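/- **Setting.** For each $N\ge 1$ let $H=H_N=(h_{ij})_{i,j=1}^N$ be a random Hermitian matrix whose entries $(h_{ij}: i\le j)$ are independent complex random variables with finite moments and $\mathbb E h_{ij}=0$. Put $s_{ij}=\mathbb E|h_{ij}|^2$ and $M=M_N=1/\max_{i,j}s_{ij}$, and assume that $\sum_j s_{ij}=1$ for all $i$, that $N^{\delta}\le M\le N$ for some fixed $\delta>0$, and that for every $p\in\mathbb N$ there is a constant $\mu_p$ with $\mathbb E|s_{ij}^{-1/2}h_{ij}|^p\le\mu_p$ for all $N,i,j$ (entries with $s_{ij}=0$ vanish almost surely and carry no condition). For $\operatorname{Im} z>0$ let $G=G(z)=(H-z)^{-1}$ and $m(z)=\frac1{2\pi}\int_{-2}^2\frac{\sqrt{4-x^2}}{x-z}\,dx$, and set $$\Lambda_o=\max_{i\ne j}|G_{ij}|,\qquad \Lambda_d=\max_i|G_{ii}-m|,\qquad \Lambda=\max\{\Lambda_o,\Lambda_d\}.$$ For $k\in\{1,\dots,N\}$ let $H^{(k)}$ be $H$ with its $k$-th row and column replaced by zero, and let $Q_kX=X-\mathbb E(X\mid H^{(k)})$. For families of nonnegative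 random variables, $X\prec Y$ means: for all $\epsilon>0$ and $D>0$ there is an $N_0(\epsilon,D)$ such that $\mathbb P[X^{(N)}(u)>N^{\epsilon}Y^{(N)}(u)]\le N^{-D}$ for all $N\ge N_0(\epsilon,D)$ and all parameters $u$; for complex $X$, $X=O_\prec(Y)$ means $|X|\prec Y$. All such bounds are uniform in the spectral parameter $z$, in the matrix indices, and in all further parameters on which the model may depend, with $\delta$ and $(\mu_p)_p$ fixed. **Theorem.** Let $\mathbf D=\mathbf D^{(N)}\subset\{z=E+\mathrm i\eta: |E|\le 10,\ M^{-1}\le\eta\le 10\}$ be a spectral domain and let $\Psi=\Psi^{(N)}(z)$, $\Psi_o=\Psi_o^{(N)}(z)$ be deterministic control parameters, each of which is admissible: there is a constant $c>0$ such that for all $N$ and all $z\in\mathbf D$, $$M^{-1/2}\le\Psi(z)\le M^{-c},$$ and likewise for $\Psi_o$. Let $T=(t_{ik})_{i,k=1}^N$ be deterministic complex weights with $|t_{ik}|\le M^{-1}$ for all $i,k$ and $\sum_k|t_{ik}|\le1$ for all $i$. Suppose that $\Lambda\prec\Psi$ and $\Lambda_o\prec\Psi_o$ uniformly in $z\in\mathbf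 D$. Then $$\sum_k t_{ik}\,Q_k\frac1{G_{kk}}=O_\prec(\Psi_o^2)$$ uniformly in $z\in\mathbf D$ and $i\in\{1,\dots,N\}$. -/

import Mathlib

open MeasureTheory ProbabilityTheory

noncomputable section

namespace LocalSemicircle

/-! ### Stochastic domination -/

/-- Stochastic domination `X ≺ Y`, uniformly in `u ∈ U N`: for all `ε, D > 0` there is a threshold,
depending on `ε` and `D` but not on `u`, beyond which `ℙ(X > N ^ ε * Y) ≤ N ^ (-D)`. The probability
space may depend on `N` and on `u`. -/
def StochDom {U : ℕ → Type*} {Ω : (N : ℕ) → U N → Type*} [∀ N u, MeasurableSpace (Ω N u)]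
    (P : (N : ℕ) → (u : U N) → Measure (Ω N u)) (X Y : (N : ℕ) → (u : U N) → Ω N u → ℝ) : Prop :=
  ∀ ε > (0 : ℝ), ∀ D > (0 : ℝ), ∃ N₀ : ℕ, ∀ N ≥ N₀, ∀ u : U N,
    (P N u).real {ω | X N u ω > (N : ℝ) ^ ε * Y N u ω} ≤ (N : ℝ) ^ (-D)

/-! ### The random matrix model -/

section Model

variable {N : ℕ} {Ω : Type*} [MeasurableSpace Ω]

/-- The variances `s i j = 𝔼 |h i j|²`. -/
def variances (P : Measure Ω) (H : Ω → Matrix (Fin N) (Fin N) ℂ) : Matrix (Fin N) (Fin N) ℝ :=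
  fun i j => ∫ ω, ‖H ω i j‖ ^ 2 ∂P

/-- The parameter `M = 1 / max_{i, j} s i j`. -/
def bandParam (P : Measure Ω) (H : Ω → Matrix (Fin N) (Fin N) ℂ) : ℝ :=
  1 / ⨆ p : Fin N × Fin N, variances P H p.1 p.2

/-- The normalized entries `ζ i j = (s i j) ^ (-1/2) * h i j`. (If `s i j = 0` this is zero; the law
of `ζ i j` is then immaterial.) -/
def normalizedEntry (P : Measure Ω) (H : Ω → Matrix (Fin N) (Fin N) ℂ) (i j : Fin N) (ω : Ω) : ℂ :=
  ((Real.sqrt (variances P H i j) : ℝ) : ℂ)⁻¹ * H ω i j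

/-- `H` is a random Hermitian matrix with independent centred entries on and above the diagonal and
a stochastic matrix of variances, with `N ^ δ ≤ M ≤ N`, whose normalized entries have `p`-th absolute
moments at most `mom p`. -/
structure IsGeneralizedWigner (P : Measure Ω) (H : Ω → Matrix (Fin N) (Fin N) ℂ)
    (δ : ℝ) (mom : ℕ → ℝ) : Prop where
  measurable : ∀ i j, Measurable fun ω => H ω i j
  hermitian : ∀ ω, (H ω).IsHermitian
  indep : iIndepFun (fun (p : {p : Fin N × Fin N // p.1 ≤ p.2}) ω => H ω p.1.1 p.1.2) P
  finite_moments : ∀ i j, ∀ p : ℕ, MemLp (fun ω => H ω i j) p P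
  centred : ∀ i j, ∫ ω, H ω i j ∂P = 0
  stochastic : ∀ i, ∑ j, variances P H i j = 1
  le_bandParam : (N : ℝ) ^ δ ≤ bandParam P H
  bandParam_le : bandParam P H ≤ N
  moment_le : ∀ i j, ∀ p : ℕ, ∫ ω, ‖normalizedEntry P H i j ω‖ ^ p ∂P ≤ mom p

/-- The minor `H^(T)`: all rows and columns with index in `T` are set to zero. -/
def minor (H : Matrix (Fin N) (Fin N) ℂ) (T : Finset (Fin N)) : Matrix (Fin N) (Fin N) ℂ :=
  fun i j => if i ∈ T ∨ j ∈ T then 0 else H i j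

/-- The partial expectation `P_k X = 𝔼(X | H^(k))`. -/
def partialExp (P : Measure Ω) (H : Ω → Matrix (Fin N) (Fin N) ℂ) (k : Fin N) (X : Ω → ℂ) : Ω → ℂ :=
  P[X | MeasurableSpace.comap (fun ω i j => minor (H ω) {k} i j) MeasurableSpace.pi]

/-- `Q_k X = X - P_k X`. -/
def fluct (P : Measure Ω) (H : Ω → Matrix (Fin N) (Fin N) ℂ) (k : Fin N) (X : Ω → ℂ) : Ω → ℂ :=
  fun ω => X ω - partialExp P H k X ω

end Model

/-! ### Resolvents and control parameters -/

/-- The Stieltjes transform `m(z)` of the semicircle law. -/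
def semicircleStieltjes (z : ℂ) : ℂ :=
  1 / (2 * Real.pi) * ∫ x in (-2 : ℝ)..2, ((Real.sqrt (4 - x ^ 2) : ℝ) : ℂ) / ((x : ℂ) - z)

/-- The Green function `G(z) = (H - z)⁻¹`. -/
def green {N : ℕ} (H : Matrix (Fin N) (Fin N) ℂ) (z : ℂ) : Matrix (Fin N) (Fin N) ℂ :=
  (H - z • (1 : Matrix (Fin N) (Fin N) ℂ))⁻¹

/-- `Λ_o = max_{i ≠ j} |G i j|`. -/
def LambdaO {N : ℕ} (H : Matrix (Fin N) (Fin N) ℂ) (z : ℂ) : ℝ :=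
  ⨆ p : {p : Fin N × Fin N // p.1 ≠ p.2}, ‖green H z p.1.1 p.1.2‖

/-- `Λ_d = max_i |G i i - m|`. -/
def LambdaD {N : ℕ} (H : Matrix (Fin N) (Fin N) ℂ) (z : ℂ) : ℝ :=
  ⨆ i : Fin N, ‖green H z i i - semicircleStieltjes z‖

/-- `Λ = max {Λ_o, Λ_d}`. -/
def Lambda {N : ℕ} (H : Matrix (Fin N) (Fin N) ℂ) (z : ℂ) : ℝ :=
  max (LambdaO H z) (LambdaD H z)

/-- `D` is contained in `{z = E + i η : |E| ≤ 10, M⁻¹ ≤ η ≤ 10}`. -/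
def IsSpectralDomain (M : ℝ) (D : Set ℂ) : Prop :=
  ∀ z ∈ D, |z.re| ≤ 10 ∧ M⁻¹ ≤ z.im ∧ z.im ≤ 10

/-- `M ^ (-1/2) ≤ Ψ ≤ M ^ (-c)` on `D`. -/
def IsAdmissible (c M : ℝ) (D : Set ℂ) (Ψ : ℂ → ℝ) : Prop :=
  ∀ z ∈ D, M ^ (-(1 / 2 : ℝ)) ≤ Ψ z ∧ Ψ z ≤ M ^ (-c)

/-- `0 ≤ |t i k| ≤ M⁻¹` and `∑ k, |t i k| ≤ 1` for all `i`. -/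
def IsWeight {N : ℕ} (M : ℝ) (T : Matrix (Fin N) (Fin N) ℂ) : Prop :=
  (∀ i k, ‖T i k‖ ≤ M⁻¹) ∧ ∀ i, ∑ k, ‖T i k‖ ≤ 1

end LocalSemicircle

end

open MeasureTheory ProbabilityTheory

noncomputable section

namespace LocalSemicircle

/-! ### Resolvent identities -/

section Resolvent

variable {N : ℕ} {H : Matrix (Fin N) (Fin N) ℂ} {z : ℂ}

/-! Write Z_k for Q_k(1/G_kk). By Schur's formula 1/G_kk is a quadratic form in row k whose
coefficients come from G^(k) and are independent of that row. Hence Z_k is explicit up to null sets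
(`centredInv`, `fluct_ae_eq`), and a large deviation bound gives Z_k only the size ψ of the
off-diagonal entries. The second factor ψ comes from the averaging: the Z_k are weakly correlated.

To exploit this, expand the moment E|∑ t_k Z_k|^n, n = 2(q+1), over index tuples κ, and let L be the
set of values taken exactly once by κ. If all other factors were independent of row l ∈ L, the
expectation of the product would vanish, since Z_l is centred given H^(l). So each factor is
resolved by inclusion-exclusion (`sum_powerset_altDiff`) into alternating differences: the piece
with index set A has the rows of L \ A (except its own index) removed from H and is differenced in
the directions of A. After multiplying out, a term in which some l ∈ L is differenced nowhere has
expectation zero (`integral_prod_altDiff_eq_zero`). In every other term each l ∈ L is differenced at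
least once.

Each difference gains a factor ψ. The reason is the identity G_ij - G_ij^(a) = G_ia G_aj / G_aa:
removing an index trades an entry for a product with one more off-diagonal entry, and a discrete
Leibniz rule iterates this (`exists_altDiff_greenMinor_le`). Hölder's inequality then bounds the
expectation of the product by a constant times ψ^(n+|L|)
(`exists_norm_integral_prod_centredInv_le`).

It remains to sum over κ. Every lone value contributes ψ, while a repeated value is paid for by its
weight |t_k| ≤ 1/M ≤ ψ^2. Together this gives n! ψ^n (`sum_prod_mul_pow_loneValues_le`), so the n-th
moment is O(ψ^(2n)). Markov's inequality with ψ = N^ε₁ Ψ_o and large n finishes the proof.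

The entries of G are controlled only outside an event of very small probability. On that event rough
moment bounds, polynomial in N, suffice (`integral_norm_pow_le_of_bound_off`): |G_ij| ≤ 1/η ≤ N
always, and the moments of 1/G_kk follow from Schur's formula. The hypothesis Λ ≺ Ψ enters only
through Λ ≤ 1/32, which with |m| ≥ 1/16 keeps the diagonal entries away from zero; the size ψ comes
from Λ_o alone. -/

theorem im_star_dotProduct_sub_smul_mulVec (hH : H.IsHermitian) (z : ℂ) (v : Fin N → ℂ) :
    (star v ⬝ᵥ ((H - z • (1 : Matrix (Fin N) (Fin N) ℂ)).mulVec v)).im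
      = -(z.im * ∑ i, ‖v i‖ ^ 2) := by
  have h1 : (star v ⬝ᵥ (H.mulVec v)).im = 0 := by
    simpa using hH.im_star_dotProduct_mulVec_self v
  have h2 : star v ⬝ᵥ v = ((∑ i, ‖v i‖ ^ 2 : ℝ) : ℂ) := by
    simp only [dotProduct, Pi.star_apply, Complex.ofReal_sum]
    refine Finset.sum_congr rfl fun i _ => ?_
    have := Complex.conj_mul' (v i)
    simpa using this
  rw [Matrix.sub_mulVec, Matrix.smul_mulVec, Matrix.one_mulVec, dotProduct_sub, dotProduct_smul, h2,
    Complex.sub_im, h1, smul_eq_mul, Complex.mul_im, Complex.ofReal_re, Complex.ofReal_im]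
  ring

/-- A kernel vector v would make the imaginary part -η‖v‖² of the quadratic form vanish. -/
theorem isUnit_det_sub_smul (hH : H.IsHermitian) (hz : 0 < z.im) :
    IsUnit (H - z • (1 : Matrix (Fin N) (Fin N) ℂ)).det := by
  rw [isUnit_iff_ne_zero]
  intro h0
  obtain ⟨v, hv, hv0⟩ := Matrix.exists_mulVec_eq_zero_iff.mpr h0
  have h := im_star_dotProduct_sub_smul_mulVec hH z v
  rw [hv0, dotProduct_zero, Complex.zero_im] at h
  have h2 : ∑ i, ‖v i‖ ^ 2 = 0 := by
    rcases mul_eq_zero.mp (neg_eq_zero.mp h.symm) with h3 | h3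
    · exact absurd h3 hz.ne'
    · exact h3
  rw [Finset.sum_eq_zero_iff_of_nonneg (fun i _ => by positivity)] at h2
  exact hv (funext fun i => by simpa using h2 i (Finset.mem_univ i))

theorem sub_smul_mul_green (hH : H.IsHermitian) (hz : 0 < z.im) :
    (H - z • (1 : Matrix (Fin N) (Fin N) ℂ)) * green H z = 1 :=
  Matrix.mul_nonsing_inv _ (isUnit_det_sub_smul hH hz)

theorem green_mul_sub_smul (hH : H.IsHermitian) (hz : 0 < z.im) :
    green H z * (H - z • (1 : Matrix (Fin N) (Fin N) ℂ)) = 1 :=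
  Matrix.nonsing_inv_mul _ (isUnit_det_sub_smul hH hz)

/-- The imaginary part identity applied to column j of G is the Ward identity η ∑_i |G_ij|² = Im
G_jj. The summand i = j yields |G_jj| ≤ 1/η, and then the whole sum is at most 1/η². -/
theorem norm_green_apply_le (hH : H.IsHermitian) (hz : 0 < z.im) (i j : Fin N) :
    ‖green H z i j‖ ≤ z.im⁻¹ := by
  have hcol : (H - z • (1 : Matrix (Fin N) (Fin N) ℂ)).mulVec (fun p => green H z p j)
      = Pi.single j 1 := by
    have h := sub_smul_mul_green hH hz
    funext p
    have := congrFun (congrFun h p) j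
    rw [Matrix.mul_apply] at this
    simp only [Matrix.mulVec, dotProduct]
    rw [this, Matrix.one_apply, Pi.single_apply]
  have h := im_star_dotProduct_sub_smul_mulVec hH z (fun p => green H z p j)
  rw [hcol, dotProduct_single, mul_one] at h
  set S := ∑ i, ‖green H z i j‖ ^ 2 with hS
  have hi : ∀ i, ‖green H z i j‖ ^ 2 ≤ S := fun i =>
    Finset.single_le_sum (f := fun i => ‖green H z i j‖ ^ 2) (fun _ _ => by positivity)
      (Finset.mem_univ i)
  have h1 : z.im * S ≤ ‖green H z j j‖ := by
    have h2 := Complex.abs_im_le_norm (star (fun p => green H z p j) j)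
    rw [h, abs_neg, abs_of_nonneg (mul_nonneg hz.le (Finset.sum_nonneg fun _ _ => by positivity))]
      at h2
    simpa using h2
  have hj : ‖green H z j j‖ ≤ z.im⁻¹ := by
    by_contra hc
    push Not at hc
    have hpos : 0 < ‖green H z j j‖ := (inv_pos.mpr hz).trans hc
    have h3 : 1 < z.im * ‖green H z j j‖ := by
      rw [inv_lt_iff_one_lt_mul₀ hz] at hc
      linarith [mul_comm z.im ‖green H z j j‖]
    have h4 := hi j
    nlinarith [mul_le_mul_of_nonneg_left h4 hz.le, mul_lt_mul_of_pos_right h3 hpos]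
  have h5 : ‖green H z i j‖ ^ 2 ≤ (z.im⁻¹) ^ 2 := by
    have h6 : S ≤ z.im⁻¹ * z.im⁻¹ := by
      have : z.im * S ≤ z.im⁻¹ := h1.trans hj
      calc S = z.im⁻¹ * (z.im * S) := by field_simp
        _ ≤ _ := by gcongr
    nlinarith [hi i]
  exact le_of_sq_le_sq h5 (inv_pos.mpr hz).le

theorem minor_isHermitian (hH : H.IsHermitian) (U : Finset (Fin N)) : (minor H U).IsHermitian := by
  ext i j
  simp only [Matrix.conjTranspose_apply, minor]
  by_cases h : i ∈ U ∨ j ∈ U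
  · simp [h, or_comm.mp h]
  · rw [if_neg h, if_neg (by tauto)]
    exact hH.apply i j

theorem minor_minor (H : Matrix (Fin N) (Fin N) ℂ) (U V : Finset (Fin N)) :
    minor (minor H U) V = minor H (U ∪ V) := by
  ext i j
  simp only [minor, Finset.mem_union]
  split_ifs <;> tauto

theorem minor_empty (H : Matrix (Fin N) (Fin N) ℂ) : minor H ∅ = H := by
  ext i j
  simp [minor]

theorem sub_smul_one_apply (H : Matrix (Fin N) (Fin N) ℂ) (z : ℂ) (i j : Fin N) :
    (H - z • (1 : Matrix (Fin N) (Fin N) ℂ)) i j = H i j - if i = j then z else 0 := by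
  simp [Matrix.sub_apply, Matrix.one_apply]

theorem ne_zero_of_im_pos (hz : 0 < z.im) : z ≠ 0 := by
  rintro rfl
  simp at hz

/-- Minors keep the size N × N, so a removed index decouples: its row and column in H^(U) - z carry
only the diagonal entry -z. The diagonal of G^(U) does not vanish there, hence i ≠ j. -/
theorem green_minor_of_mem (hH : H.IsHermitian) (hz : 0 < z.im) {U : Finset (Fin N)}
    {i j : Fin N} (hi : i ∈ U ∨ j ∈ U) (hij : i ≠ j) : green (minor H U) z i j = 0 := by
  have hz0 := ne_zero_of_im_pos hz
  rcases hi with hi | hj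
  · have h := congrFun (congrFun (sub_smul_mul_green (minor_isHermitian hH U) hz) i) j
    rw [Matrix.mul_apply, Matrix.one_apply_ne hij, Finset.sum_eq_single i] at h
    · rw [sub_smul_one_apply] at h
      simpa [minor, hi, hz0] using h
    · intro b _ hb
      rw [sub_smul_one_apply]
      simp [minor, hi, hb.symm]
    · simp
  · have h := congrFun (congrFun (green_mul_sub_smul (minor_isHermitian hH U) hz) i) j
    rw [Matrix.mul_apply, Matrix.one_apply_ne hij, Finset.sum_eq_single j] at h
    · rw [sub_smul_one_apply] at h
      simpa [minor, hj, hz0] using h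
    · intro b _ hb
      rw [sub_smul_one_apply]
      simp [minor, hj, hb]
    · simp

/-- `G - G^(a) = -G^(a) (H - H^(a)) G`, read off at a row different from `a`. -/
theorem green_apply_sub_green_minor (hH : H.IsHermitian) (hz : 0 < z.im) {a i : Fin N} (hi : i ≠ a)
    (j : Fin N) : green H z i j - green (minor H {a}) z i j
      = -(∑ p ∈ Finset.univ.erase a, green (minor H {a}) z i p * H p a) * green H z a j := by
  have hm := minor_isHermitian hH {a}
  have h1 : green H z - green (minor H {a}) z
      = green (minor H {a}) z * (minor H {a} - H) * green H z := by
    have e : minor H {a} - H = (minor H {a} - z • (1 : Matrix (Fin N) (Fin N) ℂ))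
      - (H - z • (1 : Matrix (Fin N) (Fin N) ℂ)) := by abel
    rw [e, mul_sub, sub_mul, green_mul_sub_smul hm hz, mul_assoc, sub_smul_mul_green hH hz,
      one_mul, mul_one]
  have h2 := congrFun (congrFun h1 i) j
  rw [Matrix.sub_apply] at h2
  have hrow : ∀ q, (green (minor H {a}) z * (minor H {a} - H)) i q
      = if q = a then -(∑ p ∈ Finset.univ.erase a, green (minor H {a}) z i p * H p a) else 0 := by
    intro q
    have hia : green (minor H {a}) z i a = 0 :=
      green_minor_of_mem hH hz (Or.inr (Finset.mem_singleton_self a)) hi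
    rw [Matrix.mul_apply, ← Finset.add_sum_erase _ _ (Finset.mem_univ a), hia, zero_mul, zero_add]
    split_ifs with hq
    · subst hq
      rw [← Finset.sum_neg_distrib]
      refine Finset.sum_congr rfl fun p _ => ?_
      simp [minor]
    · refine Finset.sum_eq_zero fun p hp => ?_
      have := Finset.ne_of_mem_erase hp
      simp [minor, this, hq]
  rw [h2, Matrix.mul_apply, Finset.sum_eq_single a]
  · rw [hrow, if_pos rfl]
  · intro b _ hb
    rw [hrow, if_neg hb, zero_mul]
  · simp

/-- Schur's formula: in the (k, k) entry of (H - z)G = 1, each G_pk with p ≠ k is rewritten through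
G^(k). The multiplicative form also shows that G_kk is nonzero. -/
theorem green_apply_self_mul_schur (hH : H.IsHermitian) (hz : 0 < z.im) (k : Fin N) :
    (H k k - z - ∑ p ∈ Finset.univ.erase k, ∑ q ∈ Finset.univ.erase k,
      H k p * green (minor H {k}) z p q * H q k) * green H z k k = 1 := by
  have h := congrFun (congrFun (sub_smul_mul_green hH hz) k) k
  rw [Matrix.mul_apply, Matrix.one_apply_eq, ← Finset.add_sum_erase _ _ (Finset.mem_univ k),
    sub_smul_one_apply, if_pos rfl] at h
  have h2 : ∀ p ∈ Finset.univ.erase k,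
      (H - z • (1 : Matrix (Fin N) (Fin N) ℂ)) k p * green H z p k
      = -(∑ q ∈ Finset.univ.erase k, H k p * green (minor H {k}) z p q * H q k) * green H z k k := by
    intro p hp
    have hpk := Finset.ne_of_mem_erase hp
    have h3 := green_apply_sub_green_minor hH hz hpk k
    rw [green_minor_of_mem hH hz (Or.inr (Finset.mem_singleton_self k)) hpk, sub_zero] at h3
    rw [h3, sub_smul_one_apply, if_neg hpk.symm, sub_zero, neg_mul, neg_mul, mul_neg, ← mul_assoc,
      Finset.mul_sum]
    simp only [mul_assoc]
  rw [Finset.sum_congr rfl h2, ← Finset.sum_mul, Finset.sum_neg_distrib] at h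
  rw [← h]
  ring

theorem green_apply_self_ne_zero (hH : H.IsHermitian) (hz : 0 < z.im) (k : Fin N) :
    green H z k k ≠ 0 :=
  right_ne_zero_of_mul_eq_one (green_apply_self_mul_schur hH hz k)

theorem one_div_green_apply_self (hH : H.IsHermitian) (hz : 0 < z.im) (k : Fin N) :
    1 / green H z k k = H k k - z - ∑ p ∈ Finset.univ.erase k, ∑ q ∈ Finset.univ.erase k,
      H k p * green (minor H {k}) z p q * H q k := by
  rw [div_eq_iff (green_apply_self_ne_zero hH hz k), green_apply_self_mul_schur hH hz k]

/-- The case j = a of the preceding resolvent expansion, where G_ia^(a) = 0, evaluates the common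
sum as G_ia / G_aa up to sign. This identity is the source of every gain in the averaging: removing
an index costs two entries that meet it. -/
theorem green_apply_sub_green_minor_singleton (hH : H.IsHermitian) (hz : 0 < z.im) {a i : Fin N}
    (hi : i ≠ a) (j : Fin N) : green H z i j - green (minor H {a}) z i j
      = green H z i a * green H z a j * (green H z a a)⁻¹ := by
  have h1 := green_apply_sub_green_minor hH hz hi j
  have h2 := green_apply_sub_green_minor hH hz hi a
  rw [green_minor_of_mem hH hz (Or.inr (Finset.mem_singleton_self a)) hi, sub_zero] at h2
  have h0 := green_apply_self_ne_zero hH hz a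
  rw [h1, h2]
  field_simp

/-- The Green function of the minor, as a function of the set of removed indices. -/
def greenMinor (H : Matrix (Fin N) (Fin N) ℂ) (z : ℂ) (i j : Fin N) (U : Finset (Fin N)) : ℂ :=
  green (minor H U) z i j

theorem greenMinor_sub_insert (hH : H.IsHermitian) (hz : 0 < z.im) {a i : Fin N}
    (hi : i ≠ a) (j : Fin N) (U : Finset (Fin N)) :
    greenMinor H z i j U - greenMinor H z i j (insert a U)
      = greenMinor H z i a U * greenMinor H z a j U * (greenMinor H z a a U)⁻¹ := by
  have h := green_apply_sub_green_minor_singleton (minor_isHermitian hH U) hz hi j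
  rwa [minor_minor, Finset.union_comm, ← Finset.insert_eq] at h

theorem greenMinor_self_ne_zero (hH : H.IsHermitian) (hz : 0 < z.im) (i : Fin N)
    (U : Finset (Fin N)) : greenMinor H z i i U ≠ 0 :=
  green_apply_self_ne_zero (minor_isHermitian hH U) hz i

end Resolvent

/-! ### The Stieltjes transform of the semicircle law -/

section Semicircle

open Real in
-- The substitution x = -2 cos θ removes the square root.
theorem semicircleStieltjes_eq_integral_cos {z : ℂ} (hz : 0 < z.im) :
    semicircleStieltjes z = 1 / (2 * π) *
      ∫ θ in (0 : ℝ)..π, (4 - (2 * (cos θ : ℂ)) ^ 2) / (-(2 * (cos θ : ℂ)) - z) := by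
  have hne : ∀ x : ℝ, (x : ℂ) - z ≠ 0 := fun x h => by
    have := congrArg Complex.im h
    simp at this
    exact hz.ne' this
  have hsub := intervalIntegral.integral_deriv_smul_comp (a := 0) (b := π)
    (f := fun θ => -(2 * cos θ)) (f' := fun θ => 2 * sin θ)
    (g := fun x : ℝ => ((√(4 - x ^ 2) : ℝ) : ℂ) / ((x : ℂ) - z))
    (fun θ _ => by
      have := ((hasDerivAt_cos θ).const_mul 2).fun_neg
      rwa [mul_neg, neg_neg] at this)
    (by fun_prop)
    (by
      refine Continuous.div ?_ (by fun_prop) hne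
      exact Complex.continuous_ofReal.comp (by fun_prop))
  rw [semicircleStieltjes]
  congr 1
  simp only [cos_zero, cos_pi, mul_one, mul_neg, neg_neg] at hsub
  rw [← hsub]
  refine intervalIntegral.integral_congr fun θ hθ => ?_
  rw [Set.uIcc_of_le pi_pos.le] at hθ
  have hs : 0 ≤ sin θ := sin_nonneg_of_nonneg_of_le_pi hθ.1 hθ.2
  have h4 : √(4 - (-(2 * cos θ)) ^ 2) = 2 * sin θ := by
    rw [show 4 - (-(2 * cos θ)) ^ 2 = (2 * sin θ) ^ 2 by nlinarith [sin_sq_add_cos_sq θ]]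
    exact sqrt_sq (by positivity)
  have h5 : (4 - (2 * (cos θ : ℂ)) ^ 2) = ((2 * sin θ : ℝ) : ℂ) * ((2 * sin θ : ℝ) : ℂ) := by
    rw [← Complex.ofReal_mul,
      show 2 * sin θ * (2 * sin θ) = 4 - (2 * cos θ) ^ 2 by nlinarith [sin_sq_add_cos_sq θ]]
    push_cast
    ring
  simp only [Function.comp, h4, Complex.real_smul, h5]
  push_cast
  ring

open Real in
-- By symmetry the integral is half of that over the full circle. There, with ζ = e^(iθ) and z = -(w
-- + 1/w), the integrand splits into the poles w and 1/w. Only w lies inside the circle, so Cauchy's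
-- formula gives the value.
theorem integral_inv_cos {z w : ℂ} (hz : 0 < z.im) (hw : ‖w‖ < 1) (hzw : w ^ 2 + z * w + 1 = 0) :
    ∫ θ in (0 : ℝ)..π, (-(2 * (cos θ : ℂ)) - z)⁻¹ = π / (w⁻¹ - w) := by
  have hw0 : w ≠ 0 := by
    rintro rfl
    simp at hzw
  have hz' : z = -(w + w⁻¹) := by
    field_simp
    linear_combination hzw
  have hne : ∀ x : ℝ, -(2 * (cos x : ℂ)) - z ≠ 0 := fun x h => by
    have h2 := congrArg Complex.im h
    have h3 : (2 * (cos x : ℂ)).im = 0 := by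
      rw [show (2 * (cos x : ℂ)) = ((2 * cos x : ℝ) : ℂ) by push_cast; ring, Complex.ofReal_im]
    rw [Complex.sub_im, Complex.neg_im, h3] at h2
    simp at h2
    exact hz.ne' h2
  have hcont : Continuous fun θ : ℝ => (-(2 * (cos θ : ℂ)) - z)⁻¹ := by
    refine Continuous.inv₀ (by fun_prop) hne
  set I := ∫ θ in (0 : ℝ)..π, (-(2 * (cos θ : ℂ)) - z)⁻¹ with hI
  have hdouble : ∫ θ in (0 : ℝ)..(2 * π), (-(2 * (cos θ : ℂ)) - z)⁻¹ = 2 * I := by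
    rw [← intervalIntegral.integral_add_adjacent_intervals (b := π)
      (hcont.intervalIntegrable _ _) (hcont.intervalIntegrable _ _)]
    have h := intervalIntegral.integral_comp_sub_left (a := π) (b := 2 * π)
      (fun θ : ℝ => (-(2 * (cos θ : ℂ)) - z)⁻¹) (2 * π)
    simp only [cos_two_pi_sub, sub_self] at h
    rw [h, show 2 * π - π = π by ring, ← hI, two_mul]
  have hw1 : 1 < ‖w⁻¹‖ := by
    rw [norm_inv]
    exact (one_lt_inv₀ (norm_pos_iff.mpr hw0)).mpr hw
  have hwd : w - w⁻¹ ≠ 0 := fun h => by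
    rw [← sub_eq_zero.mp h] at hw1
    exact lt_asymm hw hw1
  have hc1 : ∮ ζ in C(0, 1), (ζ - w)⁻¹ = 2 * π * Complex.I :=
    circleIntegral.integral_sub_inv_of_mem_ball (by simpa using hw)
  have hmem : ∀ ζ ∈ Metric.closedBall (0 : ℂ) 1, ζ - w⁻¹ ≠ 0 := fun ζ hζ h => by
    rw [sub_eq_zero] at h
    rw [h] at hζ
    simp only [mem_closedBall_zero_iff] at hζ
    linarith
  have hc2 : ∮ ζ in C(0, 1), (ζ - w⁻¹)⁻¹ = 0 := by
    refine Complex.circleIntegral_eq_zero_of_differentiable_on_off_countable zero_le_one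
      Set.countable_empty ?_ ?_
    · exact ContinuousOn.inv₀ (by fun_prop) hmem
    · intro ζ hζ
      refine DifferentiableAt.inv (by fun_prop) (hmem ζ (Metric.ball_subset_closedBall hζ.1))
  have hsph : ∀ ζ ∈ Metric.sphere (0 : ℂ) 1, ζ - w ≠ 0 := fun ζ hζ h => by
    rw [sub_eq_zero] at h
    rw [h] at hζ
    simp only [mem_sphere_zero_iff_norm] at hζ
    linarith
  have hci1 : CircleIntegrable (fun ζ : ℂ => (ζ - w)⁻¹) 0 1 :=
    ContinuousOn.circleIntegrable zero_le_one (ContinuousOn.inv₀ (by fun_prop) hsph)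
  have hci2 : CircleIntegrable (fun ζ : ℂ => (ζ - w⁻¹)⁻¹) 0 1 :=
    ContinuousOn.circleIntegrable zero_le_one (ContinuousOn.inv₀ (by fun_prop)
      fun ζ hζ => hmem ζ (Metric.sphere_subset_closedBall hζ))
  have hc : ∮ ζ in C(0, 1), ((ζ - w)⁻¹ - (ζ - w⁻¹)⁻¹) = 2 * π * Complex.I := by
    rw [circleIntegral.integral_sub hci1 hci2, hc1, hc2, sub_zero]
  have hkey : ∮ ζ in C(0, 1), ((ζ - w)⁻¹ - (ζ - w⁻¹)⁻¹)
      = ∫ θ in (0 : ℝ)..(2 * π), (-(Complex.I * (w - w⁻¹))) * (-(2 * (cos θ : ℂ)) - z)⁻¹ := by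
    rw [circleIntegral]
    refine intervalIntegral.integral_congr fun θ _ => ?_
    simp only [deriv_circleMap, smul_eq_mul]
    have hζ : circleMap 0 1 θ ∈ Metric.sphere (0 : ℂ) 1 :=
      circleMap_mem_sphere 0 zero_le_one θ
    have h1 := hsph _ hζ
    have h2 := hmem _ (Metric.sphere_subset_closedBall hζ)
    have h0 : circleMap 0 1 θ ≠ 0 := circleMap_ne_center one_ne_zero
    have hcos : 2 * (cos θ : ℂ) = circleMap 0 1 θ + (circleMap 0 1 θ)⁻¹ := by
      rw [circleMap_zero, Complex.ofReal_one, one_mul, ← Complex.exp_neg, Complex.ofReal_cos,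
        Complex.cos, neg_mul]
      ring
    have h3 := hne θ
    rw [hcos, hz'] at h3 ⊢
    set ζ := circleMap 0 1 θ
    have h4 : -(ζ + ζ⁻¹) - -(w + w⁻¹) = -((ζ - w) * (ζ - w⁻¹) * ζ⁻¹) := by
      field_simp
      ring
    rw [h4]
    have h5 : (ζ - w)⁻¹ - (ζ - w⁻¹)⁻¹ = (w - w⁻¹) * ((ζ - w)⁻¹ * (ζ - w⁻¹)⁻¹) := by
      rw [inv_sub_inv h1 h2, div_eq_mul_inv, mul_inv]
      ring
    rw [h5, inv_neg, mul_inv, mul_inv, inv_inv]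
    ring
  rw [hkey, intervalIntegral.integral_const_mul, hdouble] at hc
  have hwd' : w⁻¹ - w ≠ 0 := fun h => hwd (by rw [← neg_sub, h, neg_zero])
  rw [eq_div_iff hwd']
  have hI0 := Complex.I_ne_zero
  have : Complex.I * 2 * (I * (w⁻¹ - w) - π) = 0 := by linear_combination hc
  have h2 := (mul_eq_zero.mp this).resolve_left (by simp)
  exact sub_eq_zero.mp h2

open Real in
-- Polynomial division by the denominator leaves the remainder 4 - z² = -(1/w - w)², which
-- multiplies the integral just computed.
theorem semicircleStieltjes_eq_root {z w : ℂ} (hz : 0 < z.im) (hw : ‖w‖ < 1)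
    (hzw : w ^ 2 + z * w + 1 = 0) : semicircleStieltjes z = w := by
  have hw0 : w ≠ 0 := by
    rintro rfl
    simp at hzw
  have hne : ∀ x : ℝ, -(2 * (cos x : ℂ)) - z ≠ 0 := fun x h => by
    have h2 := congrArg Complex.im h
    have h3 : (2 * (cos x : ℂ)).im = 0 := by
      rw [show (2 * (cos x : ℂ)) = ((2 * cos x : ℝ) : ℂ) by push_cast; ring, Complex.ofReal_im]
    rw [Complex.sub_im, Complex.neg_im, h3] at h2
    simp at h2
    exact hz.ne' h2
  have hcont : Continuous fun θ : ℝ => (-(2 * (cos θ : ℂ)) - z)⁻¹ :=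
    Continuous.inv₀ (by fun_prop) hne
  have hsplit : ∀ θ : ℝ, (4 - (2 * (cos θ : ℂ)) ^ 2) / (-(2 * (cos θ : ℂ)) - z)
      = (2 * (cos θ : ℂ) - z) + (4 - z ^ 2) * (-(2 * (cos θ : ℂ)) - z)⁻¹ := fun θ => by
    have := hne θ
    field_simp
    ring
  have hint : ∫ θ in (0 : ℝ)..π, (2 * (cos θ : ℂ) - z) = -(π * z) := by
    rw [intervalIntegral.integral_sub
      (Continuous.intervalIntegrable (by fun_prop) _ _) (Continuous.intervalIntegrable (by fun_prop) _ _),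
      intervalIntegral.integral_const_mul, intervalIntegral.integral_const]
    have : ∫ θ in (0 : ℝ)..π, (cos θ : ℂ) = ((∫ θ in (0 : ℝ)..π, cos θ : ℝ) : ℂ) :=
      intervalIntegral.integral_ofReal
    rw [this, integral_cos]
    simp
  rw [semicircleStieltjes_eq_integral_cos hz, intervalIntegral.integral_congr fun θ _ => hsplit θ,
    intervalIntegral.integral_add (Continuous.intervalIntegrable (by fun_prop) _ _)
      ((hcont.const_mul _ |>.intervalIntegrable _ _)), intervalIntegral.integral_const_mul, hint,
    integral_inv_cos hz hw hzw]
  have hz' : z = -(w + w⁻¹) := by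
    field_simp
    linear_combination hzw
  have hwd : w⁻¹ - w ≠ 0 := fun h => by
    have h1 : w⁻¹ = w := sub_eq_zero.mp h
    have h2 : ‖w‖⁻¹ = ‖w‖ := by rw [← norm_inv, h1]
    have h3 := (one_lt_inv₀ (norm_pos_iff.mpr hw0)).mpr hw
    rw [h2] at h3
    exact lt_asymm hw h3
  have h4 : (4 - z ^ 2) = -(w⁻¹ - w) ^ 2 := by
    rw [hz']
    field_simp
    ring
  have hpi : (π : ℂ) ≠ 0 := by exact_mod_cast pi_ne_zero
  rw [h4, show -(w⁻¹ - w) ^ 2 * (π / (w⁻¹ - w)) = -(π * (w⁻¹ - w)) by field_simp, hz']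
  field_simp
  ring

/-- The two roots have product 1. If both lay on the unit circle they would be conjugate, and z,
minus their sum, would be real. -/
theorem exists_norm_lt_one_root {z : ℂ} (hz : 0 < z.im) :
    ∃ w : ℂ, ‖w‖ < 1 ∧ w ^ 2 + z * w + 1 = 0 := by
  obtain ⟨s, hs⟩ := IsAlgClosed.exists_eq_mul_self (z ^ 2 - 4)
  have hroot : ∀ w : ℂ, w = (-z + s) / 2 ∨ w = (-z - s) / 2 → w ^ 2 + z * w + 1 = 0 := by
    rintro w (rfl | rfl) <;> linear_combination (-1 / 4 : ℂ) * hs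
  have hprod : (-z + s) / 2 * ((-z - s) / 2) = 1 := by linear_combination (1 / 4 : ℂ) * hs
  have hn : ‖(-z + s) / 2‖ * ‖(-z - s) / 2‖ = 1 := by rw [← norm_mul, hprod, norm_one]
  rcases lt_trichotomy ‖(-z + s) / 2‖ 1 with h | h | h
  · exact ⟨_, h, hroot _ (Or.inl rfl)⟩
  · exfalso
    set w := (-z + s) / 2 with hw
    have hconj : (-z - s) / 2 = star w := by
      have h1 : star w * w = 1 := by
        have := Complex.conj_mul' w
        rw [h] at this
        simpa using this
      have hw0 : w ≠ 0 := by
        intro h0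
        rw [h0, norm_zero] at h
        exact zero_ne_one h
      exact mul_left_cancel₀ hw0 (by rw [hprod, mul_comm, h1])
    have hz2 : z = -(w + star w) := by
      rw [← hconj, hw]
      ring
    rw [hz2] at hz
    simp at hz
  · refine ⟨_, ?_, hroot _ (Or.inr rfl)⟩
    by_contra hc
    push Not at hc
    nlinarith

/-- The lower bound follows from m(m + z) = -1 and |m| ≤ 1. -/
theorem norm_semicircleStieltjes_bounds {z : ℂ} (hz : 0 < z.im) {K : ℝ} (hK : ‖z‖ ≤ K) :
    ‖semicircleStieltjes z‖ ≤ 1 ∧ (K + 1)⁻¹ ≤ ‖semicircleStieltjes z‖ := by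
  obtain ⟨w, hw, hzw⟩ := exists_norm_lt_one_root hz
  rw [semicircleStieltjes_eq_root hz hw hzw]
  refine ⟨hw.le, ?_⟩
  have hK0 : 0 ≤ K := (norm_nonneg z).trans hK
  have h1 : 1 ≤ ‖w‖ * (K + 1) := by
    have h2 : w * (w + z) = -1 := by linear_combination hzw
    have h3 : ‖w‖ * ‖w + z‖ = 1 := by rw [← norm_mul, h2, norm_neg, norm_one]
    rw [← h3]
    gcongr
    exact (norm_add_le _ _).trans (by linarith)
  rwa [inv_le_iff_one_le_mul₀ (by positivity)]

end Semicircle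

/-! ### Alternating differences of set functions -/

section AltDiff

variable {α : Type*} [DecidableEq α]

/-- The alternating difference `∑ S ⊆ A, (-1) ^ |S| f (U ∪ S)`. -/
def altDiff (A : Finset α) (f : Finset α → ℂ) (U : Finset α) : ℂ :=
  ∑ S ∈ A.powerset, (-1) ^ S.card * f (U ∪ S)

theorem altDiff_empty (f : Finset α → ℂ) (U : Finset α) : altDiff ∅ f U = f U := by
  simp [altDiff]

theorem altDiff_insert {a : α} {A : Finset α} (ha : a ∉ A) (f : Finset α → ℂ) (U : Finset α) :
    altDiff (insert a A) f U = altDiff A (fun W => f W - f (insert a W)) U := by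
  rw [altDiff, altDiff, Finset.sum_powerset_insert ha, ← Finset.sum_add_distrib]
  refine Finset.sum_congr rfl fun S hS => ?_
  have : a ∉ S := fun h => ha (Finset.mem_powerset.mp hS h)
  rw [Finset.card_insert_of_notMem this, Finset.union_insert]
  ring

theorem altDiff_add (A : Finset α) (f g : Finset α → ℂ) (U : Finset α) :
    altDiff A (fun W => f W + g W) U = altDiff A f U + altDiff A g U := by
  simp only [altDiff, mul_add, Finset.sum_add_distrib]

theorem altDiff_congr {A : Finset α} {f g : Finset α → ℂ} {U : Finset α}
    (h : ∀ S ⊆ A, f (U ∪ S) = g (U ∪ S)) : altDiff A f U = altDiff A g U :=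
  Finset.sum_congr rfl fun S hS => by rw [h S (Finset.mem_powerset.mp hS)]

theorem altDiff_comp_insert (a : α) (A : Finset α) (f : Finset α → ℂ) (U : Finset α) :
    altDiff A (fun W => f (insert a W)) U = altDiff A f (insert a U) := by
  simp only [altDiff, Finset.insert_union]

/-- A set function is the sum of its alternating differences over all subsets. -/
theorem sum_powerset_altDiff (B : Finset α) (f : Finset α → ℂ) (U : Finset α) :
    ∑ A ∈ B.powerset, altDiff A f (U ∪ (B \ A)) = f U := by
  induction B using Finset.induction_on generalizing f U with
  | empty => simp [altDiff_empty]
  | insert a B ha ih =>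
    -- By induction, the subsets without a sum to f (insert a U), and those containing a sum to f U
    -- - f (insert a U).
    rw [Finset.sum_powerset_insert ha]
    have h1 : ∀ A ∈ B.powerset, altDiff A f (U ∪ (insert a B \ A))
        = altDiff A f (insert a U ∪ (B \ A)) := fun A hA => by
      have : a ∉ A := fun h => ha (Finset.mem_powerset.mp hA h)
      rw [Finset.insert_sdiff_of_notMem _ this, Finset.union_insert, Finset.insert_union]
    have h2 : ∀ A ∈ B.powerset, altDiff (insert a A) f (U ∪ (insert a B \ insert a A))
        = altDiff A (fun W => f W - f (insert a W)) (U ∪ (B \ A)) := fun A hA => by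
      have : a ∉ A := fun h => ha (Finset.mem_powerset.mp hA h)
      rw [altDiff_insert this, Finset.insert_sdiff_insert, Finset.sdiff_insert_of_notMem ha]
    rw [Finset.sum_congr rfl h1, Finset.sum_congr rfl h2, ih, ih]
    ring

/-- All alternating differences of `f` within `U ∪ A` gain a factor `ψ` for each differenced
index, starting from `ψ ^ d`. -/
def DiffBound (ψ : ℝ) (U A : Finset α) (d : ℕ) (C : ℝ) (f : Finset α → ℂ) : Prop :=
  ∀ B ⊆ A, ∀ A' ⊆ A, Disjoint B A' → ‖altDiff A' f (U ∪ B)‖ ≤ C * ψ ^ (d + A'.card)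

theorem DiffBound.restrict {ψ : ℝ} {U A B A' : Finset α} {d : ℕ} {C : ℝ} {f : Finset α → ℂ}
    (h : DiffBound ψ U A d C f) (hB : B ⊆ A) (hA' : A' ⊆ A) (hd : Disjoint B A') :
    DiffBound ψ (U ∪ B) A' d C f := fun B₂ hB₂ A₂ hA₂ hd₂ => by
  rw [Finset.union_assoc]
  exact h _ (Finset.union_subset hB (hB₂.trans hA')) _ (hA₂.trans hA')
    (Finset.disjoint_union_left.mpr ⟨Finset.disjoint_of_subset_right hA₂ hd, hd₂⟩)

/-- Discrete Leibniz rule: with Δ_a the difference in direction a, Δ_a(fg) = (Δ_a f) g + f(· ∪ {a})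
Δ_a g. Each index puts its ψ on one of the factors and doubles the number of terms, hence 2^|A|. -/
theorem norm_altDiff_mul_le {ψ : ℝ} {A : Finset α} :
    ∀ {U : Finset α} {d e : ℕ} {C C' : ℝ} {f g : Finset α → ℂ},
    DiffBound ψ U A d C f → DiffBound ψ U A e C' g →
    ‖altDiff A (fun W => f W * g W) U‖ ≤ 2 ^ A.card * (C * C') * ψ ^ (d + e + A.card) := by
  induction A using Finset.induction_on with
  | empty =>
    intro U d e C C' f g hf hg
    have h1 := hf ∅ (by simp) ∅ (by simp) (by simp)
    have h2 := hg ∅ (by simp) ∅ (by simp) (by simp)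
    simp only [altDiff_empty, Finset.union_empty, Finset.card_empty, add_zero] at *
    rw [norm_mul]
    calc ‖f U‖ * ‖g U‖ ≤ (C * ψ ^ d) * (C' * ψ ^ e) :=
          mul_le_mul h1 h2 (norm_nonneg _) ((norm_nonneg _).trans h1)
      _ = _ := by ring
  | insert a A ha ih =>
    intro U d e C C' f g hf hg
    have hdiff : ∀ {d : ℕ} {C : ℝ} {f : Finset α → ℂ}, DiffBound ψ U (insert a A) d C f →
        DiffBound ψ U A (d + 1) C (fun W => f W - f (insert a W)) := by
      intro d C f hf B hB A' hA' hd
      have haA' : a ∉ A' := fun h => ha (hA' h)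
      have haB : a ∉ B := fun h => ha (hB h)
      have := hf B (hB.trans (Finset.subset_insert _ _)) (insert a A')
        (Finset.insert_subset_insert _ hA') (Finset.disjoint_insert_right.mpr ⟨haB, hd⟩)
      rw [altDiff_insert haA', Finset.card_insert_of_notMem haA'] at this
      convert this using 3
      ring
    -- The shift by a moves the base set; `DiffBound` ranges over all base sets U ∪ B so that this
    -- is covered.
    have hshift : DiffBound ψ U A d C (fun W => f (insert a W)) := by
      intro B hB A' hA' hd
      have haA' : a ∉ A' := fun h => ha (hA' h)
      have := hf (insert a B) (Finset.insert_subset_insert _ hB) A'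
        (hA'.trans (Finset.subset_insert _ _)) (Finset.disjoint_insert_left.mpr ⟨haA', hd⟩)
      rwa [altDiff_comp_insert, ← Finset.union_insert]
    have hres : DiffBound ψ U A e C' g := by
      have := hg.restrict (Finset.empty_subset _) (Finset.subset_insert a A)
        (Finset.disjoint_empty_left A)
      rwa [Finset.union_empty] at this
    have hsplit : altDiff (insert a A) (fun W => f W * g W) U
        = altDiff A (fun W => (f W - f (insert a W)) * g W) U
          + altDiff A (fun W => f (insert a W) * (g W - g (insert a W))) U := by
      rw [altDiff_insert ha, ← altDiff_add]
      congr 1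
      funext W
      ring
    rw [hsplit, Finset.card_insert_of_notMem ha]
    refine (norm_add_le _ _).trans ((add_le_add (ih (hdiff hf) hres)
      (ih hshift (hdiff hg))).trans (le_of_eq ?_))
    ring

theorem DiffBound.mul {ψ : ℝ} (hψ : 0 ≤ ψ) {U A : Finset α} {d e : ℕ} {C C' : ℝ} (hC : 0 ≤ C)
    (hC' : 0 ≤ C') {f g : Finset α → ℂ} (hf : DiffBound ψ U A d C f)
    (hg : DiffBound ψ U A e C' g) :
    DiffBound ψ U A (d + e) (2 ^ A.card * (C * C')) (fun W => f W * g W) := by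
  intro B hB A' hA' hd
  refine (norm_altDiff_mul_le (hf.restrict hB hA' hd) (hg.restrict hB hA' hd)).trans ?_
  gcongr
  norm_num

end AltDiff

/-! ### Deterministic bounds on minors -/

section Minors

variable {N : ℕ} {H : Matrix (Fin N) (Fin N) ℂ} {z : ℂ}

/-- The entries of all Green functions `G^(W)`, `W ⊆ V`, are small off the diagonal and of order
one on it. -/
def GreenControl (H : Matrix (Fin N) (Fin N) ℂ) (z : ℂ) (ψ K : ℝ) (V : Finset (Fin N)) : Prop :=
  ∀ W ⊆ V, ∀ i ∉ W, (∀ j ∉ W, i ≠ j → ‖greenMinor H z i j W‖ ≤ ψ) ∧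
    ‖greenMinor H z i i W‖ ≤ K ∧ ‖(greenMinor H z i i W)⁻¹‖ ≤ K

/-- Induction on |A|. Differencing in a turns G_ij into G_ia G_aj / G_aa and 1/G_ii into -G_ia G_ai
/ (G_aa G_ii G_ii^(a)); the remaining differences of these products follow from the induction
hypothesis and the Leibniz rule. Both products contain two off-diagonal entries, so 1/G_ii gains one
power beyond |A| once A is nonempty. The weaker third bound also covers A = ∅, which the induction
needs. -/
theorem exists_altDiff_greenMinor_le (K : ℝ) (n : ℕ) : ∃ C : ℝ, 1 ≤ C ∧
    ∀ {N : ℕ} {H : Matrix (Fin N) (Fin N) ℂ} {z : ℂ} {ψ : ℝ} {V : Finset (Fin N)},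
    H.IsHermitian → 0 < z.im → 0 ≤ ψ → ψ ≤ 1 → GreenControl H z ψ K V →
    ∀ U A : Finset (Fin N), U ∪ A ⊆ V → Disjoint U A → A.card ≤ n → ∀ i ∉ U ∪ A,
      (∀ j ∉ U ∪ A, i ≠ j → ‖altDiff A (greenMinor H z i j) U‖ ≤ C * ψ ^ (1 + A.card)) ∧
      ‖altDiff A (greenMinor H z i i) U‖ ≤ C * ψ ^ A.card ∧
      ‖altDiff A (fun W => (greenMinor H z i i W)⁻¹) U‖ ≤ C * ψ ^ A.card ∧
      (A.Nonempty → ‖altDiff A (fun W => (greenMinor H z i i W)⁻¹) U‖ ≤ C * ψ ^ (1 + A.card)) := by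
  have hbase : ∀ {N : ℕ} {H : Matrix (Fin N) (Fin N) ℂ} {z : ℂ} {ψ : ℝ} {V : Finset (Fin N)},
      0 ≤ ψ → GreenControl H z ψ K V → ∀ (C : ℝ), 1 ≤ C → K ≤ C → ∀ U ⊆ V, ∀ i ∉ U,
      (∀ j ∉ U, i ≠ j → ‖altDiff ∅ (greenMinor H z i j) U‖ ≤ C * ψ ^ (1 + (∅ : Finset (Fin N)).card)) ∧
      ‖altDiff ∅ (greenMinor H z i i) U‖ ≤ C * ψ ^ (∅ : Finset (Fin N)).card ∧
      ‖altDiff ∅ (fun W => (greenMinor H z i i W)⁻¹) U‖ ≤ C * ψ ^ (∅ : Finset (Fin N)).card ∧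
      ((∅ : Finset (Fin N)).Nonempty → ‖altDiff ∅ (fun W => (greenMinor H z i i W)⁻¹) U‖
        ≤ C * ψ ^ (1 + (∅ : Finset (Fin N)).card)) := by
    intro N H z ψ V hψ0 hg C hC1 hKC U hUV i hi
    obtain ⟨h1, h2, h3⟩ := hg U hUV i hi
    simp only [altDiff_empty, Finset.card_empty, add_zero, pow_one, pow_zero, mul_one,
      Finset.not_nonempty_empty, false_imp_iff, and_true]
    refine ⟨fun j hj hij => (h1 j hj hij).trans (le_mul_of_one_le_left hψ0 hC1),
      h2.trans hKC, h3.trans hKC⟩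
  induction n with
  | zero =>
    refine ⟨max K 1, le_max_right _ _, ?_⟩
    intro N H z ψ V hH hz hψ0 hψ1 hg U A hUA hd hA i hi
    obtain rfl : A = ∅ := Finset.card_eq_zero.mp (Nat.le_zero.mp hA)
    rw [Finset.union_empty] at *
    exact hbase hψ0 hg _ (le_max_right _ _) (le_max_left _ _) U hUA i hi
  | succ n ih =>
    obtain ⟨C, hC1, ih⟩ := ih
    have hC0 : 0 ≤ C := zero_le_one.trans hC1
    -- C₂ comes from two applications of the Leibniz rule, for G_ia G_aj / G_aa; C₃ from two more,
    -- for the further factors 1/G_ii and 1/G_ii^(a).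
    set C₂ : ℝ := 2 ^ n * (2 ^ n * (C * C) * C) with hC₂
    set C₃ : ℝ := 2 ^ n * (2 ^ n * (C₂ * C) * C) with hC₃
    have hp : (1 : ℝ) ≤ 2 ^ n := one_le_pow₀ (by norm_num)
    have hC2 : C ≤ C₂ := by
      calc C = 1 * (1 * (1 * 1) * C) := by ring
        _ ≤ _ := by rw [hC₂]; gcongr
    have hC23 : C₂ ≤ C₃ := by
      have : 0 ≤ C₂ := hC0.trans hC2
      calc C₂ = 1 * (1 * (C₂ * 1) * 1) := by ring
        _ ≤ _ := by rw [hC₃]; gcongr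
    have hC₂0 : 0 ≤ C₂ := hC0.trans hC2
    have hC₃0 : 0 ≤ C₃ := hC₂0.trans hC23
    refine ⟨max C₃ K, le_max_of_le_left (hC1.trans (hC2.trans hC23)), ?_⟩
    intro N H z ψ V hH hz hψ0 hψ1 hg U A hUA hd hA i hi
    rcases A.eq_empty_or_nonempty with rfl | ⟨a, haA⟩
    · rw [Finset.union_empty] at *
      exact hbase hψ0 hg _ (le_max_of_le_left (hC1.trans (hC2.trans hC23))) (le_max_right _ _) U
        hUA i hi
    obtain ⟨A, haA', rfl⟩ : ∃ A', a ∉ A' ∧ insert a A' = A :=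
      ⟨A.erase a, Finset.notMem_erase a A, Finset.insert_erase haA⟩
    rw [Finset.card_insert_of_notMem haA'] at *
    have hAn : A.card ≤ n := by omega
    have haU : a ∉ U := fun h => (Finset.disjoint_left.mp hd h) haA
    have hsub : ∀ {B A' : Finset (Fin N)}, B ⊆ A → A' ⊆ A → U ∪ B ∪ A' ⊆ U ∪ insert a A :=
      fun hB hA' => Finset.union_subset (Finset.union_subset_union_right
        (hB.trans (Finset.subset_insert _ _)))
        ((hA'.trans (Finset.subset_insert _ _)).trans Finset.subset_union_right)
    have hdU : Disjoint U A := Finset.disjoint_of_subset_right (Finset.subset_insert _ _) hd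
    have hdis : ∀ {B A' : Finset (Fin N)}, A' ⊆ A → Disjoint B A' → Disjoint (U ∪ B) A' :=
      fun hA' hBA => Finset.disjoint_union_left.mpr
        ⟨Finset.disjoint_of_subset_right hA' hdU, hBA⟩
    have hanot : ∀ {B A' : Finset (Fin N)}, B ⊆ A → A' ⊆ A → a ∉ U ∪ B ∪ A' := fun hB hA' h => by
      rcases Finset.mem_union.mp h with h | h
      · rcases Finset.mem_union.mp h with h | h
        · exact haU h
        · exact haA' (hB h)
      · exact haA' (hA' h)
    have hoff : ∀ p q : Fin N, p ∉ U ∪ insert a A ∨ p = a → q ∉ U ∪ insert a A ∨ q = a → p ≠ q →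
        DiffBound ψ U A 1 C (greenMinor H z p q) := by
      intro p q hp hq hpq B hB A' hA' hBA
      have key : ∀ {p}, p ∉ U ∪ insert a A ∨ p = a → p ∉ U ∪ B ∪ A' := by
        rintro p (h | rfl)
        · exact fun h2 => h (hsub hB hA' h2)
        · exact hanot hB hA'
      exact (ih hH hz hψ0 hψ1 hg (U ∪ B) A' ((hsub hB hA').trans hUA) (hdis hA' hBA)
        ((Finset.card_le_card hA').trans hAn) p (key hp)).1 q (key hq) hpq
    have hinv : ∀ p : Fin N, p ∉ U ∪ insert a A ∨ p = a →
        DiffBound ψ U A 0 C (fun W => (greenMinor H z p p W)⁻¹) := by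
      intro p hp B hB A' hA' hBA
      have hp' : p ∉ U ∪ B ∪ A' := by
        rcases hp with h | rfl
        · exact fun h2 => h (hsub hB hA' h2)
        · exact hanot hB hA'
      rw [zero_add]
      exact (ih hH hz hψ0 hψ1 hg (U ∪ B) A' ((hsub hB hA').trans hUA) (hdis hA' hBA)
        ((Finset.card_le_card hA').trans hAn) p hp').2.2.1
    have hinv' : DiffBound ψ U A 0 C (fun W => (greenMinor H z i i (insert a W))⁻¹) := by
      intro B hB A' hA' hBA
      have e : altDiff A' (fun W => (greenMinor H z i i (insert a W))⁻¹) (U ∪ B)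
          = altDiff A' (fun W => (greenMinor H z i i W)⁻¹) (insert a (U ∪ B)) :=
        altDiff_comp_insert a A' (fun W => (greenMinor H z i i W)⁻¹) (U ∪ B)
      have hs : insert a (U ∪ B) ∪ A' ⊆ U ∪ insert a A := by
        rw [Finset.insert_union]
        exact Finset.insert_subset (Finset.mem_union_right _ (Finset.mem_insert_self _ _))
          (hsub hB hA')
      rw [zero_add, e]
      exact (ih hH hz hψ0 hψ1 hg (insert a (U ∪ B)) A' (hs.trans hUA)
        (Finset.disjoint_insert_left.mpr ⟨fun h => haA' (hA' h), hdis hA' hBA⟩)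
        ((Finset.card_le_card hA').trans hAn) i (fun h => hi (hs h))).2.2.1
    have hia : i ≠ a := fun h => hi (h ▸ Finset.mem_union_right _ (Finset.mem_insert_self _ _))
    have hprod : ∀ j ∉ U ∪ insert a A, DiffBound ψ U A (1 + 1 + 0) C₂
        (fun W => greenMinor H z i a W * greenMinor H z a j W * (greenMinor H z a a W)⁻¹) := by
      intro j hj
      have hja : j ≠ a := fun h => hj (h ▸ Finset.mem_union_right _ (Finset.mem_insert_self _ _))
      have h1 := ((hoff i a (Or.inl hi) (Or.inr rfl) hia).mul hψ0 hC0 hC0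
        (hoff a j (Or.inr rfl) (Or.inl hj) hja.symm)).mul hψ0 (by positivity) hC0
        (hinv a (Or.inr rfl))
      intro B hB A' hA' hBA
      refine (h1 B hB A' hA' hBA).trans ?_
      rw [hC₂]
      gcongr <;> norm_num
    have hG : ∀ j ∉ U ∪ insert a A, ‖altDiff (insert a A) (greenMinor H z i j) U‖
        ≤ C₂ * ψ ^ (1 + (A.card + 1)) := by
      intro j hj
      have h := hprod j hj ∅ (Finset.empty_subset _) A subset_rfl (Finset.disjoint_empty_left _)
      rw [Finset.union_empty] at h
      rw [altDiff_insert haA', altDiff_congr (g := fun W => greenMinor H z i a W * greenMinor H z a j W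
        * (greenMinor H z a a W)⁻¹) (fun S _ => greenMinor_sub_insert hH hz hia j (U ∪ S))]
      refine h.trans (le_of_eq ?_)
      ring
    have hGi : ‖altDiff (insert a A) (fun W => (greenMinor H z i i W)⁻¹) U‖
        ≤ C₃ * ψ ^ (1 + (A.card + 1)) := by
      have h1 := ((hprod i hi).mul hψ0 hC₂0 hC0 (hinv i (Or.inl hi))).mul hψ0 (by positivity) hC0
        hinv'
      have h := h1 ∅ (Finset.empty_subset _) A subset_rfl (Finset.disjoint_empty_left _)
      rw [Finset.union_empty] at h
      have e : altDiff (insert a A) (fun W => (greenMinor H z i i W)⁻¹) U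
          = -altDiff A (fun W => greenMinor H z i a W * greenMinor H z a i W
            * (greenMinor H z a a W)⁻¹ * (greenMinor H z i i W)⁻¹
            * (greenMinor H z i i (insert a W))⁻¹) U := by
        rw [altDiff_insert haA', altDiff, altDiff, ← Finset.sum_neg_distrib]
        refine Finset.sum_congr rfl fun S _ => ?_
        rw [← greenMinor_sub_insert hH hz hia i (U ∪ S), ← mul_neg]
        congr 1
        have hn1 := greenMinor_self_ne_zero hH hz i (U ∪ S)
        have hn2 := greenMinor_self_ne_zero hH hz i (insert a (U ∪ S))
        field_simp
        ring
      rw [e, norm_neg]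
      refine h.trans ?_
      calc 2 ^ A.card * (2 ^ A.card * (C₂ * C) * C) * ψ ^ (1 + 1 + 0 + 0 + 0 + A.card)
          = 2 ^ A.card * (2 ^ A.card * (C₂ * C) * C) * ψ ^ (1 + (A.card + 1)) := by ring
        _ ≤ _ := by rw [hC₃]; gcongr <;> norm_num
    have hψp : ψ ^ (1 + (A.card + 1)) ≤ ψ ^ (A.card + 1) :=
      pow_le_pow_of_le_one hψ0 hψ1 (by omega)
    refine ⟨fun j hj _ => (hG j hj).trans ?_, (hG i hi).trans ?_, hGi.trans ?_, fun _ => hGi.trans ?_⟩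
    · gcongr
      exact hC23.trans (le_max_left _ _)
    · exact mul_le_mul (hC23.trans (le_max_left _ _)) hψp (by positivity)
        (hC₃0.trans (le_max_left _ _))
    · exact mul_le_mul (le_max_left _ _) hψp (by positivity) (hC₃0.trans (le_max_left _ _))
    · gcongr
      exact le_max_left _ _

/-! ### Passing from control of G to control of the Green functions of minors. -/

theorem norm_green_le_LambdaO (H : Matrix (Fin N) (Fin N) ℂ) (z : ℂ) {i j : Fin N} (hij : i ≠ j) :
    ‖green H z i j‖ ≤ LambdaO H z :=
  le_ciSup (f := fun p : {p : Fin N × Fin N // p.1 ≠ p.2} => ‖green H z p.1.1 p.1.2‖)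
    (Set.finite_range _).bddAbove ⟨(i, j), hij⟩

theorem norm_green_sub_le_Lambda (H : Matrix (Fin N) (Fin N) ℂ) (z : ℂ) (i : Fin N) :
    ‖green H z i i - semicircleStieltjes z‖ ≤ Lambda H z :=
  (le_ciSup (f := fun i : Fin N => ‖green H z i i - semicircleStieltjes z‖)
    (Set.finite_range _).bddAbove i).trans (le_max_right _ _)

/-- Indices are removed one at a time. A removal at most doubles the off-diagonal bound and moves a
diagonal entry by at most 64 · 4^n ψ², so n removals move it by at most 1/64. Since |z| ≤ 15 gives
|m| ≥ 1/16, diagonal entries stay above 1/16 - 1/32 - 1/64 = 1/64, which explains the constant 64;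
4096 is 64². -/
theorem greenControl_of_Lambda_le (hH : H.IsHermitian) (hz : 0 < z.im) (hz15 : ‖z‖ ≤ 15)
    {ψ : ℝ} {n : ℕ} (hsmall : 4096 * (n + 1) * 4 ^ n * ψ ≤ 1)
    (hO : LambdaO H z ≤ ψ) (hL : Lambda H z ≤ 1 / 32) (hψ : 0 ≤ ψ) {V : Finset (Fin N)}
    (hV : V.card ≤ n) : GreenControl H z (2 ^ n * ψ) 64 V := by
  obtain ⟨hm1, hm2⟩ := norm_semicircleStieltjes_bounds hz hz15
  have hp4 : (1 : ℝ) ≤ 4 ^ n := one_le_pow₀ (by norm_num)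
  have h24 : (2 : ℝ) ^ n ≤ 4 ^ n := by gcongr; norm_num
  have hn1 : (1 : ℝ) ≤ n + 1 := by linarith [Nat.cast_nonneg (α := ℝ) n]
  have hs1 : 4096 * (4 ^ n * ψ) ≤ 1 := by
    refine le_trans ?_ hsmall
    calc 4096 * (4 ^ n * ψ) = 4096 * 1 * 4 ^ n * ψ := by ring
      _ ≤ _ := by gcongr
  have hs2 : 64 * (2 ^ n * ψ) ≤ 1 := by
    have : 2 ^ n * ψ ≤ 4 ^ n * ψ := by gcongr
    have h0 : 0 ≤ 2 ^ n * ψ := by positivity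
    linarith
  have hdiff : ∀ u ≤ n, u * (64 * (4 ^ n * ψ ^ 2)) ≤ 1 / 64 := by
    intro u hu
    have h1 : (u : ℝ) ≤ n + 1 := by exact_mod_cast hu.trans (Nat.le_succ n)
    have h2 : ψ ≤ 1 := by
      have : ψ ≤ 4 ^ n * ψ := le_mul_of_one_le_left hψ hp4
      linarith
    calc u * (64 * (4 ^ n * ψ ^ 2)) ≤ (n + 1) * (64 * (4 ^ n * (ψ * 1))) := by
          rw [pow_two]
          gcongr
      _ = 1 / 64 * (4096 * (n + 1) * 4 ^ n * ψ) := by ring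
      _ ≤ _ := by linarith
  have hmain : ∀ W : Finset (Fin N), W.card ≤ n → ∀ i ∉ W,
      (∀ j ∉ W, i ≠ j → ‖greenMinor H z i j W‖ ≤ 2 ^ W.card * ψ) ∧
      ‖greenMinor H z i i W - green H z i i‖ ≤ W.card * (64 * (4 ^ n * ψ ^ 2)) := by
    intro W
    induction W using Finset.induction_on with
    | empty =>
      intro _ i _
      simp only [greenMinor, minor_empty, Finset.card_empty, pow_zero, one_mul, sub_self, norm_zero,
        Nat.cast_zero, zero_mul, le_refl, and_true]
      exact fun j _ hij => (norm_green_le_LambdaO H z hij).trans hO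
    | insert a W ha ih =>
      intro hc i hi
      rw [Finset.card_insert_of_notMem ha] at *
      have ih := ih (by omega)
      have hia : i ≠ a := fun h => hi (h ▸ Finset.mem_insert_self _ _)
      have hiW : i ∉ W := fun h => hi (Finset.mem_insert_of_mem h)
      have h2W : (2 : ℝ) ^ W.card ≤ 2 ^ n := by gcongr; norm_num; omega
      have haa : ‖(greenMinor H z a a W)⁻¹‖ ≤ 64 := by
        rw [norm_inv]
        refine inv_le_of_inv_le₀ (by norm_num) ?_
        have h1 := (ih a ha).2.trans (hdiff _ (by omega))
        have h2 := (norm_green_sub_le_Lambda H z a).trans hL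
        have h4 : ‖semicircleStieltjes z‖ ≤ ‖greenMinor H z a a W‖
            + ‖greenMinor H z a a W - green H z a a‖ + ‖green H z a a - semicircleStieltjes z‖ := by
          have : semicircleStieltjes z = greenMinor H z a a W
            - (greenMinor H z a a W - green H z a a) - (green H z a a - semicircleStieltjes z) := by
            ring
          conv_lhs => rw [this]
          exact (norm_sub_le _ _).trans (add_le_add_left (norm_sub_le _ _) _)
        norm_num at hm2 ⊢
        linarith
      have hdrop : ∀ j ∉ insert a W,
          ‖greenMinor H z i j W - greenMinor H z i j (insert a W)‖
            ≤ (2 ^ W.card * ψ) * (2 ^ W.card * ψ) * 64 := by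
        intro j hj
        have hja : j ≠ a := fun h => hj (h ▸ Finset.mem_insert_self _ _)
        have hjW : j ∉ W := fun h => hj (Finset.mem_insert_of_mem h)
        rw [greenMinor_sub_insert hH hz hia, norm_mul, norm_mul]
        gcongr
        · exact (ih i hiW).1 a ha hia
        · exact (ih a ha).1 j hjW hja.symm
      constructor
      · intro j hj hij
        have hjW : j ∉ W := fun h => hj (Finset.mem_insert_of_mem h)
        have h1 := (ih i hiW).1 j hjW hij
        have h2 := hdrop j hj
        have h3 : ‖greenMinor H z i j (insert a W)‖ ≤ ‖greenMinor H z i j W‖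
            + ‖greenMinor H z i j W - greenMinor H z i j (insert a W)‖ := by
          have e : greenMinor H z i j (insert a W) = greenMinor H z i j W
            - (greenMinor H z i j W - greenMinor H z i j (insert a W)) := by ring
          conv_lhs => rw [e]
          exact norm_sub_le _ _
        have h4 : (2 ^ W.card * ψ) * (2 ^ W.card * ψ) * 64 ≤ 2 ^ W.card * ψ := by
          calc (2 ^ W.card * ψ) * (2 ^ W.card * ψ) * 64
              = (2 ^ W.card * ψ) * (64 * (2 ^ W.card * ψ)) := by ring
            _ ≤ (2 ^ W.card * ψ) * (64 * (2 ^ n * ψ)) := by gcongr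
            _ ≤ (2 ^ W.card * ψ) * 1 := by gcongr
            _ = _ := mul_one _
        rw [pow_succ]
        linarith
      · have h1 := (ih i hiW).2
        have h2 := hdrop i hi
        have h3 : ‖greenMinor H z i i (insert a W) - green H z i i‖
            ≤ ‖greenMinor H z i i W - green H z i i‖
            + ‖greenMinor H z i i W - greenMinor H z i i (insert a W)‖ := by
          have e : greenMinor H z i i (insert a W) - green H z i i
            = (greenMinor H z i i W - green H z i i)
              - (greenMinor H z i i W - greenMinor H z i i (insert a W)) := by ring
          rw [e]
          exact norm_sub_le _ _
        have h4 : (2 ^ W.card * ψ) * (2 ^ W.card * ψ) * 64 ≤ 64 * (4 ^ n * ψ ^ 2) := by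
          calc (2 ^ W.card * ψ) * (2 ^ W.card * ψ) * 64 ≤ (2 ^ n * ψ) * (2 ^ n * ψ) * 64 := by
                gcongr
            _ = _ := by
              rw [show (4 : ℝ) = 2 * 2 by norm_num, mul_pow]
              ring
        push_cast
        linarith
  intro W hWV i hi
  have hWn : W.card ≤ n := (Finset.card_le_card hWV).trans hV
  obtain ⟨h1, h2⟩ := hmain W hWn i hi
  have h3 := h2.trans (hdiff _ hWn)
  have h4 := (norm_green_sub_le_Lambda H z i).trans hL
  have e1 : greenMinor H z i i W = semicircleStieltjes z + (greenMinor H z i i W - green H z i i)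
    + (green H z i i - semicircleStieltjes z) := by ring
  have e2 : semicircleStieltjes z = greenMinor H z i i W
    - (greenMinor H z i i W - green H z i i) - (green H z i i - semicircleStieltjes z) := by ring
  refine ⟨fun j hj hij => (h1 j hj hij).trans ?_, ?_, ?_⟩
  · gcongr
    norm_num
  · rw [e1]
    refine (norm_add_le _ _).trans ((add_le_add_left (norm_add_le _ _) _).trans ?_)
    linarith
  · rw [norm_inv]
    refine inv_le_of_inv_le₀ (by norm_num) ?_
    have h5 : ‖semicircleStieltjes z‖ ≤ ‖greenMinor H z i i W‖
        + ‖greenMinor H z i i W - green H z i i‖ + ‖green H z i i - semicircleStieltjes z‖ := by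
      conv_lhs => rw [e2]
      exact (norm_sub_le _ _).trans (add_le_add_left (norm_sub_le _ _) _)
    norm_num at hm2 ⊢
    linarith

end Minors

/-! ### Random variables with moments of all orders -/

section Moments

variable {Ω : Type*} [MeasurableSpace Ω] {P : Measure Ω}

/-- All absolute moments of `X` are finite. -/
structure HasMoments (P : Measure Ω) (X : Ω → ℂ) : Prop where
  aestronglyMeasurable : AEStronglyMeasurable X P
  integrable_norm_pow : ∀ q : ℕ, Integrable (fun ω => ‖X ω‖ ^ q) P

theorem norm_add_pow_le (x y : ℂ) (q : ℕ) : ‖x + y‖ ^ q ≤ 2 ^ q * (‖x‖ ^ q + ‖y‖ ^ q) := by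
  have h1 : ‖x + y‖ ≤ 2 * max ‖x‖ ‖y‖ := (norm_add_le _ _).trans (by
    linarith [le_max_left ‖x‖ ‖y‖, le_max_right ‖x‖ ‖y‖])
  calc ‖x + y‖ ^ q ≤ (2 * max ‖x‖ ‖y‖) ^ q := by gcongr
    _ = 2 ^ q * (max ‖x‖ ‖y‖) ^ q := mul_pow _ _ _
    _ ≤ _ := by
      gcongr
      rcases max_choice ‖x‖ ‖y‖ with h | h <;> rw [h]
      · exact le_add_of_nonneg_right (by positivity)
      · exact le_add_of_nonneg_left (by positivity)

namespace HasMoments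

theorem integrable {X : Ω → ℂ} (hX : HasMoments P X) : Integrable X P := by
  have := hX.integrable_norm_pow 1
  simp only [pow_one] at this
  exact (integrable_norm_iff hX.aestronglyMeasurable).mp this

theorem add {X Y : Ω → ℂ} (hX : HasMoments P X) (hY : HasMoments P Y) :
    HasMoments P (fun ω => X ω + Y ω) where
  aestronglyMeasurable := hX.aestronglyMeasurable.add hY.aestronglyMeasurable
  integrable_norm_pow q := by
    refine (((hX.integrable_norm_pow q).add (hY.integrable_norm_pow q)).const_mul (2 ^ q)).mono'
      ((hX.aestronglyMeasurable.add hY.aestronglyMeasurable).norm.pow q)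
      (Filter.Eventually.of_forall fun ω => ?_)
    rw [Real.norm_of_nonneg (by positivity)]
    exact norm_add_pow_le _ _ q

theorem mul {X Y : Ω → ℂ} (hX : HasMoments P X) (hY : HasMoments P Y) :
    HasMoments P (fun ω => X ω * Y ω) where
  aestronglyMeasurable := hX.aestronglyMeasurable.mul hY.aestronglyMeasurable
  integrable_norm_pow q := by
    refine ((hX.integrable_norm_pow (q * 2)).add (hY.integrable_norm_pow (q * 2))).mono'
      ((hX.aestronglyMeasurable.mul hY.aestronglyMeasurable).norm.pow q)
      (Filter.Eventually.of_forall fun ω => ?_)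
    rw [Real.norm_of_nonneg (by positivity), Pi.add_apply, norm_mul, mul_pow, pow_mul, pow_mul]
    nlinarith [sq_nonneg (‖X ω‖ ^ q - ‖Y ω‖ ^ q), sq_nonneg (‖X ω‖ ^ q), sq_nonneg (‖Y ω‖ ^ q)]

theorem mono {X Y : Ω → ℂ} (hY : HasMoments P Y) (hX : AEStronglyMeasurable X P)
    (h : ∀ ω, ‖X ω‖ ≤ ‖Y ω‖) : HasMoments P X where
  aestronglyMeasurable := hX
  integrable_norm_pow q := by
    refine (hY.integrable_norm_pow q).mono' (hX.norm.pow q) (Filter.Eventually.of_forall fun ω => ?_)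
    rw [Real.norm_of_nonneg (by positivity)]
    exact pow_le_pow_left₀ (norm_nonneg _) (h ω) q

theorem const [IsFiniteMeasure P] (c : ℂ) : HasMoments P (fun _ => c) where
  aestronglyMeasurable := aestronglyMeasurable_const
  integrable_norm_pow _ := integrable_const _

theorem of_bound [IsFiniteMeasure P] {X : Ω → ℂ} (hX : AEStronglyMeasurable X P) {C : ℝ}
    (h : ∀ ω, ‖X ω‖ ≤ C) : HasMoments P X :=
  (const (P := P) (C : ℂ)).mono hX fun ω => (h ω).trans (by
    rw [Complex.norm_real]
    exact le_abs_self C)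

theorem star {X : Ω → ℂ} (hX : HasMoments P X) : HasMoments P (fun ω => star (X ω)) :=
  hX.mono hX.aestronglyMeasurable.star fun ω => by simp

theorem neg {X : Ω → ℂ} (hX : HasMoments P X) : HasMoments P (fun ω => -X ω) :=
  hX.mono hX.aestronglyMeasurable.neg fun ω => by simp

theorem sub {X Y : Ω → ℂ} (hX : HasMoments P X) (hY : HasMoments P Y) :
    HasMoments P (fun ω => X ω - Y ω) := by
  simpa only [sub_eq_add_neg] using hX.add hY.neg

theorem const_mul {X : Ω → ℂ} (hX : HasMoments P X) (c : ℂ) : HasMoments P (fun ω => c * X ω) where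
  aestronglyMeasurable := hX.aestronglyMeasurable.const_mul c
  integrable_norm_pow q := by
    simp only [norm_mul, mul_pow]
    exact (hX.integrable_norm_pow q).const_mul _

theorem sum [IsFiniteMeasure P] {ι : Type*} {s : Finset ι} {X : ι → Ω → ℂ}
    (h : ∀ i ∈ s, HasMoments P (X i)) : HasMoments P (fun ω => ∑ i ∈ s, X i ω) := by
  classical
  induction s using Finset.induction_on with
  | empty => simpa using const (P := P) 0
  | insert a s ha ih =>
    simp only [Finset.sum_insert ha]
    exact (h a (Finset.mem_insert_self _ _)).add (ih fun i hi => h i (Finset.mem_insert_of_mem hi))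

theorem prod [IsFiniteMeasure P] {ι : Type*} {s : Finset ι} {X : ι → Ω → ℂ}
    (h : ∀ i ∈ s, HasMoments P (X i)) : HasMoments P (fun ω => ∏ i ∈ s, X i ω) := by
  classical
  induction s using Finset.induction_on with
  | empty => simpa using const (P := P) 1
  | insert a s ha ih =>
    simp only [Finset.prod_insert ha]
    exact (h a (Finset.mem_insert_self _ _)).mul (ih fun i hi => h i (Finset.mem_insert_of_mem hi))

theorem norm_pow {X : Ω → ℂ} (hX : HasMoments P X) (q : ℕ) :
    HasMoments P (fun ω => ((‖X ω‖ ^ q : ℝ) : ℂ)) where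
  aestronglyMeasurable :=
    Complex.continuous_ofReal.comp_aestronglyMeasurable (hX.aestronglyMeasurable.norm.pow q)
  integrable_norm_pow r := by
    have := hX.integrable_norm_pow (q * r)
    simpa [pow_mul] using this

end HasMoments

/-! ### Moments of sums of martingale differences -/

/-- A second-order Taylor bound in Y. The linear term is kept exactly because it integrates to zero
for martingale differences. The induction multiplies by |S + Y|² = |S|² + 2 Re(S̄Y) + |Y|². -/
theorem exists_norm_add_pow_le (q : ℕ) : ∃ C : ℝ, 1 ≤ C ∧ ∀ S Y : ℂ,
    ‖S + Y‖ ^ (2 * (q + 1)) ≤ ‖S‖ ^ (2 * (q + 1))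
      + 2 * (q + 1) * (‖S‖ ^ (2 * q) * (star S * Y).re)
      + C * (‖S‖ ^ (2 * q) * ‖Y‖ ^ 2 + ‖Y‖ ^ (2 * (q + 1))) := by
  have hsq : ∀ S Y : ℂ, ‖S + Y‖ ^ 2 = ‖S‖ ^ 2 + 2 * (star S * Y).re + ‖Y‖ ^ 2 := fun S Y => by
    rw [← Complex.normSq_eq_norm_sq, ← Complex.normSq_eq_norm_sq, ← Complex.normSq_eq_norm_sq]
    simp only [Complex.normSq_apply, Complex.add_re, Complex.add_im, Complex.mul_re,
      Complex.star_def, Complex.conj_re, Complex.conj_im]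
    ring
  have hu : ∀ S Y : ℂ, |(star S * Y).re| ≤ ‖S‖ * ‖Y‖ := fun S Y => by
    refine (Complex.abs_re_le_norm _).trans ?_
    rw [norm_mul, norm_star]
  induction q with
  | zero =>
    refine ⟨1, le_rfl, fun S Y => ?_⟩
    have := hsq S Y
    simp only [zero_add, mul_one, mul_zero, pow_zero, one_mul, Nat.cast_zero, zero_add]
    nlinarith [sq_nonneg ‖Y‖]
  | succ q ih =>
    obtain ⟨C, hC1, ih⟩ := ih
    refine ⟨1 + 8 * (q + 1) + 8 * C, by linarith [Nat.cast_nonneg (α := ℝ) q], fun S Y => ?_⟩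
    have h := ih S Y
    have hs := hsq S Y
    have huu := hu S Y
    set s := ‖S‖
    set y := ‖Y‖
    set u := (star S * Y).re
    have hs0 : 0 ≤ s := norm_nonneg _
    have hy0 : 0 ≤ y := norm_nonneg _
    set T := s ^ (2 * (q + 1)) * y ^ 2 + y ^ (2 * (q + 1 + 1)) with hT
    have hT1 : s ^ (2 * (q + 1)) * y ^ 2 ≤ T := le_add_of_nonneg_right (by positivity)
    have hT2 : y ^ (2 * (q + 1 + 1)) ≤ T := le_add_of_nonneg_left (by positivity)
    -- Every mixed monomial of the right degree with at least two powers of y is dominated by one of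
    -- the two terms of T, according to which of s and y is larger.
    have hcase : ∀ a b : ℕ, a + b = 2 * (q + 1) → s ^ a * y ^ (b + 2) ≤ T := by
      intro a b hab
      rcases le_total y s with hys | hsy
      · refine le_trans ?_ hT1
        calc s ^ a * y ^ (b + 2) = s ^ a * y ^ b * y ^ 2 := by ring
          _ ≤ s ^ a * s ^ b * y ^ 2 := by gcongr
          _ = _ := by rw [← pow_add, hab]
      · refine le_trans ?_ hT2
        calc s ^ a * y ^ (b + 2) ≤ y ^ a * y ^ (b + 2) := by gcongr
          _ = _ := by rw [← pow_add]; congr 1; omega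
    have hT3 := hcase (2 * q + 1) 1 (by ring)
    have hT4 := hcase (2 * q) 2 (by ring)
    have hT5 := hcase 2 (2 * q) (by ring)
    obtain ⟨hu1, hu2⟩ := abs_le.mp huu
    have e1 : ‖S + Y‖ ^ (2 * (q + 1 + 1)) = ‖S + Y‖ ^ (2 * (q + 1)) * ‖S + Y‖ ^ 2 := by ring
    have hpos : 0 ≤ s ^ 2 + 2 * u + y ^ 2 := by rw [← hs]; positivity
    have hle : s ^ 2 + 2 * u + y ^ 2 ≤ 2 * (s ^ 2 + y ^ 2) := by
      nlinarith [sq_nonneg (s - y)]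
    have hu3 : u ^ 2 ≤ s ^ 2 * y ^ 2 := by
      rw [← mul_pow]
      exact sq_le_sq' hu1 hu2
    have hsp : 0 ≤ s ^ (2 * q) := by positivity
    rw [e1]
    refine (mul_le_mul_of_nonneg_right h (by positivity)).trans ?_
    rw [hs]
    have hq0 : (0 : ℝ) ≤ q := Nat.cast_nonneg q
    have b1 : s ^ (2 * q) * u ^ 2 ≤ T := by
      refine le_trans ?_ hT1
      calc s ^ (2 * q) * u ^ 2 ≤ s ^ (2 * q) * (s ^ 2 * y ^ 2) := by gcongr
        _ = _ := by ring
    have b2 : s ^ (2 * q) * u * y ^ 2 ≤ T := by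
      refine le_trans ?_ hT3
      calc s ^ (2 * q) * u * y ^ 2 ≤ s ^ (2 * q) * (s * y) * y ^ 2 := by gcongr
        _ = _ := by ring
    have b3 : (s ^ (2 * q) * y ^ 2 + y ^ (2 * (q + 1))) * (s ^ 2 + 2 * u + y ^ 2) ≤ 8 * T := by
      calc _ ≤ (s ^ (2 * q) * y ^ 2 + y ^ (2 * (q + 1))) * (2 * (s ^ 2 + y ^ 2)) := by gcongr
        _ = 2 * (s ^ (2 * (q + 1)) * y ^ 2 + s ^ (2 * q) * y ^ (2 + 2)
            + s ^ 2 * y ^ (2 * q + 2) + y ^ (2 * (q + 1 + 1))) := by ring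
        _ ≤ _ := by linarith
    have b3' := mul_le_mul_of_nonneg_left b3 (zero_le_one.trans hC1)
    have b1' := mul_le_mul_of_nonneg_left b1 (by positivity : (0 : ℝ) ≤ 4 * (q + 1))
    have b2' := mul_le_mul_of_nonneg_left b2 (by positivity : (0 : ℝ) ≤ 2 * (q + 1))
    have hT0 : 0 ≤ T := le_trans (by positivity) hT2
    have hqT : 0 ≤ (q : ℝ) * T := by positivity
    push_cast
    have e2 : (s ^ (2 * (q + 1)) + 2 * (q + 1) * (s ^ (2 * q) * u)
        + C * (s ^ (2 * q) * y ^ 2 + y ^ (2 * (q + 1)))) * (s ^ 2 + 2 * u + y ^ 2)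
        = s ^ (2 * (q + 1 + 1)) + 2 * (q + 1 + 1) * (s ^ (2 * (q + 1)) * u)
          + s ^ (2 * (q + 1)) * y ^ 2 + 4 * (q + 1) * (s ^ (2 * q) * u ^ 2)
          + 2 * (q + 1) * (s ^ (2 * q) * u * y ^ 2)
          + C * ((s ^ (2 * q) * y ^ 2 + y ^ (2 * (q + 1))) * (s ^ 2 + 2 * u + y ^ 2)) := by
      ring
    rw [e2]
    nlinarith

/-- The `L^(2p)` norm has type two with respect to martingale differences. -/
theorem exists_integral_norm_add_pow_le (q : ℕ) : ∃ C : ℝ, 1 ≤ C ∧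
    ∀ {Ω : Type*} [MeasurableSpace Ω] {P : Measure Ω} [IsProbabilityMeasure P] {S Y : Ω → ℂ}
      {σ τ : ℝ}, HasMoments P S → HasMoments P Y →
      ∫ ω, ((‖S ω‖ ^ (2 * q) : ℝ) : ℂ) * star (S ω) * Y ω ∂P = 0 → 0 ≤ σ → 0 ≤ τ →
      ∫ ω, ‖S ω‖ ^ (2 * (q + 1)) ∂P ≤ σ ^ (q + 1) → ∫ ω, ‖Y ω‖ ^ (2 * (q + 1)) ∂P ≤ τ ^ (q + 1) →
      ∫ ω, ‖S ω + Y ω‖ ^ (2 * (q + 1)) ∂P ≤ (σ + C * τ) ^ (q + 1) := by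
  obtain ⟨C, hC1, hC⟩ := exists_norm_add_pow_le q
  refine ⟨3 * C, by linarith, ?_⟩
  intro Ω _ P _ S Y σ τ hS hY horth hσ hτ hSσ hYτ
  -- Strict positivity allows normalising by σ and τ; the general case is the limit of σ + ε, τ + ε
  -- as ε decreases to 0.
  have hpos : ∀ σ τ : ℝ, 0 < σ → 0 < τ → ∫ ω, ‖S ω‖ ^ (2 * (q + 1)) ∂P ≤ σ ^ (q + 1) →
      ∫ ω, ‖Y ω‖ ^ (2 * (q + 1)) ∂P ≤ τ ^ (q + 1) →
      ∫ ω, ‖S ω + Y ω‖ ^ (2 * (q + 1)) ∂P ≤ (σ + 3 * C * τ) ^ (q + 1) := by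
    clear hSσ hYτ hσ hτ
    intro σ τ hσ hτ hSσ hYτ
    -- Young's inequality, scaled so that each of the two terms in the bracket has integral at most
    -- 1.
    have hmix : ∀ ω, ‖S ω‖ ^ (2 * q) * ‖Y ω‖ ^ 2 ≤ σ ^ q * τ *
        ((σ ^ (q + 1))⁻¹ * ‖S ω‖ ^ (2 * (q + 1)) + (τ ^ (q + 1))⁻¹ * ‖Y ω‖ ^ (2 * (q + 1))) := by
      intro ω
      have key : ∀ a b : ℝ, 0 ≤ a → 0 ≤ b → a ^ q * b ≤ a ^ (q + 1) + b ^ (q + 1) := by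
        intro a b ha hb
        rcases le_total a b with h | h
        · calc a ^ q * b ≤ b ^ q * b := by gcongr
            _ = b ^ (q + 1) := (pow_succ _ _).symm
            _ ≤ _ := le_add_of_nonneg_left (by positivity)
        · calc a ^ q * b ≤ a ^ q * a := by gcongr
            _ = a ^ (q + 1) := (pow_succ _ _).symm
            _ ≤ _ := le_add_of_nonneg_right (by positivity)
      have h := key (‖S ω‖ ^ 2 / σ) (‖Y ω‖ ^ 2 / τ) (by positivity) (by positivity)
      have h2 := mul_le_mul_of_nonneg_left h (by positivity : 0 ≤ σ ^ q * τ)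
      calc ‖S ω‖ ^ (2 * q) * ‖Y ω‖ ^ 2
          = σ ^ q * τ * ((‖S ω‖ ^ 2 / σ) ^ q * (‖Y ω‖ ^ 2 / τ)) := by
            rw [div_pow, pow_mul]; field_simp
        _ ≤ _ := h2
        _ = _ := by rw [div_pow, div_pow, pow_mul, pow_mul]; ring
    have iS := hS.integrable_norm_pow (2 * (q + 1))
    have iY := hY.integrable_norm_pow (2 * (q + 1))
    have iO : Integrable (fun ω => ((‖S ω‖ ^ (2 * q) : ℝ) : ℂ) * star (S ω) * Y ω) P :=
      (((hS.norm_pow (2 * q)).mul hS.star).mul hY).integrable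
    have hre : ∀ ω, ‖S ω‖ ^ (2 * q) * (star (S ω) * Y ω).re
        = (((‖S ω‖ ^ (2 * q) : ℝ) : ℂ) * star (S ω) * Y ω).re := fun ω => by
      rw [mul_assoc, Complex.re_ofReal_mul]
    have iR : Integrable (fun ω => ‖S ω‖ ^ (2 * q) * (star (S ω) * Y ω).re) P := by
      simp only [hre]
      exact iO.re
    have hR0 : ∫ ω, ‖S ω‖ ^ (2 * q) * (star (S ω) * Y ω).re ∂P = 0 := by
      simp only [hre]
      have := integral_re iO
      rw [horth] at this
      simpa using this
    calc ∫ ω, ‖S ω + Y ω‖ ^ (2 * (q + 1)) ∂P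
        ≤ ∫ ω, (‖S ω‖ ^ (2 * (q + 1)) + 2 * (q + 1) * (‖S ω‖ ^ (2 * q) * (star (S ω) * Y ω).re)
          + C * (σ ^ q * τ * ((σ ^ (q + 1))⁻¹ * ‖S ω‖ ^ (2 * (q + 1))
            + (τ ^ (q + 1))⁻¹ * ‖Y ω‖ ^ (2 * (q + 1))) + ‖Y ω‖ ^ (2 * (q + 1)))) ∂P := by
          refine integral_mono ((hS.add hY).integrable_norm_pow _) ?_ fun ω => ?_
          · exact (iS.add (iR.const_mul _)).add (((((iS.const_mul _).add
              (iY.const_mul _)).const_mul _).add iY).const_mul _)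
          · refine (hC (S ω) (Y ω)).trans ?_
            have := hmix ω
            gcongr
      _ = ∫ ω, ‖S ω‖ ^ (2 * (q + 1)) ∂P + C * (σ ^ q * τ * ((σ ^ (q + 1))⁻¹ *
          ∫ ω, ‖S ω‖ ^ (2 * (q + 1)) ∂P + (τ ^ (q + 1))⁻¹ * ∫ ω, ‖Y ω‖ ^ (2 * (q + 1)) ∂P)
          + ∫ ω, ‖Y ω‖ ^ (2 * (q + 1)) ∂P) := by
          have i1 : Integrable (fun ω => ‖S ω‖ ^ (2 * (q + 1))
              + 2 * (q + 1) * (‖S ω‖ ^ (2 * q) * (star (S ω) * Y ω).re)) P :=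
            iS.add (iR.const_mul _)
          have i2 : Integrable (fun ω => (σ ^ (q + 1))⁻¹ * ‖S ω‖ ^ (2 * (q + 1))
              + (τ ^ (q + 1))⁻¹ * ‖Y ω‖ ^ (2 * (q + 1))) P :=
            (iS.const_mul _).add (iY.const_mul _)
          have i3 : Integrable (fun ω => σ ^ q * τ * ((σ ^ (q + 1))⁻¹ * ‖S ω‖ ^ (2 * (q + 1))
              + (τ ^ (q + 1))⁻¹ * ‖Y ω‖ ^ (2 * (q + 1))) + ‖Y ω‖ ^ (2 * (q + 1))) P :=
            (i2.const_mul _).add iY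
          rw [integral_add i1 (i3.const_mul _), integral_add iS (iR.const_mul _),
            integral_const_mul, hR0, integral_const_mul, integral_add (i2.const_mul _) iY,
            integral_const_mul, integral_add (iS.const_mul _) (iY.const_mul _), integral_const_mul,
            integral_const_mul]
          ring
      _ ≤ σ ^ (q + 1) + C * (σ ^ q * τ * ((σ ^ (q + 1))⁻¹ * σ ^ (q + 1)
          + (τ ^ (q + 1))⁻¹ * τ ^ (q + 1)) + τ ^ (q + 1)) := by gcongr
      _ = σ ^ (q + 1) + C * (2 * (σ ^ q * τ) + τ ^ (q + 1)) := by
          rw [inv_mul_cancel₀ (by positivity), inv_mul_cancel₀ (by positivity)]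
          ring
      _ ≤ σ ^ (q + 1) + 3 * C * (σ + 3 * C * τ) ^ q * τ := by
          have h1 : σ ^ q ≤ (σ + 3 * C * τ) ^ q := by
            gcongr
            exact le_add_of_nonneg_right (by positivity)
          have h2 : τ ^ q ≤ (σ + 3 * C * τ) ^ q := by
            gcongr
            nlinarith
          rw [pow_succ τ]
          have h3 : 2 * (σ ^ q * τ) + τ ^ q * τ ≤ 3 * ((σ + 3 * C * τ) ^ q * τ) := by
            nlinarith
          nlinarith
      _ ≤ _ := by
          rw [pow_succ σ, pow_succ (σ + 3 * C * τ)]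
          have h1 : σ ^ q ≤ (σ + 3 * C * τ) ^ q := by
            gcongr
            exact le_add_of_nonneg_right (by positivity)
          nlinarith
  have hlim : Filter.Tendsto (fun ε : ℝ => ((σ + ε) + 3 * C * (τ + ε)) ^ (q + 1))
      (nhdsWithin 0 (Set.Ioi 0)) (nhds ((σ + 3 * C * τ) ^ (q + 1))) := by
    have hc : Continuous fun ε : ℝ => ((σ + ε) + 3 * C * (τ + ε)) ^ (q + 1) := by fun_prop
    have := hc.tendsto 0
    simp only [add_zero] at this
    exact this.mono_left nhdsWithin_le_nhds
  refine ge_of_tendsto hlim ?_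
  filter_upwards [self_mem_nhdsWithin] with ε hε
  have hε' : (0 : ℝ) < ε := hε
  refine hpos (σ + ε) (τ + ε) (by linarith) (by linarith) (hSσ.trans ?_) (hYτ.trans ?_)
  · gcongr
    linarith
  · gcongr
    linarith

/-- A moment bound for sums of martingale differences. -/
theorem exists_integral_norm_sum_pow_le (q : ℕ) : ∃ C : ℝ, 1 ≤ C ∧
    ∀ {Ω : Type*} [MeasurableSpace Ω] {P : Measure Ω} [IsProbabilityMeasure P] {ι : Type*}
      [LinearOrder ι] {s : Finset ι} {Y : ι → Ω → ℂ} {τ : ι → ℝ},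
      (∀ i ∈ s, HasMoments P (Y i)) → (∀ i ∈ s, 0 ≤ τ i) →
      (∀ t ⊆ s, ∀ i ∈ s, (∀ j ∈ t, j < i) → ∫ ω, ((‖∑ j ∈ t, Y j ω‖ ^ (2 * q) : ℝ) : ℂ)
        * star (∑ j ∈ t, Y j ω) * Y i ω ∂P = 0) →
      (∀ i ∈ s, ∫ ω, ‖Y i ω‖ ^ (2 * (q + 1)) ∂P ≤ τ i ^ (q + 1)) →
      ∫ ω, ‖∑ i ∈ s, Y i ω‖ ^ (2 * (q + 1)) ∂P ≤ (C * ∑ i ∈ s, τ i) ^ (q + 1) := by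
  obtain ⟨C, hC1, hC⟩ := exists_integral_norm_add_pow_le q
  refine ⟨C, hC1, ?_⟩
  intro Ω _ P _ ι _ s Y τ
  -- The largest index is split off, so that orthogonality applies to it and the partial sum before
  -- it.
  induction s using Finset.induction_on_max with
  | empty => intro _ _ _ _; simp
  | insert a s hmax ih =>
    intro hY hτ horth hm
    have ha : a ∉ s := fun h => lt_irrefl _ (hmax a h)
    have hs : s ⊆ insert a s := Finset.subset_insert _ _
    have ih := ih (fun i hi => hY i (hs hi)) (fun i hi => hτ i (hs hi))
      (fun t ht i hi => horth t (ht.trans hs) i (hs hi)) (fun i hi => hm i (hs hi))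
    have ha' := Finset.mem_insert_self a s
    have h := hC (HasMoments.sum fun i hi => hY i (hs hi)) (hY a ha') (horth s hs a ha' hmax)
      (mul_nonneg (zero_le_one.trans hC1) (Finset.sum_nonneg fun i hi => hτ i (hs hi))) (hτ a ha')
      ih (hm a ha')
    simp only [Finset.sum_insert ha]
    convert h using 3
    · rw [add_comm]
    · ring

end Moments

/-! ### Independence of the entries -/

section Entries

variable {N : ℕ} {Ω : Type*}

/-- The position on or above the diagonal that determines the entries `(i, j)` and `(j, i)`. -/
def edge (i j : Fin N) : {p : Fin N × Fin N // p.1 ≤ p.2} :=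
  if h : i ≤ j then ⟨(i, j), h⟩ else ⟨(j, i), le_of_not_ge h⟩

/-- The σ-algebra generated by the entries with position in `S`. -/
@[reducible]
def entrySigma (H : Ω → Matrix (Fin N) (Fin N) ℂ) (S : Set {p : Fin N × Fin N // p.1 ≤ p.2}) :
    MeasurableSpace Ω :=
  ⨆ e ∈ S, MeasurableSpace.comap (fun ω => H ω e.1.1 e.1.2) inferInstance

/-- The positions that avoid the rows and columns in `U`. -/
def awayFrom (U : Finset (Fin N)) : Set {p : Fin N × Fin N // p.1 ≤ p.2} :=
  {e | e.1.1 ∉ U ∧ e.1.2 ∉ U}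

/-- The positions outside row `k`, together with those in row `k` before the column `n`. -/
def rowPast (k n : Fin N) : Set {p : Fin N × Fin N // p.1 ≤ p.2} :=
  awayFrom {k} ∪ {e | ∃ j < n, e = edge k j}

theorem edge_injective_right {k i j : Fin N} (h : edge k i = edge k j) : i = j := by
  unfold edge at h
  split_ifs at h <;> simp_all

theorem edge_notMem_awayFrom (k j : Fin N) : edge k j ∉ awayFrom {k} := by
  unfold edge awayFrom
  split_ifs <;> simp

theorem edge_mem_awayFrom {U : Finset (Fin N)} {i j : Fin N} (hi : i ∉ U) (hj : j ∉ U) :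
    edge i j ∈ awayFrom U := by
  unfold edge awayFrom
  split_ifs <;> simp [hi, hj]

theorem edge_notMem_rowPast (k n : Fin N) : edge k n ∉ rowPast k n := by
  rintro (h | ⟨j, hj, h⟩)
  · exact edge_notMem_awayFrom k n h
  · exact hj.ne (edge_injective_right h).symm

theorem awayFrom_anti {U V : Finset (Fin N)} (h : U ⊆ V) : awayFrom V ⊆ awayFrom U :=
  fun _ he => ⟨fun h1 => he.1 (h h1), fun h1 => he.2 (h h1)⟩

theorem rowPast_mono (k : Fin N) {m n : Fin N} (h : m ≤ n) : rowPast k m ⊆ rowPast k n :=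
  Set.union_subset_union_right _ fun _ ⟨j, hj, he⟩ => ⟨j, hj.trans_le h, he⟩

theorem edge_mem_rowPast {k j n : Fin N} (h : j < n) : edge k j ∈ rowPast k n :=
  Or.inr ⟨j, h, rfl⟩

variable {H : Ω → Matrix (Fin N) (Fin N) ℂ} {S T : Set {p : Fin N × Fin N // p.1 ≤ p.2}}

theorem entrySigma_mono (h : S ⊆ T) : entrySigma H S ≤ entrySigma H T :=
  biSup_mono h

theorem measurable_entry (hH : ∀ ω, (H ω).IsHermitian) {i j : Fin N} (h : edge i j ∈ S) :
    Measurable[entrySigma H S] fun ω => H ω i j := by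
  have hle := le_iSup₂ (f := fun (e : {p : Fin N × Fin N // p.1 ≤ p.2}) (_ : e ∈ S) =>
    MeasurableSpace.comap (fun ω => H ω e.1.1 e.1.2) inferInstance) (edge i j) h
  have hm : Measurable[entrySigma H S] fun ω => H ω (edge i j).1.1 (edge i j).1.2 :=
    (comap_measurable _).mono hle le_rfl
  unfold edge at hm
  split_ifs at hm
  · exact hm
  · have e : (fun ω => H ω i j) = fun ω => star (H ω j i) :=
      funext fun ω => ((hH ω).apply i j).symm
    rw [e]
    exact Complex.continuous_conj.measurable.comp hm

/-- By Cramer's rule the entries are quotients of determinants. The σ-algebra is arbitrary because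
measurability is needed both for entries away from given rows and for the minor H^(k). -/
theorem measurable_green {m : MeasurableSpace Ω} {A : Ω → Matrix (Fin N) (Fin N) ℂ}
    (hA : ∀ i j, Measurable[m] fun ω => A ω i j) (z : ℂ) (i j : Fin N) :
    Measurable[m] fun ω => green (A ω) z i j := by
  have hdet : ∀ B : Ω → Matrix (Fin N) (Fin N) ℂ, (∀ i j, Measurable[m] fun ω => B ω i j) →
      Measurable[m] fun ω => (B ω).det := by
    intro B hB
    simp only [Matrix.det_apply']
    exact Finset.measurable_sum _ fun σ _ =>
      (Finset.measurable_prod _ fun i _ => hB _ _).const_mul _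
  have hA' : ∀ i j, Measurable[m] fun ω => (A ω - z • (1 : Matrix (Fin N) (Fin N) ℂ)) i j := by
    intro i j
    simp only [Matrix.sub_apply]
    exact (hA i j).sub_const _
  simp only [green, Matrix.inv_def, Matrix.smul_apply, Ring.inverse_eq_inv', smul_eq_mul,
    Matrix.adjugate_apply]
  refine (hdet _ hA').inv.mul (hdet _ fun p q => ?_)
  simp only [Matrix.updateRow_apply]
  split_ifs
  · exact measurable_const
  · exact hA' p q

theorem measurable_greenMinor (hH : ∀ ω, (H ω).IsHermitian) (z : ℂ) (i j : Fin N)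
    {U V : Finset (Fin N)} (hUV : U ⊆ V) :
    Measurable[entrySigma H (awayFrom U)] fun ω => greenMinor (H ω) z i j V := by
  refine measurable_green (fun p q => ?_) z i j
  simp only [minor]
  split_ifs with h
  · exact measurable_const
  · push Not at h
    exact measurable_entry hH (edge_mem_awayFrom (fun h1 => h.1 (hUV h1)) fun h1 => h.2 (hUV h1))

end Entries

/-! ### Independence and moments of the entries of a generalized Wigner matrix. -/

section Wigner

variable {N : ℕ} {Ω : Type*} [mΩ : MeasurableSpace Ω] {P : Measure Ω}
  {H : Ω → Matrix (Fin N) (Fin N) ℂ} {δ : ℝ} {mom : ℕ → ℝ}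
  {S T : Set {p : Fin N × Fin N // p.1 ≤ p.2}}

namespace IsGeneralizedWigner

theorem entrySigma_le (hW : IsGeneralizedWigner P H δ mom) : entrySigma H S ≤ mΩ :=
  iSup₂_le fun e _ => (hW.measurable e.1.1 e.1.2).comap_le

theorem indepFun (hW : IsGeneralizedWigner P H δ mom) (hST : Disjoint S T) {X Y : Ω → ℂ}
    (hX : Measurable[entrySigma H S] X) (hY : Measurable[entrySigma H T] Y) : IndepFun X Y P := by
  have h := indep_iSup_of_disjoint (m := fun e : {p : Fin N × Fin N // p.1 ≤ p.2} =>
    MeasurableSpace.comap (fun ω => H ω e.1.1 e.1.2) inferInstance)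
    (fun e => (hW.measurable e.1.1 e.1.2).comap_le) hW.indep hST
  exact indep_of_indep_of_le_left (indep_of_indep_of_le_right h hY.comap_le) hX.comap_le

theorem measurable_of_entrySigma (hW : IsGeneralizedWigner P H δ mom) {X : Ω → ℂ}
    (hX : Measurable[entrySigma H S] X) : Measurable X := hX.mono hW.entrySigma_le le_rfl

theorem integral_mul_eq_zero (hW : IsGeneralizedWigner P H δ mom) (hST : Disjoint S T)
    {W X : Ω → ℂ} (hm : Measurable[entrySigma H S] W) (hX : Measurable[entrySigma H T] X)
    (h0 : ∫ ω, X ω ∂P = 0) : ∫ ω, W ω * X ω ∂P = 0 := by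
  rw [(hW.indepFun hST hm hX).integral_fun_mul_eq_mul_integral
    (hW.measurable_of_entrySigma hm).aestronglyMeasurable
    (hW.measurable_of_entrySigma hX).aestronglyMeasurable, h0, mul_zero]

theorem integral_norm_mul_pow (hW : IsGeneralizedWigner P H δ mom) (hST : Disjoint S T)
    {W X : Ω → ℂ} (hm : Measurable[entrySigma H S] W) (hX : Measurable[entrySigma H T] X)
    (q : ℕ) : ∫ ω, ‖W ω * X ω‖ ^ q ∂P = (∫ ω, ‖W ω‖ ^ q ∂P) * ∫ ω, ‖X ω‖ ^ q ∂P := by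
  simp only [norm_mul, mul_pow]
  have h := (hW.indepFun hST hm hX).comp (φ := fun x : ℂ => ‖x‖ ^ q) (ψ := fun x : ℂ => ‖x‖ ^ q)
    (by fun_prop) (by fun_prop)
  exact h.integral_fun_mul_eq_mul_integral
    ((hW.measurable_of_entrySigma hm).norm.pow_const q).aestronglyMeasurable
    ((hW.measurable_of_entrySigma hX).norm.pow_const q).aestronglyMeasurable

theorem hasMoments_entry (hW : IsGeneralizedWigner P H δ mom) (i j : Fin N) :
    HasMoments P fun ω => H ω i j where
  aestronglyMeasurable := (hW.measurable i j).aestronglyMeasurable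
  integrable_norm_pow q := by
    rcases eq_or_ne q 0 with rfl | hq
    · have h1 := (hW.finite_moments i j 1).integrable_norm_pow one_ne_zero
      have h2 := hW.indep.isProbabilityMeasure
      simp
    · exact (hW.finite_moments i j q).integrable_norm_pow hq

theorem variances_nonneg (P : Measure Ω) (H : Ω → Matrix (Fin N) (Fin N) ℂ) (i j : Fin N) :
    0 ≤ variances P H i j := integral_nonneg fun _ => by positivity

theorem variances_comm (hW : IsGeneralizedWigner P H δ mom) (i j : Fin N) :
    variances P H i j = variances P H j i := by
  refine integral_congr_ae (Filter.Eventually.of_forall fun ω => ?_)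
  simp only
  rw [← (hW.hermitian ω).apply i j, norm_star]

theorem variances_le (P : Measure Ω) (H : Ω → Matrix (Fin N) (Fin N) ℂ) (i j : Fin N) :
    variances P H i j ≤ (bandParam P H)⁻¹ := by
  rw [bandParam, one_div, inv_inv]
  exact le_ciSup (f := fun p : Fin N × Fin N => variances P H p.1 p.2)
    (Set.finite_range _).bddAbove (i, j)

theorem sum_variances_le (hW : IsGeneralizedWigner P H δ mom) (k : Fin N) (R : Finset (Fin N)) :
    ∑ j ∈ R, variances P H k j ≤ 1 := by
  rw [← hW.stochastic k]
  exact Finset.sum_le_sum_of_subset_of_nonneg (Finset.subset_univ R)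
    fun j _ _ => variances_nonneg P H k j

/-- The bound is a power of a multiple of the variance, so that the τ's of the martingale bound sum
over a row to a constant. When the variance is zero the normalized entry carries no information, but
the entry vanishes almost surely. -/
theorem integral_norm_entry_pow_le (hW : IsGeneralizedWigner P H δ mom) (i j : Fin N) (r : ℕ) :
    ∫ ω, ‖H ω i j‖ ^ (2 * (r + 1)) ∂P
      ≤ (max 1 (mom (2 * (r + 1))) * variances P H i j) ^ (r + 1) := by
  have hs0 := variances_nonneg P H i j
  have hmom : mom (2 * (r + 1)) ≤ (max 1 (mom (2 * (r + 1)))) ^ (r + 1) :=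
    (le_max_right _ _).trans (le_self_pow₀ (le_max_left _ _) (Nat.succ_ne_zero r))
  have hm := hW.moment_le i j (2 * (r + 1))
  rw [mul_pow]
  rcases hs0.eq_or_lt with h0 | hpos
  · have hz : ∫ ω, ‖H ω i j‖ ^ 2 ∂P = 0 := h0.symm
    rw [integral_eq_zero_iff_of_nonneg (fun _ => by positivity)
      ((hW.hasMoments_entry i j).integrable_norm_pow 2)] at hz
    have : ∫ ω, ‖H ω i j‖ ^ (2 * (r + 1)) ∂P = 0 := by
      rw [← integral_zero Ω ℝ (μ := P)]
      refine integral_congr_ae ?_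
      filter_upwards [hz] with ω hω
      simp only [Pi.zero_apply] at hω
      rw [pow_mul, hω, zero_pow (Nat.succ_ne_zero r)]
    rw [this]
    positivity
  · have e : ∀ ω, ‖normalizedEntry P H i j ω‖ ^ (2 * (r + 1))
        = (variances P H i j ^ (r + 1))⁻¹ * ‖H ω i j‖ ^ (2 * (r + 1)) := by
      intro ω
      rw [normalizedEntry, norm_mul, norm_inv, Complex.norm_real,
        Real.norm_of_nonneg (Real.sqrt_nonneg _), mul_pow, inv_pow, pow_mul, Real.sq_sqrt hs0]
    simp only [e] at hm
    rw [integral_const_mul, inv_mul_le_iff₀ (by positivity)] at hm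
    refine hm.trans ?_
    rw [mul_comm]
    gcongr

theorem integral_norm_sq_sub_pow_le [IsProbabilityMeasure P] (hW : IsGeneralizedWigner P H δ mom)
    (i j : Fin N) (r : ℕ) :
    ∫ ω, ‖((‖H ω i j‖ ^ 2 : ℝ) : ℂ) - variances P H i j‖ ^ (2 * (r + 1)) ∂P
      ≤ (8 * (max 1 (mom (4 * (r + 1)))) ^ 2 * variances P H i j ^ 2) ^ (r + 1) := by
  have hs0 := variances_nonneg P H i j
  set s := variances P H i j
  set μ := max 1 (mom (4 * (r + 1)))
  have hμ : 1 ≤ μ := le_max_left _ _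
  have h4 : ∫ ω, ‖H ω i j‖ ^ (4 * (r + 1)) ∂P ≤ (μ * s) ^ (2 * (r + 1)) := by
    have h := hW.integral_norm_entry_pow_le i j (2 * r + 1)
    rw [show 2 * (2 * r + 1 + 1) = 4 * (r + 1) by ring,
      show 2 * r + 1 + 1 = 2 * (r + 1) by ring] at h
    exact h
  have hint := (hW.hasMoments_entry i j).integrable_norm_pow (4 * (r + 1))
  have hmom : HasMoments P fun ω => ((‖H ω i j‖ ^ 2 : ℝ) : ℂ) - s :=
    ((hW.hasMoments_entry i j).norm_pow 2).sub (HasMoments.const _)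
  calc ∫ ω, ‖((‖H ω i j‖ ^ 2 : ℝ) : ℂ) - s‖ ^ (2 * (r + 1)) ∂P
      ≤ ∫ ω, 2 ^ (2 * (r + 1)) * (‖H ω i j‖ ^ (4 * (r + 1)) + s ^ (2 * (r + 1))) ∂P := by
        refine integral_mono (hmom.integrable_norm_pow _)
          ((hint.add (integrable_const _)).const_mul _) fun ω => ?_
        have h := norm_add_pow_le ((‖H ω i j‖ ^ 2 : ℝ) : ℂ) (-(s : ℂ)) (2 * (r + 1))
        rw [← sub_eq_add_neg, norm_neg, Complex.norm_real, Complex.norm_real,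
          Real.norm_of_nonneg hs0, Real.norm_of_nonneg (by positivity), ← pow_mul,
          show 2 * (2 * (r + 1)) = 4 * (r + 1) by ring] at h
        exact h
    _ = 2 ^ (2 * (r + 1)) * (∫ ω, ‖H ω i j‖ ^ (4 * (r + 1)) ∂P + s ^ (2 * (r + 1))) := by
        rw [integral_const_mul, integral_add hint (integrable_const _)]
        simp
    _ ≤ 2 ^ (2 * (r + 1)) * ((μ * s) ^ (2 * (r + 1)) + (μ * s) ^ (2 * (r + 1))) := by
        gcongr
        exact le_mul_of_one_le_left hs0 hμ
    _ = 2 * (4 * μ ^ 2 * s ^ 2) ^ (r + 1) := by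
        rw [pow_mul, pow_mul, ← mul_two, ← mul_assoc, ← mul_pow]
        ring
    _ ≤ 2 ^ (r + 1) * (4 * μ ^ 2 * s ^ 2) ^ (r + 1) := by
        gcongr
        exact le_self_pow₀ (by norm_num) (Nat.succ_ne_zero r)
    _ = _ := by
        rw [← mul_pow]
        ring

theorem integral_norm_sq_sub [IsProbabilityMeasure P] (hW : IsGeneralizedWigner P H δ mom)
    (i j : Fin N) : ∫ ω, (((‖H ω i j‖ ^ 2 : ℝ) : ℂ) - variances P H i j) ∂P = 0 := by
  have h : ∫ ω, ((‖H ω i j‖ ^ 2 : ℝ) : ℂ) ∂P = ((variances P H i j : ℝ) : ℂ) := integral_ofReal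
  rw [integral_sub ((hW.hasMoments_entry i j).norm_pow 2).integrable (integrable_const _), h]
  simp

/-! ### Large deviation bounds -/

theorem disjoint_rowPast (k n : Fin N) : Disjoint (rowPast k n) {edge k n} :=
  Set.disjoint_singleton_right.mpr (edge_notMem_rowPast k n)

end IsGeneralizedWigner

/-- Moments of `∑ g_n ξ_n`, where `ξ_n` is a centred function of the entry `(k, n)` and `g_n` depends
only on the other rows and on the preceding entries of row `k`. -/
theorem exists_integral_norm_rowSum_pow_le (q : ℕ) : ∃ C : ℝ, 1 ≤ C ∧
    ∀ {N : ℕ} {Ω : Type*} [MeasurableSpace Ω] {P : Measure Ω} [IsProbabilityMeasure P]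
      {H : Ω → Matrix (Fin N) (Fin N) ℂ} {δ : ℝ} {mom : ℕ → ℝ}, IsGeneralizedWigner P H δ mom →
      ∀ {k : Fin N} {s : Finset (Fin N)} {g ξ : Fin N → Ω → ℂ} {γ τ : Fin N → ℝ},
      (∀ n ∈ s, Measurable[entrySigma H (rowPast k n)] (g n)) → (∀ n ∈ s, HasMoments P (g n)) →
      (∀ n ∈ s, Measurable[entrySigma H {edge k n}] (ξ n)) → (∀ n ∈ s, HasMoments P (ξ n)) →
      (∀ n ∈ s, ∫ ω, ξ n ω ∂P = 0) → (∀ n ∈ s, 0 ≤ γ n) → (∀ n ∈ s, 0 ≤ τ n) →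
      (∀ n ∈ s, ∫ ω, ‖g n ω‖ ^ (2 * (q + 1)) ∂P ≤ γ n ^ (q + 1)) →
      (∀ n ∈ s, ∫ ω, ‖ξ n ω‖ ^ (2 * (q + 1)) ∂P ≤ τ n ^ (q + 1)) →
      ∫ ω, ‖∑ n ∈ s, g n ω * ξ n ω‖ ^ (2 * (q + 1)) ∂P ≤ (C * ∑ n ∈ s, γ n * τ n) ^ (q + 1) := by
  obtain ⟨C, hC1, hC⟩ := exists_integral_norm_sum_pow_le q
  refine ⟨C, hC1, ?_⟩
  intro N Ω _ P _ H δ mom hW k s g ξ γ τ hg hgm hξ hξm hξ0 hγ hτ hgγ hξτ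
  refine hC (fun n hn => (hgm n hn).mul (hξm n hn)) (fun n hn => mul_nonneg (hγ n hn) (hτ n hn))
    ?_ ?_
  -- Ordering row k by columns makes the summands martingale differences: the earlier sum and g n
  -- are functions of `rowPast k n`, while ξ n is centred and depends on the position (k, n) outside
  -- it.
  · intro t ht n hn htn
    have hS : Measurable[entrySigma H (rowPast k n)] fun ω => ∑ j ∈ t, g j ω * ξ j ω := by
      refine Finset.measurable_sum _ fun j hj => ?_
      refine ((hg j (ht hj)).mono (entrySigma_mono (rowPast_mono k (htn j hj).le)) le_rfl).mul
        ((hξ j (ht hj)).mono (entrySigma_mono ?_) le_rfl)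
      exact Set.singleton_subset_iff.mpr (edge_mem_rowPast (htn j hj))
    have hm : Measurable[entrySigma H (rowPast k n)] fun ω =>
        ((‖∑ j ∈ t, g j ω * ξ j ω‖ ^ (2 * q) : ℝ) : ℂ) * star (∑ j ∈ t, g j ω * ξ j ω) * g n ω :=
      ((show Measurable fun x : ℂ => ((‖x‖ ^ (2 * q) : ℝ) : ℂ) * star x by fun_prop).comp hS).mul
        (hg n hn)
    have h := hW.integral_mul_eq_zero (IsGeneralizedWigner.disjoint_rowPast k n) hm (hξ n hn)
      (hξ0 n hn)
    rw [← h]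
    refine integral_congr_ae (Filter.Eventually.of_forall fun ω => ?_)
    simp only
    ring
  · intro n hn
    rw [hW.integral_norm_mul_pow (IsGeneralizedWigner.disjoint_rowPast k n) (hg n hn) (hξ n hn),
      mul_pow]
    exact mul_le_mul (hgγ n hn) (hξτ n hn) (integral_nonneg fun _ => by positivity)
      (pow_nonneg (hγ n hn) _)

/-- Moments of the off-diagonal part of a quadratic form in row `k` whose coefficients depend only on
the other rows. -/
theorem exists_integral_norm_rowQuad_pow_le (q : ℕ) : ∃ C : ℝ, 1 ≤ C ∧
    ∀ {N : ℕ} {Ω : Type*} [MeasurableSpace Ω] {P : Measure Ω} [IsProbabilityMeasure P]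
      {H : Ω → Matrix (Fin N) (Fin N) ℂ} {δ : ℝ} {mom : ℕ → ℝ}, IsGeneralizedWigner P H δ mom →
      ∀ {k : Fin N} {s : Finset (Fin N)} {g : Fin N → Fin N → Ω → ℂ} {ξ ζ : Fin N → Ω → ℂ}
        {γ : ℝ} {τ : Fin N → ℝ},
      (∀ n j, Measurable[entrySigma H (awayFrom {k})] (g n j)) →
      (∀ n j, HasMoments P (g n j)) →
      (∀ n, Measurable[entrySigma H {edge k n}] (ξ n)) → (∀ n, HasMoments P (ξ n)) →
      (∀ n, Measurable[entrySigma H {edge k n}] (ζ n)) → (∀ n, HasMoments P (ζ n)) →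
      (∀ n, ∫ ω, ξ n ω ∂P = 0) → (∀ n, ∫ ω, ζ n ω ∂P = 0) → 0 ≤ γ → (∀ n, 0 ≤ τ n) →
      (∀ n ∈ s, ∀ j ∈ s, j < n → ∫ ω, ‖g n j ω‖ ^ (2 * (q + 1)) ∂P ≤ γ ^ (q + 1)) →
      (∀ n, ∫ ω, ‖ξ n ω‖ ^ (2 * (q + 1)) ∂P ≤ τ n ^ (q + 1)) →
      (∀ n, ∫ ω, ‖ζ n ω‖ ^ (2 * (q + 1)) ∂P ≤ τ n ^ (q + 1)) →
      ∫ ω, ‖∑ n ∈ s, (∑ j ∈ s with j < n, g n j ω * ζ j ω) * ξ n ω‖ ^ (2 * (q + 1)) ∂P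
        ≤ (C * γ * (∑ n ∈ s, τ n) ^ 2) ^ (q + 1) := by
  obtain ⟨C, hC1, hC⟩ := exists_integral_norm_rowSum_pow_le q
  refine ⟨C * C, one_le_mul_of_one_le_of_one_le hC1 hC1, ?_⟩
  intro N Ω _ P _ H δ mom hW k s g ξ ζ γ τ hg hgm hξ hξm hζ hζm hξ0 hζ0 hγ hτ hgγ hξτ hζτ
  have hC0 : 0 ≤ C := zero_le_one.trans hC1
  have hτs : 0 ≤ ∑ n ∈ s, τ n := Finset.sum_nonneg fun n _ => hτ n
  -- The linear bound is used twice: the inner sums serve as coefficients of the outer one, which is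
  -- allowed since j < n, and their moments are bounded by the linear bound itself.
  have h := hC hW (k := k) (s := s) (g := fun n ω => ∑ j ∈ s with j < n, g n j ω * ζ j ω) (ξ := ξ)
    (γ := fun _ => C * (γ * ∑ n ∈ s, τ n)) (τ := τ) ?_
    (fun n _ => HasMoments.sum fun j _ => (hgm n j).mul (hζm j)) (fun n _ => hξ n)
    (fun n _ => hξm n) (fun n _ => hξ0 n) (fun n _ => by positivity) (fun n _ => hτ n) ?_
    (fun n _ => hξτ n)
  · refine h.trans (le_of_eq ?_)
    rw [← Finset.mul_sum]
    ring
  · intro n _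
    refine Finset.measurable_sum _ fun j hj => ?_
    refine ((hg n j).mono (entrySigma_mono Set.subset_union_left) le_rfl).mul
      ((hζ j).mono (entrySigma_mono ?_) le_rfl)
    exact Set.singleton_subset_iff.mpr (edge_mem_rowPast (Finset.mem_filter.mp hj).2)
  · intro n hn
    have h2 := hC hW (k := k) (s := s.filter (· < n)) (g := g n) (ξ := ζ) (γ := fun _ => γ) (τ := τ)
      (fun j _ => (hg n j).mono (entrySigma_mono Set.subset_union_left) le_rfl)
      (fun j _ => hgm n j) (fun j _ => hζ j) (fun j _ => hζm j) (fun j _ => hζ0 j) (fun _ _ => hγ)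
      (fun j _ => hτ j) (fun j hj => hgγ n hn j (Finset.mem_filter.mp hj).1
        (Finset.mem_filter.mp hj).2) (fun j _ => hζτ j)
    refine h2.trans ?_
    rw [← Finset.mul_sum]
    have : ∑ j ∈ s with j < n, τ j ≤ ∑ j ∈ s, τ j :=
      Finset.sum_le_sum_of_subset_of_nonneg (Finset.filter_subset _ _) fun j _ _ => hτ j
    have h0 : 0 ≤ ∑ j ∈ s with j < n, τ j := Finset.sum_nonneg fun j _ => hτ j
    gcongr

end Wigner

/-! ### The fluctuation of `1 / G_kk` -/

section CentredInv

/-- Two triangular parts and the diagonal: in each triangular part the outer index is the later one,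
as the martingale bound requires. -/
theorem sum_sum_eq_sum_lt_add {N : ℕ} (R : Finset (Fin N)) (f : Fin N → Fin N → ℂ) :
    ∑ p ∈ R, ∑ q ∈ R, f p q = ∑ n ∈ R, ∑ j ∈ R with j < n, f n j
      + ∑ n ∈ R, ∑ j ∈ R with j < n, f j n + ∑ n ∈ R, f n n := by
  have h1 : ∀ p ∈ R, ∑ q ∈ R, f p q = ∑ q ∈ R with q < p, f p q
      + ∑ q ∈ R with p < q, f p q + f p p := by
    intro p hp
    rw [← Finset.sum_filter_add_sum_filter_not R (fun q => q < p), add_assoc]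
    congr 1
    rw [← Finset.sum_filter_add_sum_filter_not (R.filter fun q => ¬ q < p) (fun q => p < q),
      Finset.filter_filter, Finset.filter_filter]
    congr 1
    · exact Finset.sum_congr (Finset.filter_congr fun q _ => ⟨fun h => h.2,
        fun h => ⟨not_lt.mpr h.le, h⟩⟩) fun _ _ => rfl
    · rw [Finset.sum_eq_single p]
      · intro q hq hqp
        simp only [Finset.mem_filter, not_lt] at hq
        exact absurd (le_antisymm hq.2.2 hq.2.1) hqp
      · intro h
        simp [hp] at h
  rw [Finset.sum_congr rfl h1, Finset.sum_add_distrib, Finset.sum_add_distrib]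
  congr 2
  simp only [Finset.sum_filter]
  rw [Finset.sum_comm]

theorem norm_sub_add_add_pow_le (q : ℕ) (a b c d : ℂ) : ‖a - (b + c + d)‖ ^ (2 * (q + 1))
    ≤ 64 ^ (q + 1) * (‖a‖ ^ (2 * (q + 1)) + ‖b‖ ^ (2 * (q + 1)) + ‖c‖ ^ (2 * (q + 1))
      + ‖d‖ ^ (2 * (q + 1))) := by
  have h1 := norm_add_pow_le a (-(b + c + d)) (2 * (q + 1))
  have h2 := norm_add_pow_le (b + c) d (2 * (q + 1))
  have h3 := norm_add_pow_le b c (2 * (q + 1))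
  rw [norm_neg, ← sub_eq_add_neg] at h1
  have h4 : (2 : ℝ) ^ (2 * (q + 1)) = 4 ^ (q + 1) := by rw [pow_mul]; norm_num
  have h5 : (64 : ℝ) ^ (q + 1) = 4 ^ (q + 1) * 4 ^ (q + 1) * 4 ^ (q + 1) := by
    rw [← mul_pow, ← mul_pow]
    norm_num
  have h6 : (1 : ℝ) ≤ 4 ^ (q + 1) := one_le_pow₀ (by norm_num)
  rw [h4] at h1 h2 h3
  rw [h5]
  set F : ℝ := 4 ^ (q + 1)
  have ha : 0 ≤ ‖a‖ ^ (2 * (q + 1)) := by positivity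
  have hb : 0 ≤ ‖b‖ ^ (2 * (q + 1)) := by positivity
  have hc : 0 ≤ ‖c‖ ^ (2 * (q + 1)) := by positivity
  have hd : 0 ≤ ‖d‖ ^ (2 * (q + 1)) := by positivity
  have hF : F ≤ F * F * F := by nlinarith [mul_le_mul h6 h6 zero_le_one (by linarith)]
  have hF2 : F * F ≤ F * F * F := by nlinarith [mul_nonneg (zero_le_one.trans h6) (zero_le_one.trans h6)]
  calc ‖a - (b + c + d)‖ ^ (2 * (q + 1))
      ≤ F * (‖a‖ ^ (2 * (q + 1)) + ‖b + c + d‖ ^ (2 * (q + 1))) := h1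
    _ ≤ F * (‖a‖ ^ (2 * (q + 1)) + F * (F * (‖b‖ ^ (2 * (q + 1)) + ‖c‖ ^ (2 * (q + 1)))
        + ‖d‖ ^ (2 * (q + 1)))) := by
        gcongr
        refine h2.trans ?_
        gcongr
    _ = F * ‖a‖ ^ (2 * (q + 1)) + F * F * F * (‖b‖ ^ (2 * (q + 1)) + ‖c‖ ^ (2 * (q + 1)))
        + F * F * ‖d‖ ^ (2 * (q + 1)) := by ring
    _ ≤ F * F * F * ‖a‖ ^ (2 * (q + 1)) + F * F * F * (‖b‖ ^ (2 * (q + 1))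
        + ‖c‖ ^ (2 * (q + 1))) + F * F * F * ‖d‖ ^ (2 * (q + 1)) := by gcongr
    _ = _ := by ring

theorem measurable_matrix_of_entries {N : ℕ} {Ω : Type*} {m : MeasurableSpace Ω}
    {A : Ω → Matrix (Fin N) (Fin N) ℂ} (hA : ∀ i j, Measurable[m] fun ω => A ω i j) :
    Measurable[m] fun ω i j => A ω i j :=
  measurable_pi_lambda _ fun i => measurable_pi_lambda _ fun j => hA i j

variable {N : ℕ} {Ω : Type*} [mΩ : MeasurableSpace Ω] {P : Measure Ω}
  {H : Ω → Matrix (Fin N) (Fin N) ℂ} {δ : ℝ} {mom : ℕ → ℝ} {z : ℂ}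

/-- The conditional expectation of `1 / G_kk^(T)` given the minor `H^(k)`. -/
def meanInv (P : Measure Ω) (H : Ω → Matrix (Fin N) (Fin N) ℂ) (z : ℂ) (k : Fin N)
    (T : Finset (Fin N)) (ω : Ω) : ℂ :=
  -z - ∑ i ∈ (insert k T)ᶜ, (variances P H k i : ℂ) * greenMinor (H ω) z i i (insert k T)

/-- The fluctuation `Q_k (1 / G_kk^(T))`. -/
def centredInv (P : Measure Ω) (H : Ω → Matrix (Fin N) (Fin N) ℂ) (z : ℂ) (k : Fin N)
    (T : Finset (Fin N)) (ω : Ω) : ℂ :=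
  (greenMinor (H ω) z k k T)⁻¹ - meanInv P H z k T ω

/-- Schur's formula for H^(T), with sums restricted to indices outside T and k because the other
entries vanish. Averaging over row k leaves only the diagonal terms, with |h_kn|² replaced by its
mean, so what remains is built from centred functions of single entries of row k. -/
theorem centredInv_eq (hH : ∀ ω, (H ω).IsHermitian) (hz : 0 < z.im) {k : Fin N}
    {T : Finset (Fin N)} (hk : k ∉ T) (ω : Ω) : centredInv P H z k T ω = H ω k k
      - (∑ n ∈ (insert k T)ᶜ, (∑ j ∈ (insert k T)ᶜ with j < n,
          greenMinor (H ω) z n j (insert k T) * H ω j k) * H ω k n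
        + ∑ n ∈ (insert k T)ᶜ, (∑ j ∈ (insert k T)ᶜ with j < n,
          greenMinor (H ω) z j n (insert k T) * H ω k j) * H ω n k
        + ∑ n ∈ (insert k T)ᶜ, greenMinor (H ω) z n n (insert k T)
          * (((‖H ω k n‖ ^ 2 : ℝ) : ℂ) - variances P H k n)) := by
  have h1 := one_div_green_apply_self (minor_isHermitian (hH ω) T) hz k
  have hsub : (insert k T)ᶜ ⊆ Finset.univ.erase k := fun x hx => by
    simp only [Finset.mem_compl, Finset.mem_insert, not_or] at hx
    simp [hx.1]
  have hzero : ∀ x ∈ Finset.univ.erase k, x ∉ (insert k T)ᶜ → x ∈ T := fun x hx hx' => by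
    simp only [Finset.mem_compl, Finset.mem_insert, not_not] at hx'
    exact hx'.resolve_left (Finset.ne_of_mem_erase hx)
  have hmem : ∀ x ∈ (insert k T)ᶜ, x ∉ T := fun x hx h => by
    simp [h] at hx
  rw [minor_minor, Finset.union_comm, ← Finset.insert_eq] at h1
  rw [← Finset.sum_subset hsub] at h1
  swap
  · intro x hx hx'
    refine Finset.sum_eq_zero fun q _ => ?_
    simp [minor, hzero x hx hx']
  rw [Finset.sum_congr rfl (g := fun p => ∑ q ∈ (insert k T)ᶜ,
    H ω k p * greenMinor (H ω) z p q (insert k T) * H ω q k)] at h1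
  swap
  · intro p hp
    rw [← Finset.sum_subset hsub]
    · refine Finset.sum_congr rfl fun q hq => ?_
      simp [minor, hk, hmem p hp, hmem q hq, greenMinor]
    · intro x hx hx'
      simp [minor, hzero x hx hx']
  rw [one_div, sum_sum_eq_sum_lt_add] at h1
  have hkk : minor (H ω) T k k = H ω k k := by simp [minor, hk]
  have hd : ∀ n, H ω k n * H ω n k = ((‖H ω k n‖ ^ 2 : ℝ) : ℂ) := fun n => by
    rw [← (hH ω).apply n k, Complex.star_def, Complex.mul_conj, Complex.normSq_eq_norm_sq]
  have e1 : ∑ n ∈ (insert k T)ᶜ, ∑ j ∈ (insert k T)ᶜ with j < n,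
      H ω k n * greenMinor (H ω) z n j (insert k T) * H ω j k
      = ∑ n ∈ (insert k T)ᶜ, (∑ j ∈ (insert k T)ᶜ with j < n,
        greenMinor (H ω) z n j (insert k T) * H ω j k) * H ω k n := by
    refine Finset.sum_congr rfl fun n _ => ?_
    rw [Finset.sum_mul]
    exact Finset.sum_congr rfl fun j _ => by ring
  have e2 : ∑ n ∈ (insert k T)ᶜ, ∑ j ∈ (insert k T)ᶜ with j < n,
      H ω k j * greenMinor (H ω) z j n (insert k T) * H ω n k
      = ∑ n ∈ (insert k T)ᶜ, (∑ j ∈ (insert k T)ᶜ with j < n,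
        greenMinor (H ω) z j n (insert k T) * H ω k j) * H ω n k := by
    refine Finset.sum_congr rfl fun n _ => ?_
    rw [Finset.sum_mul]
    exact Finset.sum_congr rfl fun j _ => by ring
  have e3 : ∑ n ∈ (insert k T)ᶜ, greenMinor (H ω) z n n (insert k T)
      * (((‖H ω k n‖ ^ 2 : ℝ) : ℂ) - variances P H k n)
      = ∑ n ∈ (insert k T)ᶜ, H ω k n * greenMinor (H ω) z n n (insert k T) * H ω n k
        - ∑ n ∈ (insert k T)ᶜ, (variances P H k n : ℂ) * greenMinor (H ω) z n n (insert k T) := by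
    rw [← Finset.sum_sub_distrib]
    refine Finset.sum_congr rfl fun n _ => ?_
    rw [← hd]
    ring
  rw [centredInv, meanInv, greenMinor, h1, hkk, e1, e2, e3]
  ring

/-- `X` has all moments and is orthogonal to `W`. -/
def OrthTo (P : Measure Ω) (W X : Ω → ℂ) : Prop :=
  HasMoments P X ∧ ∫ ω, W ω * X ω ∂P = 0

theorem OrthTo.add {W X Y : Ω → ℂ} (hW : HasMoments P W) (hX : OrthTo P W X) (hY : OrthTo P W Y) :
    OrthTo P W (fun ω => X ω + Y ω) := by
  refine ⟨hX.1.add hY.1, ?_⟩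
  simp only [mul_add]
  rw [integral_add (hW.mul hX.1).integrable (hW.mul hY.1).integrable, hX.2, hY.2, add_zero]

theorem OrthTo.const_mul {W X : Ω → ℂ} (hX : OrthTo P W X) (c : ℂ) :
    OrthTo P W (fun ω => c * X ω) := by
  refine ⟨hX.1.const_mul c, ?_⟩
  simp only [mul_left_comm]
  rw [integral_const_mul, hX.2, mul_zero]

theorem OrthTo.sub {W X Y : Ω → ℂ} (hW : HasMoments P W) (hX : OrthTo P W X) (hY : OrthTo P W Y) :
    OrthTo P W (fun ω => X ω - Y ω) := by
  simpa [sub_eq_add_neg] using hX.add hW (hY.const_mul (-1))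

theorem OrthTo.sum [IsFiniteMeasure P] {ι : Type*} {s : Finset ι} {W : Ω → ℂ} {X : ι → Ω → ℂ}
    (hW : HasMoments P W) (hX : ∀ i ∈ s, OrthTo P W (X i)) :
    OrthTo P W (fun ω => ∑ i ∈ s, X i ω) := by
  refine ⟨HasMoments.sum fun i hi => (hX i hi).1, ?_⟩
  simp only [Finset.mul_sum]
  rw [integral_finsetSum _ fun i hi => (hW.mul (hX i hi).1).integrable]
  exact Finset.sum_eq_zero fun i hi => (hX i hi).2

/-! ### Orthogonality to functions of H^(k) and conditional expectations. -/

namespace IsGeneralizedWigner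

theorem measurable_centredInv (hW : IsGeneralizedWigner P H δ mom) (z : ℂ) (k : Fin N)
    (T : Finset (Fin N)) : Measurable[entrySigma H (awayFrom T)] (centredInv P H z k T) :=
  (measurable_greenMinor hW.hermitian z k k subset_rfl).inv.sub (measurable_const.sub
    (Finset.measurable_sum _ fun i _ => (measurable_greenMinor hW.hermitian z i i
      (Finset.subset_insert k T)).const_mul _))

theorem comap_minor_le (hW : IsGeneralizedWigner P H δ mom) (k : Fin N) :
    MeasurableSpace.comap (fun ω i j => minor (H ω) {k} i j) MeasurableSpace.pi
      ≤ entrySigma H (awayFrom {k}) := by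
  refine Measurable.comap_le (measurable_matrix_of_entries fun i j => ?_)
  simp only [minor]
  split_ifs with h
  · exact measurable_const
  · push Not at h
    exact measurable_entry hW.hermitian (edge_mem_awayFrom h.1 h.2)

/-- Removing k and T from H amounts to removing T from H^(k). Measurability is needed for the
σ-algebra of H^(k) itself in order to identify the conditional expectation. -/
theorem measurable_meanInv (H : Ω → Matrix (Fin N) (Fin N) ℂ) (z : ℂ) (k : Fin N)
    (T : Finset (Fin N)) : Measurable[MeasurableSpace.comap (fun ω i j => minor (H ω) {k} i j)
      MeasurableSpace.pi] (meanInv P H z k T) := by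
  refine measurable_const.sub (Finset.measurable_sum _ fun i _ => Measurable.const_mul ?_ _)
  have e : ∀ ω, greenMinor (H ω) z i i (insert k T) = green (minor (minor (H ω) {k}) T) z i i :=
    fun ω => by rw [minor_minor, ← Finset.insert_eq, greenMinor]
  simp only [e]
  refine measurable_green (fun p q => ?_) z i i
  have hpq : Measurable[MeasurableSpace.comap (fun ω i j => minor (H ω) {k} i j)
      MeasurableSpace.pi] fun ω => minor (H ω) {k} p q :=
    (measurable_pi_apply q).comp ((measurable_pi_apply p).comp
      (comap_measurable (fun ω i j => minor (H ω) {k} i j)))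
  rw [show (fun ω => minor (minor (H ω) {k}) T p q)
    = fun ω => if p ∈ T ∨ q ∈ T then 0 else minor (H ω) {k} p q from rfl]
  split_ifs
  · exact measurable_const
  · exact hpq

variable [IsProbabilityMeasure P]

theorem hasMoments_greenMinor (hW : IsGeneralizedWigner P H δ mom) (hz : 0 < z.im) (i j : Fin N)
    (T : Finset (Fin N)) : HasMoments P fun ω => greenMinor (H ω) z i j T :=
  HasMoments.of_bound (hW.measurable_of_entrySigma
    (measurable_greenMinor hW.hermitian z i j subset_rfl)).aestronglyMeasurable
    fun ω => norm_green_apply_le (minor_isHermitian (hW.hermitian ω) T) hz i j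

/-- In each term of the expansion, the function of the entry with the latest column is centred and
independent of W and of the remaining factors. -/
theorem orthTo_centredInv (hW : IsGeneralizedWigner P H δ mom) (hz : 0 < z.im) {k : Fin N}
    {T : Finset (Fin N)} (hk : k ∉ T) {W : Ω → ℂ} (hWm : HasMoments P W)
    (hWs : Measurable[entrySigma H (awayFrom {k})] W) :
    OrthTo P W (centredInv P H z k T) := by
  have hfun : centredInv P H z k T = _ := funext fun ω => centredInv_eq hW.hermitian hz hk ω
  have hent := fun i j => hW.hasMoments_entry i j
  have hG := fun i j => hW.hasMoments_greenMinor hz i j (insert k T)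
  have hGm : ∀ i j, Measurable[entrySigma H (awayFrom {k})]
      fun ω => greenMinor (H ω) z i j (insert k T) := fun i j =>
    measurable_greenMinor hW.hermitian z i j (Finset.singleton_subset_iff.mpr
      (Finset.mem_insert_self k T))
  have hcen : ∀ n, ∫ ω, H ω n k ∂P = 0 := fun n => hW.centred n k
  have hsym : ∀ i j : Fin N, edge i j = edge j i := fun i j => by
    unfold edge
    split_ifs with h1 h2 h2
    · obtain rfl := le_antisymm h1 h2
      rfl
    · rfl
    · rfl
    · exact absurd (le_of_not_ge h1) h2
  have hrow : ∀ n, Measurable[entrySigma H {edge k n}] fun ω => H ω k n := fun n =>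
    measurable_entry hW.hermitian rfl
  have hcol : ∀ n, Measurable[entrySigma H {edge k n}] fun ω => H ω n k := fun n =>
    measurable_entry hW.hermitian (hsym n k)
  have hrow' : ∀ {j n}, j < n → Measurable[entrySigma H (rowPast k n)] fun ω => H ω k j :=
    fun h => measurable_entry hW.hermitian (edge_mem_rowPast h)
  have hcol' : ∀ {j n}, j < n → Measurable[entrySigma H (rowPast k n)] fun ω => H ω j k :=
    fun {j n} h => measurable_entry hW.hermitian (hsym j k ▸ edge_mem_rowPast h)
  have hpast : ∀ {X : Ω → ℂ} {n}, Measurable[entrySigma H (awayFrom {k})] X →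
      Measurable[entrySigma H (rowPast k n)] X := fun hX =>
    hX.mono (entrySigma_mono Set.subset_union_left) le_rfl
  rw [hfun]
  refine OrthTo.sub hWm ⟨hent k k, ?_⟩ (OrthTo.add hWm (OrthTo.add hWm
    (OrthTo.sum hWm fun n _ => ?_) (OrthTo.sum hWm fun n _ => ?_)) (OrthTo.sum hWm fun n _ => ?_))
  · exact hW.integral_mul_eq_zero (disjoint_rowPast k k) (hpast hWs) (hrow k) (hW.centred k k)
  · simp only [Finset.sum_mul]
    refine OrthTo.sum hWm fun j hj => ⟨((hG n j).mul (hent j k)).mul (hent k n), ?_⟩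
    have hjn := (Finset.mem_filter.mp hj).2
    have := hW.integral_mul_eq_zero (disjoint_rowPast k n) ((hpast hWs).mul
      ((hpast (hGm n j)).mul (hcol' hjn))) (hrow n) (hW.centred k n)
    simpa only [mul_assoc, Pi.mul_apply] using this
  · simp only [Finset.sum_mul]
    refine OrthTo.sum hWm fun j hj => ⟨((hG j n).mul (hent k j)).mul (hent n k), ?_⟩
    have hjn := (Finset.mem_filter.mp hj).2
    have := hW.integral_mul_eq_zero (disjoint_rowPast k n) ((hpast hWs).mul
      ((hpast (hGm j n)).mul (hrow' hjn))) (hcol n) (hW.centred n k)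
    simpa only [mul_assoc, Pi.mul_apply] using this
  · refine ⟨(hG n n).mul (((hent k n).norm_pow 2).sub (HasMoments.const _)), ?_⟩
    have := hW.integral_mul_eq_zero (disjoint_rowPast k n) ((hpast hWs).mul (hpast (hGm n n)))
      ((show Measurable fun x : ℂ => ((‖x‖ ^ 2 : ℝ) : ℂ) - variances P H k n by fun_prop).comp
        (hrow n)) (hW.integral_norm_sq_sub k n)
    simpa only [mul_assoc, Pi.mul_apply, Function.comp] using this

theorem hasMoments_centredInv (hW : IsGeneralizedWigner P H δ mom) (hz : 0 < z.im) {k : Fin N}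
    {T : Finset (Fin N)} (hk : k ∉ T) : HasMoments P (centredInv P H z k T) :=
  (hW.orthTo_centredInv hz hk (HasMoments.const 0) measurable_const).1

theorem hasMoments_meanInv (hW : IsGeneralizedWigner P H δ mom) (hz : 0 < z.im) (k : Fin N)
    (T : Finset (Fin N)) : HasMoments P (meanInv P H z k T) :=
  (HasMoments.const _).sub (HasMoments.sum fun i _ =>
    (hW.hasMoments_greenMinor hz i i _).const_mul _)

/-- The inverse of a diagonal entry has no deterministic bound; its moments come from Schur's
formula, a polynomial in row k with bounded coefficients. -/
theorem hasMoments_inv_greenMinor (hW : IsGeneralizedWigner P H δ mom) (hz : 0 < z.im) {k : Fin N}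
    {T : Finset (Fin N)} (hk : k ∉ T) :
    HasMoments P fun ω => (greenMinor (H ω) z k k T)⁻¹ := by
  have h := (hW.hasMoments_centredInv hz hk).add (hW.hasMoments_meanInv hz k T)
  simpa only [centredInv, sub_add_cancel] using h

/-- The conditional expectation of an alternating difference of `1 / G_kk` given `H^(k)`. -/
theorem altDiff_meanInv_ae_eq (hW : IsGeneralizedWigner P H δ mom) (hz : 0 < z.im) {k : Fin N}
    {A T : Finset (Fin N)} (hk : k ∉ T ∪ A) :
    (fun ω => altDiff A (fun U => meanInv P H z k U ω) T) =ᵐ[P]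
      partialExp P H k (fun ω => altDiff A (fun U => (greenMinor (H ω) z k k U)⁻¹) T) := by
  have hkS : ∀ S ∈ A.powerset, k ∉ T ∪ S := fun S hS h =>
    hk (Finset.union_subset_union_right (Finset.mem_powerset.mp hS) h)
  have hX : HasMoments P fun ω => altDiff A (fun U => (greenMinor (H ω) z k k U)⁻¹) T :=
    HasMoments.sum fun S hS => (hW.hasMoments_inv_greenMinor hz (hkS S hS)).const_mul _
  have hM : HasMoments P fun ω => altDiff A (fun U => meanInv P H z k U ω) T :=
    HasMoments.sum fun S _ => (hW.hasMoments_meanInv hz k _).const_mul _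
  have hle := (hW.comap_minor_le k).trans hW.entrySigma_le
  refine ae_eq_condExp_of_forall_setIntegral_eq hle hX.integrable
    (fun s _ _ => hM.integrable.integrableOn) (fun s hs _ => ?_) ?_
  · have hs' := hle s hs
    have hWs : Measurable[entrySigma H (awayFrom {k})] (s.indicator fun _ => (1 : ℂ)) :=
      measurable_const.indicator (hW.comap_minor_le k s hs)
    have hWm : HasMoments P (s.indicator fun _ => (1 : ℂ)) :=
      HasMoments.of_bound (C := 1) (hW.measurable_of_entrySigma hWs).aestronglyMeasurable fun ω => by
        by_cases h : ω ∈ s <;> simp [h]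
    -- The indicator of s is a function of H^(k), so the fluctuation is orthogonal to it; this is
    -- equality of the integrals over s.
    have horth : OrthTo P (s.indicator fun _ => (1 : ℂ))
        (fun ω => altDiff A (fun U => centredInv P H z k U ω) T) :=
      OrthTo.sum hWm fun S hS => (hW.orthTo_centredInv hz (hkS S hS) hWm hWs).const_mul _
    have h0 := horth.2
    have e : ∀ ω, s.indicator (fun _ => (1 : ℂ)) ω
        * altDiff A (fun U => centredInv P H z k U ω) T = s.indicator (fun ω =>
          altDiff A (fun U => (greenMinor (H ω) z k k U)⁻¹) T
          - altDiff A (fun U => meanInv P H z k U ω) T) ω := fun ω => by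
      by_cases h : ω ∈ s
      · simp [h, altDiff, centredInv, mul_sub]
      · simp [h]
    simp only [e] at h0
    rw [integral_indicator hs', integral_sub hX.integrable.integrableOn
      hM.integrable.integrableOn] at h0
    exact (sub_eq_zero.mp h0).symm
  · exact (Finset.measurable_sum _ fun S _ =>
      (measurable_meanInv H z k _).const_mul _).aestronglyMeasurable

theorem fluct_ae_eq (hW : IsGeneralizedWigner P H δ mom) (hz : 0 < z.im) (k : Fin N) :
    fluct P H k (fun ω => 1 / green (H ω) z k k) =ᵐ[P] centredInv P H z k ∅ := by
  have h := hW.altDiff_meanInv_ae_eq (A := ∅) (T := ∅) hz (k := k) (by simp)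
  simp only [altDiff_empty, greenMinor, minor_empty] at h
  filter_upwards [h] with ω hω
  simp only [fluct, centredInv, greenMinor, minor_empty, one_div]
  rw [hω]

/-- Centring at most doubles the `L^n` norm, up to a constant. -/
theorem integral_norm_altDiff_centredInv_pow_le (hW : IsGeneralizedWigner P H δ mom)
    (hz : 0 < z.im) {k : Fin N} {A T : Finset (Fin N)} (hk : k ∉ T ∪ A) (n : ℕ) :
    ∫ ω, ‖altDiff A (fun U => centredInv P H z k U ω) T‖ ^ n ∂P
      ≤ 2 ^ n * 2 * ∫ ω, ‖altDiff A (fun U => (greenMinor (H ω) z k k U)⁻¹) T‖ ^ n ∂P := by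
  have hkS : ∀ S ∈ A.powerset, k ∉ T ∪ S := fun S hS h =>
    hk (Finset.union_subset_union_right (Finset.mem_powerset.mp hS) h)
  have hX : HasMoments P fun ω => altDiff A (fun U => (greenMinor (H ω) z k k U)⁻¹) T :=
    HasMoments.sum fun S hS => (hW.hasMoments_inv_greenMinor hz (hkS S hS)).const_mul _
  have hM : HasMoments P fun ω => altDiff A (fun U => meanInv P H z k U ω) T :=
    HasMoments.sum fun S _ => (hW.hasMoments_meanInv hz k _).const_mul _
  have hZ : ∀ ω, altDiff A (fun U => centredInv P H z k U ω) T
      = altDiff A (fun U => (greenMinor (H ω) z k k U)⁻¹) T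
        - altDiff A (fun U => meanInv P H z k U ω) T := fun ω => by
    simp [altDiff, centredInv, mul_sub]
  have hle := (hW.comap_minor_le k).trans hW.entrySigma_le
  have hjensen : ∫ ω, ‖altDiff A (fun U => meanInv P H z k U ω) T‖ ^ n ∂P
      ≤ ∫ ω, ‖altDiff A (fun U => (greenMinor (H ω) z k k U)⁻¹) T‖ ^ n ∂P := by
    have hc : ConvexOn ℝ Set.univ (fun x : ℂ => ‖x‖ ^ n) :=
      (convexOn_norm convex_univ).pow (fun _ _ => norm_nonneg _) n
    have h := hc.map_condExp_le_univ hle (Continuous.lowerSemicontinuous (by fun_prop))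
      hX.integrable (hX.integrable_norm_pow n)
    rw [← integral_condExp hle
      (f := fun ω => ‖altDiff A (fun U => (greenMinor (H ω) z k k U)⁻¹) T‖ ^ n)]
    refine integral_mono_ae (hM.integrable_norm_pow n) integrable_condExp ?_
    filter_upwards [h, hW.altDiff_meanInv_ae_eq hz hk] with ω h1 h2
    simp only [h2]
    exact h1
  calc ∫ ω, ‖altDiff A (fun U => centredInv P H z k U ω) T‖ ^ n ∂P
      ≤ ∫ ω, 2 ^ n * (‖altDiff A (fun U => (greenMinor (H ω) z k k U)⁻¹) T‖ ^ n
        + ‖altDiff A (fun U => meanInv P H z k U ω) T‖ ^ n) ∂P := by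
        refine integral_mono ?_ (((hX.integrable_norm_pow n).add
          (hM.integrable_norm_pow n)).const_mul _) fun ω => ?_
        · simp only [hZ]
          exact (hX.sub hM).integrable_norm_pow n
        · simp only [hZ]
          rw [sub_eq_add_neg]
          refine (norm_add_pow_le _ _ n).trans (le_of_eq ?_)
          rw [norm_neg]
    _ = 2 ^ n * (∫ ω, ‖altDiff A (fun U => (greenMinor (H ω) z k k U)⁻¹) T‖ ^ n ∂P
        + ∫ ω, ‖altDiff A (fun U => meanInv P H z k U ω) T‖ ^ n ∂P) := by
        rw [integral_const_mul, integral_add (hX.integrable_norm_pow n) (hM.integrable_norm_pow n)]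
    _ ≤ _ := by
        rw [mul_assoc]
        gcongr
        linarith

end IsGeneralizedWigner

/-- The large deviation bound for the fluctuation of `1 / G_kk^(T)` in terms of the moments of the
entries of `G^(kT)`. -/
theorem exists_integral_norm_centredInv_pow_le (q : ℕ) (mom : ℕ → ℝ) : ∃ C : ℝ, 1 ≤ C ∧
    ∀ {N : ℕ} {Ω : Type*} [MeasurableSpace Ω] {P : Measure Ω} [IsProbabilityMeasure P]
      {H : Ω → Matrix (Fin N) (Fin N) ℂ} {δ : ℝ} {z : ℂ}, IsGeneralizedWigner P H δ mom →
      0 < z.im → ∀ {k : Fin N} {T : Finset (Fin N)}, k ∉ T → ∀ {γ γ' : ℝ}, 0 ≤ γ → 0 ≤ γ' →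
      (∀ i ∉ insert k T, ∀ j ∉ insert k T, i ≠ j →
        ∫ ω, ‖greenMinor (H ω) z i j (insert k T)‖ ^ (2 * (q + 1)) ∂P ≤ γ ^ (q + 1)) →
      (∀ i ∉ insert k T,
        ∫ ω, ‖greenMinor (H ω) z i i (insert k T)‖ ^ (2 * (q + 1)) ∂P ≤ γ' ^ (q + 1)) →
      ∫ ω, ‖centredInv P H z k T ω‖ ^ (2 * (q + 1)) ∂P
        ≤ (C * (γ + (1 + γ') * (bandParam P H)⁻¹)) ^ (q + 1) := by
  obtain ⟨C₁, hC₁, h₁⟩ := exists_integral_norm_rowSum_pow_le q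
  obtain ⟨C₂, hC₂, h₂⟩ := exists_integral_norm_rowQuad_pow_le q
  set μ := max 1 (mom (2 * (q + 1))) with hμdef
  set ν := max 1 (mom (4 * (q + 1))) with hνdef
  have hμ : 1 ≤ μ := le_max_left _ _
  have hν : 1 ≤ ν := le_max_left _ _
  set C := μ + C₂ * μ ^ 2 + C₁ * (8 * ν ^ 2) with hCdef
  have hCa : μ ≤ C := by
    have h1 : 0 ≤ C₂ * μ ^ 2 := by positivity
    have h2 : 0 ≤ C₁ * (8 * ν ^ 2) := by positivity
    linarith
  have hCb : C₂ * μ ^ 2 ≤ C := by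
    have h1 : 0 ≤ C₁ * (8 * ν ^ 2) := by positivity
    linarith
  have hCc : C₁ * (8 * ν ^ 2) ≤ C := by
    have h1 : 0 ≤ C₂ * μ ^ 2 := by positivity
    linarith
  refine ⟨256 * C, by linarith, ?_⟩
  intro N Ω _ P _ H δ z hW hz k T hk γ γ' hγ hγ' hoff hdiag
  set R := (insert k T)ᶜ with hR
  set s := variances P H k with hs
  have hs0 : ∀ n, 0 ≤ s n := fun n => IsGeneralizedWigner.variances_nonneg P H k n
  have hsM : ∀ n, s n ≤ (bandParam P H)⁻¹ := fun n => IsGeneralizedWigner.variances_le P H k n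
  set m := (bandParam P H)⁻¹ with hm
  have hm0 : 0 ≤ m := (hs0 k).trans (hsM k)
  have hssum : ∑ n ∈ R, s n ≤ 1 := hW.sum_variances_le k R
  have hssum0 : 0 ≤ ∑ n ∈ R, s n := Finset.sum_nonneg fun n _ => hs0 n
  set B := C * (γ + (1 + γ') * m) with hB
  have hC0 : 0 ≤ C := by linarith
  have hB0 : 0 ≤ B := by positivity
  have hent := fun i j => hW.hasMoments_entry i j
  have hG := fun i j => hW.hasMoments_greenMinor hz i j (insert k T)
  have hGm : ∀ i j, Measurable[entrySigma H (awayFrom {k})]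
      fun ω => greenMinor (H ω) z i j (insert k T) := fun i j =>
    measurable_greenMinor hW.hermitian z i j (Finset.singleton_subset_iff.mpr
      (Finset.mem_insert_self k T))
  have hsym : ∀ i j : Fin N, edge i j = edge j i := fun i j => by
    unfold edge
    split_ifs with h1 h2 h2
    · obtain rfl := le_antisymm h1 h2
      rfl
    · rfl
    · rfl
    · exact absurd (le_of_not_ge h1) h2
  have hrow : ∀ n, Measurable[entrySigma H {edge k n}] fun ω => H ω k n := fun n =>
    measurable_entry hW.hermitian rfl
  have hcol : ∀ n, Measurable[entrySigma H {edge k n}] fun ω => H ω n k := fun n =>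
    measurable_entry hW.hermitian (hsym n k)
  have hrowm : ∀ n, ∫ ω, ‖H ω k n‖ ^ (2 * (q + 1)) ∂P ≤ (μ * s n) ^ (q + 1) := fun n =>
    hW.integral_norm_entry_pow_le k n q
  have hcolm : ∀ n, ∫ ω, ‖H ω n k‖ ^ (2 * (q + 1)) ∂P ≤ (μ * s n) ^ (q + 1) := fun n => by
    have := hW.integral_norm_entry_pow_le n k q
    rwa [hW.variances_comm n k] at this
  have hmem : ∀ n ∈ R, n ∉ insert k T := fun n hn => Finset.mem_compl.mp hn
  have hτ : ∀ n, 0 ≤ μ * s n := fun n => mul_nonneg (by linarith) (hs0 n)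
  -- Here γ is the square of the size of the off-diagonal entries. The variances in a row sum to at
  -- most 1, so the quadratic form costs only a constant.
  have hquad : (C₂ * γ * (∑ n ∈ R, μ * s n) ^ 2) ^ (q + 1) ≤ B ^ (q + 1) := by
    refine pow_le_pow_left₀ (by positivity) ?_ _
    rw [← Finset.mul_sum]
    calc C₂ * γ * (μ * ∑ n ∈ R, s n) ^ 2 ≤ C₂ * γ * (μ * 1) ^ 2 := by gcongr
      _ = C₂ * μ ^ 2 * γ := by ring
      _ ≤ C * γ := by gcongr
      _ ≤ B := by
        rw [hB]
        gcongr
        exact le_add_of_nonneg_right (by positivity)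
  have b1 : ∫ ω, ‖H ω k k‖ ^ (2 * (q + 1)) ∂P ≤ B ^ (q + 1) := by
    refine (hrowm k).trans (pow_le_pow_left₀ (hτ k) ?_ _)
    calc μ * s k ≤ C * ((1 + 0) * m) := by
          rw [add_zero, one_mul]
          exact mul_le_mul hCa (hsM k) (hs0 k) hC0
      _ ≤ C * (γ + (1 + γ') * m) := by
          gcongr
          exact (show (1 + 0) * m ≤ (1 + γ') * m by gcongr).trans (le_add_of_nonneg_left hγ)
  have b2 := (h₂ hW (k := k) (s := R) (g := fun n j ω => greenMinor (H ω) z n j (insert k T))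
    (ξ := fun n ω => H ω k n) (ζ := fun n ω => H ω n k) (γ := γ) (τ := fun n => μ * s n)
    (fun n j => hGm n j) (fun n j => hG n j) hrow (fun n => hent k n) hcol (fun n => hent n k)
    (fun n => hW.centred k n) (fun n => hW.centred n k) hγ hτ
    (fun n hn j hj hjn => hoff n (hmem n hn) j (hmem j hj) hjn.ne') hrowm hcolm).trans hquad
  have b3 := (h₂ hW (k := k) (s := R) (g := fun n j ω => greenMinor (H ω) z j n (insert k T))
    (ξ := fun n ω => H ω n k) (ζ := fun n ω => H ω k n) (γ := γ) (τ := fun n => μ * s n)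
    (fun n j => hGm j n) (fun n j => hG j n) hcol (fun n => hent n k) hrow (fun n => hent k n)
    (fun n => hW.centred n k) (fun n => hW.centred k n) hγ hτ
    (fun n hn j hj hjn => hoff j (hmem j hj) n (hmem n hn) hjn.ne) hcolm hrowm).trans hquad
  have b4 := h₁ hW (k := k) (s := R) (g := fun n ω => greenMinor (H ω) z n n (insert k T))
    (ξ := fun n ω => ((‖H ω k n‖ ^ 2 : ℝ) : ℂ) - variances P H k n) (γ := fun _ => γ')
    (τ := fun n => 8 * ν ^ 2 * s n ^ 2)
    (fun n _ => (hGm n n).mono (entrySigma_mono Set.subset_union_left) le_rfl)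
    (fun n _ => hG n n)
    (fun n _ => (show Measurable fun x : ℂ => ((‖x‖ ^ 2 : ℝ) : ℂ) - variances P H k n by
      fun_prop).comp (hrow n))
    (fun n _ => ((hent k n).norm_pow 2).sub (HasMoments.const _))
    (fun n _ => hW.integral_norm_sq_sub k n) (fun _ _ => hγ') (fun n _ => by positivity)
    (fun n hn => hdiag n (hmem n hn)) (fun n _ => hW.integral_norm_sq_sub_pow_le k n q)
  have b4' : (C₁ * ∑ n ∈ R, γ' * (8 * ν ^ 2 * s n ^ 2)) ^ (q + 1) ≤ B ^ (q + 1) := by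
    refine pow_le_pow_left₀ (mul_nonneg (by linarith) (Finset.sum_nonneg fun n _ => by positivity))
      ?_ _
    -- The diagonal terms have fluctuations of order s n, and the sum of squares is at most max s ·
    -- ∑ s ≤ 1/M.
    have hsq : ∑ n ∈ R, s n ^ 2 ≤ m := by
      calc ∑ n ∈ R, s n ^ 2 ≤ ∑ n ∈ R, m * s n := by
            refine Finset.sum_le_sum fun n _ => ?_
            rw [pow_two]
            exact mul_le_mul_of_nonneg_right (hsM n) (hs0 n)
        _ = m * ∑ n ∈ R, s n := by rw [Finset.mul_sum]
        _ ≤ m * 1 := by gcongr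
        _ = m := mul_one m
    calc C₁ * ∑ n ∈ R, γ' * (8 * ν ^ 2 * s n ^ 2)
        = C₁ * (8 * ν ^ 2) * (γ' * ∑ n ∈ R, s n ^ 2) := by
          rw [← Finset.mul_sum, ← Finset.mul_sum]
          ring
      _ ≤ C * (γ' * m) := by gcongr
      _ ≤ C * (γ + (1 + γ') * m) := by
          gcongr
          nlinarith
  have b4 := b4.trans b4'
  have m2 : HasMoments P fun ω => ∑ n ∈ R, (∑ j ∈ R with j < n,
      greenMinor (H ω) z n j (insert k T) * H ω j k) * H ω k n :=
    HasMoments.sum fun n _ => (HasMoments.sum fun j _ => (hG n j).mul (hent j k)).mul (hent k n)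
  have m3 : HasMoments P fun ω => ∑ n ∈ R, (∑ j ∈ R with j < n,
      greenMinor (H ω) z j n (insert k T) * H ω k j) * H ω n k :=
    HasMoments.sum fun n _ => (HasMoments.sum fun j _ => (hG j n).mul (hent k j)).mul (hent n k)
  have m4 : HasMoments P fun ω => ∑ n ∈ R, greenMinor (H ω) z n n (insert k T)
      * (((‖H ω k n‖ ^ 2 : ℝ) : ℂ) - variances P H k n) :=
    HasMoments.sum fun n _ => (hG n n).mul (((hent k n).norm_pow 2).sub (HasMoments.const _))
  have i1 := (hent k k).integrable_norm_pow (2 * (q + 1))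
  have i2 := m2.integrable_norm_pow (2 * (q + 1))
  have i3 := m3.integrable_norm_pow (2 * (q + 1))
  have i4 := m4.integrable_norm_pow (2 * (q + 1))
  have hfin : ∫ ω, ‖centredInv P H z k T ω‖ ^ (2 * (q + 1)) ∂P
      ≤ 64 ^ (q + 1) * (B ^ (q + 1) + B ^ (q + 1) + B ^ (q + 1) + B ^ (q + 1)) := by
    simp only [centredInv_eq hW.hermitian hz hk]
    refine (integral_mono ?_ ((((i1.add i2).add i3).add i4).const_mul (64 ^ (q + 1)))
      fun ω => norm_sub_add_add_pow_le q _ _ _ _).trans ?_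
    · exact ((hent k k).sub ((m2.add m3).add m4)).integrable_norm_pow _
    · rw [integral_const_mul]
      gcongr
      rw [integral_add' ((i1.add i2).add i3) i4, integral_add' (i1.add i2) i3, integral_add' i1 i2]
      gcongr
  refine hfin.trans ?_
  have h4 : (4 : ℝ) ≤ 4 ^ (q + 1) := le_self_pow₀ (by norm_num) (Nat.succ_ne_zero q)
  calc 64 ^ (q + 1) * (B ^ (q + 1) + B ^ (q + 1) + B ^ (q + 1) + B ^ (q + 1))
      = 64 ^ (q + 1) * (4 * B ^ (q + 1)) := by ring
    _ ≤ 64 ^ (q + 1) * (4 ^ (q + 1) * B ^ (q + 1)) := by gcongr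
    _ = (256 * C * (γ + (1 + γ') * m)) ^ (q + 1) := by
      rw [← mul_pow, ← mul_pow, hB]
      ring

end CentredInv

/-! ### Moments on the event that the Green function is controlled -/

section Regime

variable {N : ℕ} {Ω : Type*} [mΩ : MeasurableSpace Ω] {P : Measure Ω}
  {H : Ω → Matrix (Fin N) (Fin N) ℂ} {δ : ℝ} {mom : ℕ → ℝ} {z : ℂ}

/-- Outside the exceptional set `B`, of probability at most `ψ ^ K`, the Green function at `z` is
controlled with off-diagonal entries of size `ψ`; here `ψ` is small enough for minors of up to `d`
indices to remain controlled, and at most a power of the dimension. -/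
structure ControlRegime (P : Measure Ω) (H : Ω → Matrix (Fin N) (Fin N) ℂ) (z : ℂ) (ψ : ℝ)
    (d b K : ℕ) (B : Set Ω) : Prop where
  im_pos : 0 < z.im
  norm_le : ‖z‖ ≤ 15
  inv_im_le : z.im⁻¹ ≤ N
  card_mul_le : N * ψ ^ b ≤ 1
  inv_bandParam_le : (bandParam P H)⁻¹ ≤ ψ ^ 2
  pos : 0 < ψ
  small : 4096 * (d + 1) * 4 ^ d * ψ ≤ 1
  measurableSet : MeasurableSet B
  LambdaO_le : ∀ ω ∉ B, LambdaO (H ω) z ≤ ψ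
  Lambda_le : ∀ ω ∉ B, Lambda (H ω) z ≤ 1 / 32
  prob_le : P.real B ≤ ψ ^ K

theorem ControlRegime.two_pow_mul_le_one {ψ : ℝ} {d b K : ℕ} {B : Set Ω}
    (hR : ControlRegime P H z ψ d b K B) : 2 ^ d * ψ ≤ 1 := by
  have h0 := hR.pos
  have h1 : (1 : ℝ) ≤ 4096 * (d + 1) := by linarith [Nat.cast_nonneg (α := ℝ) d]
  calc (2 : ℝ) ^ d * ψ ≤ 4 ^ d * ψ := by
        gcongr
        norm_num
    _ = 1 * (4 ^ d * ψ) := by ring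
    _ ≤ 4096 * (d + 1) * (4 ^ d * ψ) := by gcongr
    _ = 4096 * (d + 1) * 4 ^ d * ψ := by ring
    _ ≤ 1 := hR.small

theorem ControlRegime.le_one {ψ : ℝ} {d b K : ℕ} {B : Set Ω}
    (hR : ControlRegime P H z ψ d b K B) : ψ ≤ 1 :=
  (le_mul_of_one_le_left hR.pos.le (one_le_pow₀ (by norm_num))).trans hR.two_pow_mul_le_one

theorem ControlRegime.greenControl {ψ : ℝ} {d b K : ℕ} {B : Set Ω}
    (hR : ControlRegime P H z ψ d b K B) (hH : ∀ ω, (H ω).IsHermitian) {ω : Ω} (hω : ω ∉ B)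
    {V : Finset (Fin N)} (hV : V.card ≤ d) : GreenControl (H ω) z (2 ^ d * ψ) 64 V :=
  greenControl_of_Lambda_le (hH ω) hR.im_pos hR.norm_le hR.small (hR.LambdaO_le ω hω)
    (hR.Lambda_le ω hω) hR.pos.le hV

/-- A bound outside an event of small probability, together with a rough bound on a higher moment,
controls the moments. -/
theorem integral_norm_pow_le_of_bound_off [IsProbabilityMeasure P] {X : Ω → ℂ}
    (hX : HasMoments P X) {B : Set Ω} (hB : MeasurableSet B) {a ψ C : ℝ} {n m r K : ℕ} (hψ : 0 < ψ)
    (hψ1 : ψ ≤ 1) (hK : 2 * m + r ≤ K) (hP : P.real B ≤ ψ ^ K) (ha : 0 ≤ a)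
    (hXa : ∀ ω ∉ B, ‖X ω‖ ≤ a) (hr : ψ ^ r * ∫ ω, ‖X ω‖ ^ (2 * n) ∂P ≤ C) :
    ∫ ω, ‖X ω‖ ^ n ∂P ≤ a ^ n + (1 + C) * ψ ^ m := by
  have hiB : Integrable (B.indicator fun _ => (1 : ℝ)) P := (integrable_const _).indicator hB
  have hi := hX.integrable_norm_pow (2 * n)
  have hpt : ∀ ω, ‖X ω‖ ^ n ≤ a ^ n + ((ψ ^ (m + r))⁻¹ * B.indicator (fun _ => (1 : ℝ)) ω
      + ψ ^ (m + r) * ‖X ω‖ ^ (2 * n)) := by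
    intro ω
    by_cases h : ω ∈ B
    · rw [Set.indicator_of_mem h, mul_one]
      -- Young's inequality x ≤ 1/l + l x² with l = ψ^(m+r): since K ≥ 2m + r, the first term
      -- integrates over B to at most ψ^m, and the second is ψ^m times the rough moment.
      have h1 : ‖X ω‖ ^ n ≤ (ψ ^ (m + r))⁻¹ + ψ ^ (m + r) * ‖X ω‖ ^ (2 * n) := by
        set l := ψ ^ (m + r)
        have hl : 0 < l := by positivity
        set x := ‖X ω‖ ^ n
        rw [show ‖X ω‖ ^ (2 * n) = x ^ 2 by rw [mul_comm, pow_mul]]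
        have h2 : l⁻¹ + l * x ^ 2 - x = l * ((x - l⁻¹ / 2) ^ 2 + 3 / 4 * l⁻¹ ^ 2) := by
          field_simp
          ring
        have h3 : 0 ≤ l * ((x - l⁻¹ / 2) ^ 2 + 3 / 4 * l⁻¹ ^ 2) := by positivity
        linarith
      have := pow_nonneg ha n
      linarith
    · rw [Set.indicator_of_notMem h, mul_zero, zero_add]
      have h1 := pow_le_pow_left₀ (norm_nonneg _) (hXa ω h) n
      have h2 : 0 ≤ ψ ^ (m + r) * ‖X ω‖ ^ (2 * n) := by positivity
      linarith
  calc ∫ ω, ‖X ω‖ ^ n ∂P ≤ ∫ ω, (a ^ n + ((ψ ^ (m + r))⁻¹ * B.indicator (fun _ => (1 : ℝ)) ω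
        + ψ ^ (m + r) * ‖X ω‖ ^ (2 * n))) ∂P :=
        integral_mono (hX.integrable_norm_pow n)
          ((integrable_const _).add ((hiB.const_mul _).add (hi.const_mul _))) hpt
    _ = a ^ n + ((ψ ^ (m + r))⁻¹ * P.real B + ψ ^ m * (ψ ^ r * ∫ ω, ‖X ω‖ ^ (2 * n) ∂P)) := by
        have i1 : Integrable (fun ω => (ψ ^ (m + r))⁻¹ * B.indicator (fun _ => (1 : ℝ)) ω
          + ψ ^ (m + r) * ‖X ω‖ ^ (2 * n)) P := (hiB.const_mul _).add (hi.const_mul _)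
        rw [integral_add (integrable_const _) i1, integral_add (hiB.const_mul _) (hi.const_mul _),
          integral_const_mul, integral_const_mul, integral_indicator hB, pow_add]
        simp [mul_assoc]
    _ ≤ a ^ n + (ψ ^ m + ψ ^ m * C) := by
        have h1 : (ψ ^ (m + r))⁻¹ * P.real B ≤ ψ ^ m := by
          rw [inv_mul_le_iff₀ (by positivity), ← pow_add]
          exact hP.trans (pow_le_pow_of_le_one hψ.le hψ1 (by omega))
        gcongr
    _ = _ := by ring

theorem norm_sum_pow_le {ι : Type*} (s : Finset ι) (f : ι → ℂ) (n : ℕ) :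
    ‖∑ i ∈ s, f i‖ ^ (n + 1) ≤ (s.card : ℝ) ^ n * ∑ i ∈ s, ‖f i‖ ^ (n + 1) := by
  refine (pow_le_pow_left₀ (norm_nonneg _) (norm_sum_le _ _) _).trans ?_
  exact pow_sum_le_card_mul_sum_pow (fun _ _ => norm_nonneg _) n

/-- Any polynomial growth in N is absorbed by a power of ψ; this is how rough bounds become
harmless. -/
theorem ControlRegime.pow_mul_card_pow_le {ψ : ℝ} {d b K : ℕ} {B : Set Ω}
    (hR : ControlRegime P H z ψ d b K B) (r : ℕ) : ψ ^ (r * b) * (N : ℝ) ^ r ≤ 1 := by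
  have h0 := hR.pos.le
  rw [mul_comm r b, pow_mul, ← mul_pow, mul_comm]
  exact pow_le_one₀ (by positivity) hR.card_mul_le

theorem ControlRegime.norm_greenMinor_le {ψ : ℝ} {d b K : ℕ} {B : Set Ω}
    (hR : ControlRegime P H z ψ d b K B) (hH : ∀ ω, (H ω).IsHermitian) (i j : Fin N)
    (T : Finset (Fin N)) (ω : Ω) : ‖greenMinor (H ω) z i j T‖ ≤ N :=
  (norm_green_apply_le (minor_isHermitian (hH ω) T) hR.im_pos i j).trans hR.inv_im_le

theorem integral_le_of_forall_le [IsProbabilityMeasure P] {f : Ω → ℝ} {c : ℝ} (hf : Integrable f P)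
    (h : ∀ ω, f ω ≤ c) : ∫ ω, f ω ∂P ≤ c := by
  refine (integral_mono hf (integrable_const c) h).trans (le_of_eq ?_)
  simp

/-- Rough bounds on the moments of `1 / G_kk^(T)`. -/
theorem exists_integral_norm_inv_greenMinor_pow_le (q : ℕ) (mom : ℕ → ℝ) : ∃ C : ℝ, 1 ≤ C ∧
    ∀ {N : ℕ} {Ω : Type*} [MeasurableSpace Ω] {P : Measure Ω} [IsProbabilityMeasure P]
      {H : Ω → Matrix (Fin N) (Fin N) ℂ} {δ : ℝ} {z : ℂ} {ψ : ℝ} {d b K : ℕ} {B : Set Ω},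
      IsGeneralizedWigner P H δ mom → ControlRegime P H z ψ d b K B →
      ∀ {k : Fin N} {T : Finset (Fin N)}, k ∉ T →
      ψ ^ (2 * (q + 1) * b) * ∫ ω, ‖(greenMinor (H ω) z k k T)⁻¹‖ ^ (2 * (q + 1)) ∂P ≤ C := by
  obtain ⟨C, hC1, hC⟩ := exists_integral_norm_centredInv_pow_le q mom
  refine ⟨2 ^ (2 * (q + 1)) * ((C * 3) ^ (q + 1) + 16 ^ (2 * (q + 1))), ?_, ?_⟩
  · have h1 : (1 : ℝ) ≤ 2 ^ (2 * (q + 1)) := one_le_pow₀ (by norm_num)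
    have h2 : (1 : ℝ) ≤ (C * 3) ^ (q + 1) := one_le_pow₀ (by linarith)
    have h3 : (0 : ℝ) ≤ 16 ^ (2 * (q + 1)) := by positivity
    nlinarith
  intro N Ω _ P _ H δ z ψ d b K B hW hR k T hk
  have hN : (1 : ℝ) ≤ N := by
    have := Nat.one_le_iff_ne_zero.mpr (fun h => by subst h; exact k.elim0 : N ≠ 0)
    exact_mod_cast this
  have hψ := hR.pos.le
  have hm : (bandParam P H)⁻¹ ≤ 1 :=
    hR.inv_bandParam_le.trans (pow_le_one₀ hψ hR.le_one)
  have hm0 : 0 ≤ (bandParam P H)⁻¹ :=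
    (IsGeneralizedWigner.variances_nonneg P H k k).trans
      (IsGeneralizedWigner.variances_le P H k k)
  have hG : ∀ i j, ∫ ω, ‖greenMinor (H ω) z i j (insert k T)‖ ^ (2 * (q + 1)) ∂P
      ≤ ((N : ℝ) ^ 2) ^ (q + 1) := fun i j => by
    refine integral_le_of_forall_le
      ((hW.hasMoments_greenMinor hR.im_pos i j _).integrable_norm_pow _) fun ω => ?_
    rw [← pow_mul]
    exact pow_le_pow_left₀ (norm_nonneg _) (hR.norm_greenMinor_le hW.hermitian i j _ ω) _
  have hZ := hC hW hR.im_pos hk (γ := (N : ℝ) ^ 2) (γ' := (N : ℝ) ^ 2) (by positivity)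
    (by positivity) (fun i _ j _ _ => hG i j) (fun i _ => hG i i)
  have hZ' : ∫ ω, ‖centredInv P H z k T ω‖ ^ (2 * (q + 1)) ∂P
      ≤ (C * 3) ^ (q + 1) * (N : ℝ) ^ (2 * (q + 1)) := by
    refine hZ.trans ?_
    rw [pow_mul, ← mul_pow]
    refine pow_le_pow_left₀ (by positivity) ?_ _
    have h1 : (1 + (N : ℝ) ^ 2) * (bandParam P H)⁻¹ ≤ 2 * (N : ℝ) ^ 2 := by
      calc (1 + (N : ℝ) ^ 2) * (bandParam P H)⁻¹ ≤ (1 + (N : ℝ) ^ 2) * 1 := by gcongr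
        _ ≤ _ := by nlinarith
    calc C * ((N : ℝ) ^ 2 + (1 + (N : ℝ) ^ 2) * (bandParam P H)⁻¹)
        ≤ C * ((N : ℝ) ^ 2 + 2 * (N : ℝ) ^ 2) := by gcongr
      _ = _ := by ring
  have hMn : ∀ ω, ‖meanInv P H z k T ω‖ ≤ 16 * N := by
    intro ω
    have h1 : ‖∑ i ∈ (insert k T)ᶜ, (variances P H k i : ℂ) * greenMinor (H ω) z i i (insert k T)‖
        ≤ N := by
      refine (norm_sum_le _ _).trans ?_
      calc ∑ i ∈ (insert k T)ᶜ, ‖(variances P H k i : ℂ) * greenMinor (H ω) z i i (insert k T)‖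
          ≤ ∑ i ∈ (insert k T)ᶜ, variances P H k i * N := by
            refine Finset.sum_le_sum fun i _ => ?_
            rw [norm_mul, Complex.norm_real,
              Real.norm_of_nonneg (IsGeneralizedWigner.variances_nonneg P H k i)]
            exact mul_le_mul_of_nonneg_left (hR.norm_greenMinor_le hW.hermitian i i _ ω)
              (IsGeneralizedWigner.variances_nonneg P H k i)
        _ = (∑ i ∈ (insert k T)ᶜ, variances P H k i) * N := by rw [Finset.sum_mul]
        _ ≤ 1 * N := by
            gcongr
            exact hW.sum_variances_le k _
        _ = N := one_mul _
    have h2 := hR.norm_le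
    calc ‖meanInv P H z k T ω‖ ≤ ‖-z‖ + N := (norm_sub_le _ _).trans (by gcongr)
      _ ≤ 15 + N := by
        rw [norm_neg]
        gcongr
      _ ≤ _ := by linarith
  have mM := hW.hasMoments_meanInv hR.im_pos k T
  have mZ := hW.hasMoments_centredInv hR.im_pos hk
  have hM : ∫ ω, ‖meanInv P H z k T ω‖ ^ (2 * (q + 1)) ∂P
      ≤ 16 ^ (2 * (q + 1)) * (N : ℝ) ^ (2 * (q + 1)) := by
    refine integral_le_of_forall_le (mM.integrable_norm_pow _) fun ω => ?_
    rw [← mul_pow]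
    exact pow_le_pow_left₀ (norm_nonneg _) (hMn ω) _
  have hint : ∫ ω, ‖(greenMinor (H ω) z k k T)⁻¹‖ ^ (2 * (q + 1)) ∂P
      ≤ 2 ^ (2 * (q + 1)) * ((C * 3) ^ (q + 1) + 16 ^ (2 * (q + 1))) * (N : ℝ) ^ (2 * (q + 1)) := by
    calc ∫ ω, ‖(greenMinor (H ω) z k k T)⁻¹‖ ^ (2 * (q + 1)) ∂P
        ≤ ∫ ω, 2 ^ (2 * (q + 1)) * (‖centredInv P H z k T ω‖ ^ (2 * (q + 1))
          + ‖meanInv P H z k T ω‖ ^ (2 * (q + 1))) ∂P := by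
          refine integral_mono
            ((hW.hasMoments_inv_greenMinor hR.im_pos hk).integrable_norm_pow _)
            (((mZ.integrable_norm_pow _).add (mM.integrable_norm_pow _)).const_mul _) fun ω => ?_
          have := norm_add_pow_le (centredInv P H z k T ω) (meanInv P H z k T ω) (2 * (q + 1))
          rwa [show centredInv P H z k T ω + meanInv P H z k T ω = (greenMinor (H ω) z k k T)⁻¹ by
            rw [centredInv, sub_add_cancel]] at this
      _ = 2 ^ (2 * (q + 1)) * (∫ ω, ‖centredInv P H z k T ω‖ ^ (2 * (q + 1)) ∂P
          + ∫ ω, ‖meanInv P H z k T ω‖ ^ (2 * (q + 1)) ∂P) := by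
          rw [integral_const_mul,
            integral_add (mZ.integrable_norm_pow _) (mM.integrable_norm_pow _)]
      _ ≤ 2 ^ (2 * (q + 1)) * ((C * 3) ^ (q + 1) * (N : ℝ) ^ (2 * (q + 1))
          + 16 ^ (2 * (q + 1)) * (N : ℝ) ^ (2 * (q + 1))) := by gcongr
      _ = _ := by ring
  have hp := hR.pow_mul_card_pow_le (2 * (q + 1))
  set E := 2 ^ (2 * (q + 1)) * ((C * 3) ^ (q + 1) + 16 ^ (2 * (q + 1)))
  have hE : 0 ≤ E := by positivity
  calc ψ ^ (2 * (q + 1) * b) * ∫ ω, ‖(greenMinor (H ω) z k k T)⁻¹‖ ^ (2 * (q + 1)) ∂P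
      ≤ ψ ^ (2 * (q + 1) * b) * (E * (N : ℝ) ^ (2 * (q + 1))) := by gcongr
    _ = E * (ψ ^ (2 * (q + 1) * b) * (N : ℝ) ^ (2 * (q + 1))) := by ring
    _ ≤ E * 1 := by gcongr
    _ = E := mul_one E

/-- Each index in an alternating difference of the fluctuations of `1 / G_kk` gains a factor `ψ`. -/
theorem exists_integral_norm_altDiff_centredInv_pow_le (q b : ℕ) (mom : ℕ → ℝ) : ∃ C : ℝ, 1 ≤ C ∧
    ∀ {N : ℕ} {Ω : Type*} [MeasurableSpace Ω] {P : Measure Ω} [IsProbabilityMeasure P]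
      {H : Ω → Matrix (Fin N) (Fin N) ℂ} {δ : ℝ} {z : ℂ} {ψ : ℝ} {K : ℕ} {B : Set Ω},
      IsGeneralizedWigner P H δ mom → ControlRegime P H z ψ (2 * (q + 1) + 1) b K B →
      2 * (2 * (q + 1) * (2 * (q + 1) + 1)) + 4 * (q + 1) * b ≤ K →
      ∀ {k : Fin N} {A T : Finset (Fin N)}, Disjoint T A → k ∉ T ∪ A →
      (T ∪ A).card ≤ 2 * (q + 1) →
      ∫ ω, ‖altDiff A (fun U => centredInv P H z k U ω) T‖ ^ (2 * (q + 1)) ∂P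
        ≤ (C * ψ ^ (1 + A.card)) ^ (2 * (q + 1)) := by
  set n := 2 * (q + 1) with hn
  obtain ⟨C₀, hC₀, h₀⟩ := exists_integral_norm_centredInv_pow_le q mom
  obtain ⟨C₁, hC₁, h₁⟩ := exists_integral_norm_inv_greenMinor_pow_le (2 * q + 1) mom
  obtain ⟨C₂, hC₂, h₂⟩ := exists_altDiff_greenMinor_le 64 n
  -- The loss in the off-diagonal bound when up to n + 1 indices are removed.
  set p : ℝ := 2 ^ (n + 1) with hp
  have hp1 : 1 ≤ p := one_le_pow₀ (by norm_num)
  set C₃ : ℝ := (2 ^ n : ℝ) ^ (2 * n) * C₁ with hC₃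
  have hC₃1 : 1 ≤ C₃ := one_le_mul_of_one_le_of_one_le (one_le_pow₀ (one_le_pow₀ (by norm_num))) hC₁
  set Ca : ℝ := C₀ * ((3 * p) ^ 2 + (1 + 128 ^ 2)) with hCa
  set Cb : ℝ := 2 * 2 * (C₂ * p ^ (n + 1) + (1 + C₃)) with hCb
  have hCa0 : 0 ≤ Ca := by positivity
  have hCa1 : 1 ≤ Ca := by
    have h1 : (1 : ℝ) ≤ (3 * p) ^ 2 + (1 + 128 ^ 2) := by nlinarith [sq_nonneg (3 * p)]
    exact one_le_mul_of_one_le_of_one_le hC₀ h1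
  have hCb1 : 1 ≤ Cb := by
    have h1 : 0 ≤ C₂ * p ^ (n + 1) := by positivity
    linarith
  refine ⟨max Ca Cb, le_max_of_le_left hCa1, ?_⟩
  intro N Ω _ P _ H δ z ψ K B hW hR hK k A T hTA hk hcard
  have hψ0 := hR.pos.le
  have hψ1 := hR.le_one
  have hz := hR.im_pos
  have hpψ : p * ψ ≤ 1 := hR.two_pow_mul_le_one
  have hm0 : 0 ≤ (bandParam P H)⁻¹ :=
    (IsGeneralizedWigner.variances_nonneg P H k k).trans
      (IsGeneralizedWigner.variances_le P H k k)
  rcases A.eq_empty_or_nonempty with rfl | hA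
  -- Without differences the single factor ψ comes from the large deviation bound. Schur's formula
  -- removes k in addition to T, which is why the regime allows n + 1 indices.
  · simp only [altDiff_empty, Finset.card_empty, add_zero, pow_one]
    rw [Finset.union_empty] at hk hcard
    have hV : (insert k T).card ≤ n + 1 := (Finset.card_insert_le _ _).trans (by omega)
    have hrough : ∀ i j, ψ ^ (2 * n * b)
        * ∫ ω, ‖greenMinor (H ω) z i j (insert k T)‖ ^ (2 * n) ∂P ≤ 1 := fun i j => by
      refine le_trans ?_ (hR.pow_mul_card_pow_le (2 * n))
      gcongr
      refine integral_le_of_forall_le ((hW.hasMoments_greenMinor hz i j _).integrable_norm_pow _)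
        fun ω => ?_
      exact pow_le_pow_left₀ (norm_nonneg _) (hR.norm_greenMinor_le hW.hermitian i j _ ω) _
    have hKn : 2 * n + 2 * n * b ≤ K := by
      refine le_trans ?_ hK
      have h1 : n ≤ n * (n + 1) := Nat.le_mul_of_pos_right n (Nat.succ_pos n)
      have h2 : 2 * n * b = 4 * (q + 1) * b := by rw [hn]; ring
      omega
    have hoff : ∀ i ∉ insert k T, ∀ j ∉ insert k T, i ≠ j →
        ∫ ω, ‖greenMinor (H ω) z i j (insert k T)‖ ^ n ∂P ≤ ((3 * p * ψ) ^ 2) ^ (q + 1) := by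
      intro i hi j hj hij
      have h := integral_norm_pow_le_of_bound_off (hW.hasMoments_greenMinor hz i j (insert k T))
        hR.measurableSet (a := p * ψ) (n := n) (m := n) hR.pos hψ1 hKn hR.prob_le (by positivity)
        (fun ω hω => (hR.greenControl hW.hermitian hω hV _ subset_rfl i hi).1 j hj hij) (hrough i j)
      refine h.trans ?_
      rw [← pow_mul, ← hn]
      calc (p * ψ) ^ n + (1 + 1) * ψ ^ n ≤ (p * ψ) ^ n + (1 + 1) * (p * ψ) ^ n := by
            gcongr
            exact le_mul_of_one_le_left hψ0 hp1
        _ = 3 * (p * ψ) ^ n := by ring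
        _ ≤ 3 ^ n * (p * ψ) ^ n := by
            gcongr
            exact le_self_pow₀ (by norm_num) (by omega)
        _ = _ := by rw [← mul_pow, mul_assoc]
    have hdiag : ∀ i ∉ insert k T,
        ∫ ω, ‖greenMinor (H ω) z i i (insert k T)‖ ^ n ∂P ≤ ((128 : ℝ) ^ 2) ^ (q + 1) := by
      intro i hi
      have h := integral_norm_pow_le_of_bound_off (hW.hasMoments_greenMinor hz i i (insert k T))
        hR.measurableSet (a := 64) (n := n) (m := n) hR.pos hψ1 hKn hR.prob_le (by positivity)
        (fun ω hω => (hR.greenControl hW.hermitian hω hV _ subset_rfl i hi).2.1) (hrough i i)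
      refine h.trans ?_
      rw [← pow_mul, ← hn]
      have h64 : (64 : ℝ) ≤ 64 ^ n := le_self_pow₀ (by norm_num) (by omega)
      have h2n : (2 : ℝ) ≤ 2 ^ n := le_self_pow₀ (by norm_num) (by omega)
      calc (64 : ℝ) ^ n + (1 + 1) * ψ ^ n ≤ 64 ^ n + (1 + 1) * 1 := by
            gcongr
            exact pow_le_one₀ hψ0 hψ1
        _ ≤ 2 * 64 ^ n := by linarith
        _ ≤ 2 ^ n * 64 ^ n := by gcongr
        _ = _ := by
            rw [← mul_pow]
            norm_num
    refine (h₀ hW hz hk (by positivity) (by positivity) hoff hdiag).trans ?_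
    rw [hn, pow_mul]
    refine pow_le_pow_left₀ (by positivity) ?_ _
    calc C₀ * ((3 * p * ψ) ^ 2 + (1 + 128 ^ 2) * (bandParam P H)⁻¹)
        ≤ C₀ * ((3 * p * ψ) ^ 2 + (1 + 128 ^ 2) * ψ ^ 2) := by
          gcongr
          exact hR.inv_bandParam_le
      _ = Ca * ψ ^ 2 := by rw [hCa]; ring
      _ ≤ Ca ^ 2 * ψ ^ 2 := by
          gcongr
          exact le_self_pow₀ hCa1 two_ne_zero
      _ ≤ _ := by
          rw [← mul_pow]
          gcongr
          exact le_max_left _ _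
  -- With at least one difference, the bound for 1/G_kk already has the right order outside B, and
  -- centring costs a constant.
  · have hAn : A.card ≤ n := (Finset.card_le_card Finset.subset_union_right).trans hcard
    have hkS : ∀ S ∈ A.powerset, k ∉ T ∪ S := fun S hS h =>
      hk (Finset.union_subset_union_right (Finset.mem_powerset.mp hS) h)
    have mS := fun S hS => hW.hasMoments_inv_greenMinor hz (hkS S hS)
    have hX : HasMoments P fun ω => altDiff A (fun U => (greenMinor (H ω) z k k U)⁻¹) T :=
      HasMoments.sum fun S hS => (mS S hS).const_mul _
    have hrough : ψ ^ (2 * n * b)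
        * ∫ ω, ‖altDiff A (fun U => (greenMinor (H ω) z k k U)⁻¹) T‖ ^ (2 * n) ∂P ≤ C₃ := by
      have hpc : (A.powerset.card : ℝ) ≤ 2 ^ n := by
        rw [Finset.card_powerset]
        push_cast
        gcongr
        norm_num
      have e2n : 2 * (2 * q + 1 + 1) = 2 * n := by omega
      obtain ⟨r, hr⟩ : ∃ r, 2 * n = r + 1 := ⟨2 * n - 1, by omega⟩
      calc ψ ^ (2 * n * b)
          * ∫ ω, ‖altDiff A (fun U => (greenMinor (H ω) z k k U)⁻¹) T‖ ^ (2 * n) ∂P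
          ≤ ψ ^ (2 * n * b) * ∫ ω, (A.powerset.card : ℝ) ^ r
            * ∑ S ∈ A.powerset, ‖(greenMinor (H ω) z k k (T ∪ S))⁻¹‖ ^ (2 * n) ∂P := by
            refine mul_le_mul_of_nonneg_left (integral_mono (hX.integrable_norm_pow _)
              ((integrable_finsetSum _ fun S hS => (mS S hS).integrable_norm_pow _).const_mul _)
              fun ω => ?_) (by positivity)
            have h := norm_sum_pow_le A.powerset
              (fun S => (-1) ^ S.card * (greenMinor (H ω) z k k (T ∪ S))⁻¹) r
            rw [← hr] at h
            simpa [altDiff] using h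
        _ = (A.powerset.card : ℝ) ^ r * ∑ S ∈ A.powerset, ψ ^ (2 * n * b)
            * ∫ ω, ‖(greenMinor (H ω) z k k (T ∪ S))⁻¹‖ ^ (2 * n) ∂P := by
            rw [integral_const_mul, integral_finsetSum _ fun S hS =>
              (mS S hS).integrable_norm_pow _, Finset.mul_sum, Finset.mul_sum, Finset.mul_sum]
            exact Finset.sum_congr rfl fun S _ => by ring
        _ ≤ (A.powerset.card : ℝ) ^ r * ∑ S ∈ A.powerset, C₁ := by
            refine mul_le_mul_of_nonneg_left (Finset.sum_le_sum fun S hS => ?_) (by positivity)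
            have h := h₁ hW hR (hkS S hS)
            rwa [e2n] at h
        _ = (A.powerset.card : ℝ) ^ (2 * n) * C₁ := by
            rw [Finset.sum_const, nsmul_eq_mul, ← mul_assoc, ← pow_succ, ← hr]
        _ ≤ C₃ := by
            rw [hC₃]
            exact mul_le_mul_of_nonneg_right (pow_le_pow_left₀ (Nat.cast_nonneg _) hpc _)
              (by linarith)
    have hpt : ∀ ω ∉ B, ‖altDiff A (fun U => (greenMinor (H ω) z k k U)⁻¹) T‖
        ≤ C₂ * p ^ (n + 1) * ψ ^ (1 + A.card) := by
      intro ω hω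
      have hg := hR.greenControl hW.hermitian hω (V := T ∪ A) (by omega)
      have h := (h₂ (hW.hermitian ω) hz (by positivity) hpψ hg T A subset_rfl hTA hAn k hk).2.2.2 hA
      refine h.trans ?_
      rw [mul_pow, ← mul_assoc]
      have hpp : p ^ (1 + A.card) ≤ p ^ (n + 1) := pow_le_pow_right₀ hp1 (by omega)
      gcongr
    have hmK : 2 * (n * (1 + A.card)) + 2 * n * b ≤ K := by
      refine le_trans ?_ hK
      have h1 : n * (1 + A.card) ≤ n * (n + 1) := Nat.mul_le_mul_left n (by omega)
      have h2 : 2 * n * b = 4 * (q + 1) * b := by rw [hn]; ring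
      omega
    have h := integral_norm_pow_le_of_bound_off hX hR.measurableSet (n := n)
      (m := n * (1 + A.card)) hR.pos hψ1 hmK hR.prob_le (by positivity) hpt hrough
    refine (hW.integral_norm_altDiff_centredInv_pow_le hz hk n).trans ?_
    set x := ψ ^ (1 + A.card) with hx
    have hx0 : 0 ≤ x := by positivity
    have e1 : ψ ^ (n * (1 + A.card)) = x ^ n := by rw [hx, ← pow_mul, mul_comm]
    rw [e1] at h
    have hC4 : (1 + C₃) ≤ (1 + C₃) ^ n := le_self_pow₀ (by linarith) (by omega)
    have h2n : (2 : ℝ) ≤ 2 ^ n := le_self_pow₀ (by norm_num) (by omega)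
    have hadd : ∀ a c : ℝ, 0 ≤ a → 0 ≤ c → a ^ n + c ^ n ≤ (a + c) ^ n := fun a c ha hc =>
      pow_add_pow_le ha hc (by omega)
    calc 2 ^ n * 2 * ∫ ω, ‖altDiff A (fun U => (greenMinor (H ω) z k k U)⁻¹) T‖ ^ n ∂P
        ≤ 2 ^ n * 2 ^ n * ((C₂ * p ^ (n + 1) * x) ^ n + (1 + C₃) ^ n * x ^ n) := by
          refine mul_le_mul (by gcongr) (h.trans (by gcongr)) (integral_nonneg fun _ => by positivity)
            (by positivity)
      _ = (2 * 2 * x) ^ n * ((C₂ * p ^ (n + 1)) ^ n + (1 + C₃) ^ n) := by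
          rw [mul_pow _ x, mul_pow (2 * 2) x, mul_pow 2 2]
          ring
      _ ≤ (2 * 2 * x) ^ n * (C₂ * p ^ (n + 1) + (1 + C₃)) ^ n := by
          gcongr
          exact hadd _ _ (by positivity) (by linarith)
      _ = (Cb * x) ^ n := by
          rw [← mul_pow, hCb]
          ring
      _ ≤ _ := by
          gcongr
          exact le_max_right _ _

end Regime

/-! ### Expectations of products of fluctuations -/

section Products

/-- Conjugation, if `c` is true. -/
def conjIf (c : Bool) (x : ℂ) : ℂ := if c then star x else x

theorem norm_conjIf (c : Bool) (x : ℂ) : ‖conjIf c x‖ = ‖x‖ := by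
  unfold conjIf
  split_ifs <;> simp

theorem conjIf_sum {ι : Type*} (c : Bool) (s : Finset ι) (f : ι → ℂ) :
    conjIf c (∑ i ∈ s, f i) = ∑ i ∈ s, conjIf c (f i) := by
  unfold conjIf
  split_ifs <;> simp

theorem conjIf_mul (c : Bool) (x y : ℂ) : conjIf c (x * y) = conjIf c x * conjIf c y := by
  unfold conjIf
  split_ifs <;> simp

theorem measurable_conjIf (c : Bool) : Measurable (conjIf c) := by
  unfold conjIf
  split_ifs
  · exact Complex.continuous_conj.measurable
  · exact measurable_id

/-- Alternating x̄ and x expresses an even power of |x| as a product, so the power of a sum can be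
multiplied out. -/
theorem exists_prod_conjIf_eq (m : ℕ) : ∃ σ : Fin (2 * m) → Bool, ∀ x : ℂ,
    ∏ r, conjIf (σ r) x = ((‖x‖ ^ (2 * m) : ℝ) : ℂ) := by
  induction m with
  | zero => exact ⟨fun _ => true, fun x => by simp⟩
  | succ m ih =>
    obtain ⟨σ, hσ⟩ := ih
    refine ⟨Fin.cons true (Fin.cons false σ : Fin (2 * m + 1) → Bool), fun x => ?_⟩
    have h : ∏ r : Fin (2 * m + 1 + 1),
        conjIf ((Fin.cons true (Fin.cons false σ : Fin (2 * m + 1) → Bool) :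
          Fin (2 * m + 1 + 1) → Bool) r) x = ((‖x‖ ^ (2 * (m + 1)) : ℝ) : ℂ) := by
      rw [Fin.prod_univ_succ, Fin.prod_univ_succ]
      simp only [Fin.cons_zero, Fin.cons_succ]
      rw [hσ, ← mul_assoc]
      have h2 : conjIf true x * conjIf false x = ((‖x‖ ^ 2 : ℝ) : ℂ) := by
        have := Complex.conj_mul' x
        simpa [conjIf] using this
      rw [h2, ← Complex.ofReal_mul, ← pow_add]
      congr 2
      ring
    exact h

theorem prod_le_sum_pow {n : ℕ} (hn : 0 < n) {x : Fin n → ℝ} (hx : ∀ r, 0 ≤ x r) :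
    ∏ r, x r ≤ ∑ r, x r ^ n := by
  have : Nonempty (Fin n) := ⟨⟨0, hn⟩⟩
  obtain ⟨m, hm⟩ := Finite.exists_max x
  calc ∏ r, x r ≤ ∏ _r : Fin n, x m := Finset.prod_le_prod (fun r _ => hx r) fun r _ => hm r
    _ = x m ^ n := by simp
    _ ≤ _ := Finset.single_le_sum (f := fun r => x r ^ n) (fun r _ => pow_nonneg (hx r) n)
      (Finset.mem_univ m)

/-- The values that are taken exactly once. -/
def loneValues {N n : ℕ} (κ : Fin n → Fin N) : Finset (Fin N) :=
  Finset.univ.filter fun l => (Finset.univ.filter fun r => κ r = l).card = 1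

theorem exists_of_mem_loneValues {N n : ℕ} {κ : Fin n → Fin N} {l : Fin N}
    (h : l ∈ loneValues κ) : ∃ r, κ r = l ∧ ∀ r', κ r' = l → r' = r := by
  obtain ⟨r, hr⟩ := Finset.card_eq_one.mp (Finset.mem_filter.mp h).2
  have hmem : ∀ r', κ r' = l ↔ r' = r := fun r' => by
    have := Finset.ext_iff.mp hr r'
    simpa using this
  exact ⟨r, (hmem r).mpr rfl, fun r' h' => (hmem r').mp h'⟩

theorem card_loneValues_le {N n : ℕ} (κ : Fin n → Fin N) : (loneValues κ).card ≤ n := by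
  have hsub : loneValues κ ⊆ Finset.univ.image κ := fun l hl => by
    obtain ⟨r, hr, _⟩ := exists_of_mem_loneValues hl
    exact Finset.mem_image.mpr ⟨r, Finset.mem_univ r, hr⟩
  refine (Finset.card_le_card hsub).trans (Finset.card_image_le.trans ?_)
  simp

variable {N : ℕ} {Ω : Type*} [mΩ : MeasurableSpace Ω] {P : Measure Ω}
  {H : Ω → Matrix (Fin N) (Fin N) ℂ} {δ : ℝ} {mom : ℕ → ℝ} {z : ℂ}

theorem HasMoments.conjIf {X : Ω → ℂ} (hX : HasMoments P X) (c : Bool) :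
    HasMoments P fun ω => conjIf c (X ω) :=
  hX.mono ((measurable_conjIf c).comp_aemeasurable
    hX.aestronglyMeasurable.aemeasurable).aestronglyMeasurable fun _ => (norm_conjIf c _).le

/-- Hölder's inequality for `n` factors, up to a factor `n`. -/
theorem norm_integral_prod_le [IsProbabilityMeasure P] {n : ℕ} (hn : 0 < n) {X : Fin n → Ω → ℂ}
    {b : Fin n → ℝ} (hX : ∀ r, HasMoments P (X r)) (hb : ∀ r, 0 < b r)
    (h : ∀ r, ∫ ω, ‖X r ω‖ ^ n ∂P ≤ b r ^ n) : ‖∫ ω, ∏ r, X r ω ∂P‖ ≤ n * ∏ r, b r := by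
  have hB : 0 ≤ ∏ r, b r := Finset.prod_nonneg fun r _ => (hb r).le
  have hpt : ∀ ω, ‖∏ r, X r ω‖ ≤ (∏ r, b r) * ∑ r, (b r ^ n)⁻¹ * ‖X r ω‖ ^ n := by
    intro ω
    have h1 := prod_le_sum_pow hn (x := fun r => ‖X r ω‖ / b r)
      fun r => div_nonneg (norm_nonneg _) (hb r).le
    rw [norm_prod]
    calc ∏ r, ‖X r ω‖ = (∏ r, b r) * ∏ r, ‖X r ω‖ / b r := by
          rw [← Finset.prod_mul_distrib]
          exact Finset.prod_congr rfl fun r _ => (mul_div_cancel₀ _ (hb r).ne').symm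
      _ ≤ (∏ r, b r) * ∑ r, (‖X r ω‖ / b r) ^ n := by gcongr
      _ = _ := by
          congr 1
          refine Finset.sum_congr rfl fun r _ => ?_
          rw [div_pow, div_eq_inv_mul]
  have hi : ∀ r ∈ Finset.univ, Integrable (fun ω => (b r ^ n)⁻¹ * ‖X r ω‖ ^ n) P := fun r _ =>
    ((hX r).integrable_norm_pow n).const_mul _
  calc ‖∫ ω, ∏ r, X r ω ∂P‖ ≤ ∫ ω, ‖∏ r, X r ω‖ ∂P := norm_integral_le_integral_norm _
    _ ≤ ∫ ω, (∏ r, b r) * ∑ r, (b r ^ n)⁻¹ * ‖X r ω‖ ^ n ∂P :=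
        integral_mono (HasMoments.prod fun r _ => hX r).integrable.norm
          ((integrable_finsetSum _ hi).const_mul _) hpt
    _ = (∏ r, b r) * ∑ r, (b r ^ n)⁻¹ * ∫ ω, ‖X r ω‖ ^ n ∂P := by
        rw [integral_const_mul, integral_finsetSum _ hi]
        simp only [integral_const_mul]
    _ ≤ (∏ r, b r) * ∑ _r : Fin n, (1 : ℝ) := by
        gcongr with r _
        rw [inv_mul_le_iff₀ (pow_pos (hb r) n), mul_one]
        exact h r
    _ = _ := by
        simp [mul_comm]

/-- Conjugating the whole integral moves the conjugation from X to W. -/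
theorem OrthTo.integral_mul_conjIf {W X : Ω → ℂ} (c : Bool)
    (h : OrthTo P (fun ω => LocalSemicircle.conjIf c (W ω)) X) :
    ∫ ω, W ω * LocalSemicircle.conjIf c (X ω) ∂P = 0 := by
  have h2 := h.2
  cases c
  · simpa [LocalSemicircle.conjIf] using h2
  · simp only [LocalSemicircle.conjIf, if_true] at h2 ⊢
    have e : ∀ ω, W ω * star (X ω) = (starRingEnd ℂ) (star (W ω) * X ω) := fun ω => by simp
    simp only [e]
    rw [integral_conj, h2, map_zero]

/-- The expectation vanishes if some lone value is not differenced by any other factor. -/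
theorem IsGeneralizedWigner.integral_prod_altDiff_eq_zero [IsProbabilityMeasure P]
    (hW : IsGeneralizedWigner P H δ mom) (hz : 0 < z.im) {n : ℕ} {κ : Fin n → Fin N}
    (σ : Fin n → Bool) {A T : Fin n → Finset (Fin N)} (hk : ∀ r, κ r ∉ T r ∪ A r) {r₀ : Fin n}
    (h : ∀ r ≠ r₀, κ r₀ ∈ T r) :
    ∫ ω, ∏ r, conjIf (σ r) (altDiff (A r) (fun U => centredInv P H z (κ r) U ω) (T r)) ∂P = 0 := by
  have hkS : ∀ r, ∀ S ∈ (A r).powerset, κ r ∉ T r ∪ S := fun r S hS h =>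
    hk r (Finset.union_subset_union_right (Finset.mem_powerset.mp hS) h)
  have hD : ∀ r, HasMoments P fun ω => altDiff (A r) (fun U => centredInv P H z (κ r) U ω) (T r) :=
    fun r => HasMoments.sum fun S hS => (hW.hasMoments_centredInv hz (hkS r S hS)).const_mul _
  have hDm : ∀ r ≠ r₀, Measurable[entrySigma H (awayFrom {κ r₀})]
      fun ω => altDiff (A r) (fun U => centredInv P H z (κ r) U ω) (T r) := fun r hr =>
    Finset.measurable_sum _ fun S _ => ((hW.measurable_centredInv z (κ r) (T r ∪ S)).mono
      (entrySigma_mono (awayFrom_anti (Finset.singleton_subset_iff.mpr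
        (Finset.mem_union_left _ (h r hr))))) le_rfl).const_mul _
  have hWm : HasMoments P fun ω => ∏ r ∈ Finset.univ.erase r₀,
      conjIf (σ r) (altDiff (A r) (fun U => centredInv P H z (κ r) U ω) (T r)) :=
    HasMoments.prod fun r _ => (hD r).conjIf (σ r)
  have hWs : Measurable[entrySigma H (awayFrom {κ r₀})] fun ω => ∏ r ∈ Finset.univ.erase r₀,
      conjIf (σ r) (altDiff (A r) (fun U => centredInv P H z (κ r) U ω) (T r)) :=
    Finset.measurable_prod _ fun r hr => (measurable_conjIf (σ r)).comp
      (hDm r (Finset.ne_of_mem_erase hr))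
  -- All other factors have row κ r₀ removed, so their product depends on H^(κ r₀) only and is
  -- orthogonal to the fluctuation of the factor r₀.
  have horth : OrthTo P (fun ω => conjIf (σ r₀) (∏ r ∈ Finset.univ.erase r₀,
      conjIf (σ r) (altDiff (A r) (fun U => centredInv P H z (κ r) U ω) (T r))))
      (fun ω => altDiff (A r₀) (fun U => centredInv P H z (κ r₀) U ω) (T r₀)) :=
    OrthTo.sum (hWm.conjIf _) fun S hS => (hW.orthTo_centredInv hz (hkS r₀ S hS) (hWm.conjIf _)
      ((measurable_conjIf _).comp hWs)).const_mul _
  have := horth.integral_mul_conjIf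
  simpa only [Finset.prod_erase_mul _ _ (Finset.mem_univ r₀)] using this

/-- In the expectation of a product of fluctuations, each lone value gains a factor `ψ`. -/
theorem exists_norm_integral_prod_centredInv_le (q b : ℕ) (mom : ℕ → ℝ) : ∃ C : ℝ, 1 ≤ C ∧
    ∀ {N : ℕ} {Ω : Type*} [MeasurableSpace Ω] {P : Measure Ω} [IsProbabilityMeasure P]
      {H : Ω → Matrix (Fin N) (Fin N) ℂ} {δ : ℝ} {z : ℂ} {ψ : ℝ} {K : ℕ} {B : Set Ω},
      IsGeneralizedWigner P H δ mom → ControlRegime P H z ψ (2 * (q + 1) + 1) b K B →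
      2 * (2 * (q + 1) * (2 * (q + 1) + 1)) + 4 * (q + 1) * b ≤ K →
      ∀ (σ : Fin (2 * (q + 1)) → Bool) (κ : Fin (2 * (q + 1)) → Fin N),
      ‖∫ ω, ∏ r, conjIf (σ r) (centredInv P H z (κ r) ∅ ω) ∂P‖
        ≤ C * ψ ^ (2 * (q + 1) + (loneValues κ).card) := by
  obtain ⟨C, hC1, hC⟩ := exists_integral_norm_altDiff_centredInv_pow_le q b mom
  have hn : 0 < 2 * (q + 1) := by omega
  set n := 2 * (q + 1) with hndef
  -- (2^n)^n counts the choices of a subset for each factor; n C^n comes from Hölder's inequality.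
  refine ⟨((2 : ℝ) ^ n) ^ n * (n * C ^ n), ?_, ?_⟩
  · have h1 : (1 : ℝ) ≤ ((2 : ℝ) ^ n) ^ n := one_le_pow₀ (one_le_pow₀ (by norm_num))
    have h2 : (1 : ℝ) ≤ n := by exact_mod_cast hn
    have h3 : (1 : ℝ) ≤ C ^ n := one_le_pow₀ hC1
    exact one_le_mul_of_one_le_of_one_le h1 (one_le_mul_of_one_le_of_one_le h2 h3)
  intro N Ω _ P _ H δ z ψ K B hW hR hK σ κ
  set L := loneValues κ with hL
  have hLn : L.card ≤ n := card_loneValues_le κ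
  have hψ := hR.pos
  -- The index of a factor is never among the indices removed or differenced in it.
  set t : Fin n → Finset (Finset (Fin N)) := fun r => (L.erase (κ r)).powerset with ht
  set D : Fin n → Finset (Fin N) → Ω → ℂ := fun r A ω =>
    altDiff A (fun U => centredInv P H z (κ r) U ω) (L.erase (κ r) \ A) with hD
  have hun : ∀ r, ∀ A ∈ t r, L.erase (κ r) \ A ∪ A = L.erase (κ r) := fun r A hA =>
    Finset.sdiff_union_of_subset (Finset.mem_powerset.mp hA)
  have hκ : ∀ r, ∀ A ∈ t r, κ r ∉ L.erase (κ r) \ A ∪ A := fun r A hA => by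
    rw [hun r A hA]
    exact Finset.notMem_erase _ _
  have hDm : ∀ r, ∀ A ∈ t r, HasMoments P (D r A) := fun r A hA =>
    HasMoments.sum fun S hS => (hW.hasMoments_centredInv hR.im_pos (fun h => hκ r A hA
      (Finset.union_subset_union_right (Finset.mem_powerset.mp hS) h))).const_mul _
  have hDb : ∀ r, ∀ A ∈ t r, ∫ ω, ‖D r A ω‖ ^ n ∂P ≤ (C * ψ ^ (1 + A.card)) ^ n := fun r A hA =>
    hC hW hR hK Finset.sdiff_disjoint (hκ r A hA) (by
      rw [hun r A hA]
      exact (Finset.card_le_card (Finset.erase_subset _ _)).trans hLn)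
  have hexp : ∀ ω, ∏ r, conjIf (σ r) (centredInv P H z (κ r) ∅ ω)
      = ∑ x ∈ Fintype.piFinset t, ∏ r, conjIf (σ r) (D r (x r) ω) := by
    intro ω
    rw [← Finset.prod_univ_sum t fun r A => conjIf (σ r) (D r A ω)]
    refine Finset.prod_congr rfl fun r _ => ?_
    rw [← conjIf_sum]
    congr 1
    have := sum_powerset_altDiff (L.erase (κ r)) (fun U => centredInv P H z (κ r) U ω) ∅
    simp only [Finset.empty_union] at this
    exact this.symm
  have hterm : ∀ x ∈ Fintype.piFinset t,
      ‖∫ ω, ∏ r, conjIf (σ r) (D r (x r) ω) ∂P‖ ≤ n * C ^ n * ψ ^ (n + L.card) := by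
    intro x hx
    have hxr := Fintype.mem_piFinset.mp hx
    -- Either every lone value is differenced somewhere, so the cardinalities |x r| add up to at
    -- least |L|, or some lone value is removed outright from all factors but its own and the
    -- expectation vanishes.
    by_cases hcov : ∀ l ∈ L, ∃ r, l ∈ x r
    · have h := norm_integral_prod_le hn (X := fun r ω => conjIf (σ r) (D r (x r) ω))
        (b := fun r => C * ψ ^ (1 + (x r).card)) (P := P)
        (fun r => (hDm r _ (hxr r)).conjIf _) (fun r => by positivity) (fun r => by
          simp only [norm_conjIf]
          exact hDb r _ (hxr r))
      refine h.trans ?_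
      rw [Finset.prod_mul_distrib, Finset.prod_pow_eq_pow_sum, Finset.sum_add_distrib,
        Finset.prod_const, Finset.card_univ, Fintype.card_fin, ← mul_assoc]
      have hcard : L.card ≤ ∑ r, (x r).card := by
        have hsub : L ⊆ Finset.univ.biUnion x := fun l hl => by
          obtain ⟨r, hr⟩ := hcov l hl
          exact Finset.mem_biUnion.mpr ⟨r, Finset.mem_univ r, hr⟩
        exact (Finset.card_le_card hsub).trans Finset.card_biUnion_le
      refine mul_le_mul_of_nonneg_left (pow_le_pow_of_le_one hψ.le hR.le_one ?_) (by positivity)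
      simp only [Finset.sum_const, Finset.card_univ, Fintype.card_fin, smul_eq_mul, mul_one]
      omega
    · push Not at hcov
      obtain ⟨l, hl, hlx⟩ := hcov
      obtain ⟨r₀, hr₀, huniq⟩ := exists_of_mem_loneValues hl
      have h0 := hW.integral_prod_altDiff_eq_zero hR.im_pos σ (A := x)
        (T := fun r => L.erase (κ r) \ x r) (κ := κ) (fun r => hκ r _ (hxr r)) (r₀ := r₀)
        (fun r hr => by
          rw [hr₀]
          refine Finset.mem_sdiff.mpr ⟨Finset.mem_erase.mpr ⟨fun h => hr (huniq r h.symm), hl⟩,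
            hlx r⟩)
      have h0' : ∫ ω, ∏ r, conjIf (σ r) (D r (x r) ω) ∂P = 0 := h0
      rw [h0', norm_zero]
      positivity
  have hcount : ((Fintype.piFinset t).card : ℝ) ≤ ((2 : ℝ) ^ n) ^ n := by
    rw [Fintype.card_piFinset]
    push_cast
    calc ∏ r, ((t r).card : ℝ) ≤ ∏ _r : Fin n, (2 : ℝ) ^ n := by
          refine Finset.prod_le_prod (fun r _ => Nat.cast_nonneg _) fun r _ => ?_
          rw [ht, Finset.card_powerset]
          push_cast
          refine pow_le_pow_right₀ (by norm_num)
            ((Finset.card_le_card (Finset.erase_subset _ _)).trans hLn)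
      _ = _ := by simp
  simp only [hexp]
  rw [integral_finsetSum _ fun x hx => (HasMoments.prod fun r _ =>
    (hDm r _ (Fintype.mem_piFinset.mp hx r)).conjIf (σ r)).integrable]
  calc ‖∑ x ∈ Fintype.piFinset t, ∫ ω, ∏ r, conjIf (σ r) (D r (x r) ω) ∂P‖
      ≤ ∑ x ∈ Fintype.piFinset t, n * C ^ n * ψ ^ (n + L.card) :=
        (norm_sum_le _ _).trans (Finset.sum_le_sum hterm)
    _ = (Fintype.piFinset t).card * (n * C ^ n * ψ ^ (n + L.card)) := by
        rw [Finset.sum_const, nsmul_eq_mul]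
    _ ≤ ((2 : ℝ) ^ n) ^ n * (n * C ^ n * ψ ^ (n + L.card)) := by gcongr
    _ = _ := by ring

/-! ### Summation over the indices -/

/-- Induction on n, adding one value k. A new k becomes lone and gains ψ, with total weight at most
1. An old k may destroy a lone value, but its weight is at most ψ² and there are at most n such k.
Each step therefore costs (1 + n)ψ. -/
theorem sum_prod_mul_pow_loneValues_le {t : Fin N → ℝ} {ψ : ℝ} (ht0 : ∀ k, 0 ≤ t k)
    (ht1 : ∀ k, t k ≤ ψ ^ 2) (htsum : ∑ k, t k ≤ 1) (hψ : 0 ≤ ψ) (hψ1 : ψ ≤ 1) (n : ℕ) :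
    ∑ κ : Fin n → Fin N, (∏ r, t (κ r)) * ψ ^ (loneValues κ).card ≤ n.factorial * ψ ^ n := by
  induction n with
  | zero =>
    rw [Fintype.sum_unique]
    simp [loneValues]
  | succ n ih =>
    have hstep : ∀ (κ : Fin n → Fin N) (k : Fin N),
        t k * ψ ^ (loneValues (Fin.cons k κ : Fin (n + 1) → Fin N)).card
          ≤ (t k + if k ∈ Finset.univ.image κ then 1 else 0) * ψ ^ ((loneValues κ).card + 1) := by
      intro κ k
      have hcount : ∀ l, (Finset.univ.filter fun r =>
          (Fin.cons k κ : Fin (n + 1) → Fin N) r = l).card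
          = (if k = l then 1 else 0) + (Finset.univ.filter fun r => κ r = l).card := by
        intro l
        rw [Finset.card_filter, Finset.card_filter, Fin.sum_univ_succ]
        simp
      by_cases hk : k ∈ Finset.univ.image κ
      · rw [if_pos hk]
        have hcard : (loneValues κ).card
            ≤ (loneValues (Fin.cons k κ : Fin (n + 1) → Fin N)).card + 1 := by
          have hsub : (loneValues κ).erase k ⊆ loneValues (Fin.cons k κ : Fin (n + 1) → Fin N) := by
            intro l hl
            obtain ⟨hlk, hl⟩ := Finset.mem_erase.mp hl
            rw [loneValues, Finset.mem_filter, hcount, if_neg hlk.symm, zero_add]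
            exact Finset.mem_filter.mp hl
          have h1 := Finset.card_le_card hsub
          have h2 := Finset.pred_card_le_card_erase (s := loneValues κ) (a := k)
          omega
        calc t k * ψ ^ (loneValues (Fin.cons k κ : Fin (n + 1) → Fin N)).card
            ≤ ψ ^ 2 * ψ ^ (loneValues (Fin.cons k κ : Fin (n + 1) → Fin N)).card := by
              gcongr
              exact ht1 k
          _ = ψ ^ ((loneValues (Fin.cons k κ : Fin (n + 1) → Fin N)).card + 2) := by ring
          -- At most one lone value is lost, so the ψ² of the weight still leaves one net factor ψ.
          _ ≤ ψ ^ ((loneValues κ).card + 1) := pow_le_pow_of_le_one hψ hψ1 (by omega)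
          _ ≤ (t k + 1) * ψ ^ ((loneValues κ).card + 1) :=
              le_mul_of_one_le_left (by positivity) (by linarith [ht0 k])
      · rw [if_neg hk, add_zero]
        have hk0 : (Finset.univ.filter fun r => κ r = k).card = 0 := by
          rw [Finset.card_eq_zero, Finset.filter_eq_empty_iff]
          intro r _ hr
          exact hk (Finset.mem_image.mpr ⟨r, Finset.mem_univ r, hr⟩)
        have hkl : k ∉ loneValues κ := by
          rw [loneValues, Finset.mem_filter, hk0]
          simp
        have heq : loneValues (Fin.cons k κ : Fin (n + 1) → Fin N) = insert k (loneValues κ) := by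
          ext l
          rw [loneValues, Finset.mem_filter, hcount, Finset.mem_insert, loneValues,
            Finset.mem_filter]
          by_cases hlk : k = l
          · subst hlk
            simp [hk0]
          · simp [hlk, Ne.symm hlk]
        rw [heq, Finset.card_insert_of_notMem hkl]
    have himg : ∀ κ : Fin n → Fin N,
        ∑ k : Fin N, (if k ∈ Finset.univ.image κ then (1 : ℝ) else 0) ≤ n := by
      intro κ
      rw [Finset.sum_ite_mem, Finset.univ_inter, Finset.sum_const, nsmul_eq_mul, mul_one]
      have h : (Finset.univ.image κ).card ≤ n := by
        refine Finset.card_image_le.trans ?_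
        simp
      exact_mod_cast h
    have hsum : ∑ κ : Fin (n + 1) → Fin N, (∏ r, t (κ r)) * ψ ^ (loneValues κ).card
        = ∑ κ : Fin n → Fin N, ∑ k : Fin N, (∏ r, t (κ r))
          * (t k * ψ ^ (loneValues (Fin.cons k κ : Fin (n + 1) → Fin N)).card) := by
      rw [← (Fin.consEquiv fun _ => Fin N).sum_comp, Fintype.sum_prod_type, Finset.sum_comm]
      refine Finset.sum_congr rfl fun κ _ => Finset.sum_congr rfl fun k _ => ?_
      have e : (Fin.consEquiv fun _ => Fin N) (k, κ) = (Fin.cons k κ : Fin (n + 1) → Fin N) := rfl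
      rw [e, Fin.prod_univ_succ]
      simp only [Fin.cons_zero, Fin.cons_succ]
      ring
    rw [hsum]
    calc ∑ κ : Fin n → Fin N, ∑ k : Fin N, (∏ r, t (κ r))
          * (t k * ψ ^ (loneValues (Fin.cons k κ : Fin (n + 1) → Fin N)).card)
        ≤ ∑ κ : Fin n → Fin N, (∏ r, t (κ r)) * ((1 + n) * ψ ^ ((loneValues κ).card + 1)) := by
          refine Finset.sum_le_sum fun κ _ => ?_
          rw [← Finset.mul_sum]
          refine mul_le_mul_of_nonneg_left ?_ (Finset.prod_nonneg fun r _ => ht0 _)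
          refine (Finset.sum_le_sum fun k _ => hstep κ k).trans ?_
          rw [← Finset.sum_mul, Finset.sum_add_distrib]
          gcongr
          exact himg κ
      _ = (1 + n) * ψ * ∑ κ : Fin n → Fin N, (∏ r, t (κ r)) * ψ ^ (loneValues κ).card := by
          rw [Finset.mul_sum]
          refine Finset.sum_congr rfl fun κ _ => ?_
          ring
      _ ≤ (1 + n) * ψ * (n.factorial * ψ ^ n) := by gcongr
      _ = _ := by
          rw [Nat.factorial_succ]
          push_cast
          ring

/-- The moments of a weighted average of the fluctuations of `1 / G_kk`. -/
theorem exists_integral_norm_sum_centredInv_pow_le (q b : ℕ) (mom : ℕ → ℝ) : ∃ C : ℝ, 1 ≤ C ∧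
    ∀ {N : ℕ} {Ω : Type*} [MeasurableSpace Ω] {P : Measure Ω} [IsProbabilityMeasure P]
      {H : Ω → Matrix (Fin N) (Fin N) ℂ} {δ : ℝ} {z : ℂ} {ψ : ℝ} {K : ℕ} {B : Set Ω},
      IsGeneralizedWigner P H δ mom → ControlRegime P H z ψ (2 * (q + 1) + 1) b K B →
      2 * (2 * (q + 1) * (2 * (q + 1) + 1)) + 4 * (q + 1) * b ≤ K →
      ∀ {t : Fin N → ℂ}, (∀ k, ‖t k‖ ≤ (bandParam P H)⁻¹) → ∑ k, ‖t k‖ ≤ 1 →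
      ∫ ω, ‖∑ k, t k * centredInv P H z k ∅ ω‖ ^ (2 * (q + 1)) ∂P
        ≤ C * ψ ^ (4 * (q + 1)) := by
  obtain ⟨C, hC1, hC⟩ := exists_norm_integral_prod_centredInv_le q b mom
  have hf : (1 : ℝ) ≤ (2 * (q + 1)).factorial := by exact_mod_cast Nat.factorial_pos _
  refine ⟨C * (2 * (q + 1)).factorial, one_le_mul_of_one_le_of_one_le hC1 hf, ?_⟩
  intro N Ω _ P _ H δ z ψ K B hW hR hK t ht htsum
  set n := 2 * (q + 1) with hn
  obtain ⟨σ, hσ⟩ : ∃ σ : Fin n → Bool, ∀ x : ℂ,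
    ∏ r, conjIf (σ r) x = ((‖x‖ ^ n : ℝ) : ℂ) := exists_prod_conjIf_eq (q + 1)
  have hZ : ∀ k, HasMoments P (centredInv P H z k ∅) := fun k =>
    hW.hasMoments_centredInv hR.im_pos (Finset.notMem_empty k)
  have hexp : ∀ ω, ((‖∑ k, t k * centredInv P H z k ∅ ω‖ ^ n : ℝ) : ℂ)
      = ∑ κ : Fin n → Fin N, (∏ r, conjIf (σ r) (t (κ r)))
        * ∏ r, conjIf (σ r) (centredInv P H z (κ r) ∅ ω) := by
    intro ω
    rw [← hσ]
    simp only [conjIf_sum, conjIf_mul]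
    rw [Finset.prod_univ_sum, Fintype.piFinset_univ]
    exact Finset.sum_congr rfl fun κ _ => Finset.prod_mul_distrib
  have hint : ((∫ ω, ‖∑ k, t k * centredInv P H z k ∅ ω‖ ^ n ∂P : ℝ) : ℂ)
      = ∑ κ : Fin n → Fin N, (∏ r, conjIf (σ r) (t (κ r)))
        * ∫ ω, ∏ r, conjIf (σ r) (centredInv P H z (κ r) ∅ ω) ∂P := by
    have h1 : ∫ ω, ((‖∑ k, t k * centredInv P H z k ∅ ω‖ ^ n : ℝ) : ℂ) ∂P
        = ((∫ ω, ‖∑ k, t k * centredInv P H z k ∅ ω‖ ^ n ∂P : ℝ) : ℂ) := integral_ofReal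
    rw [← h1]
    simp only [hexp]
    rw [integral_finsetSum _ fun κ _ => ((HasMoments.prod fun r _ =>
      (hZ (κ r)).conjIf (σ r)).const_mul _).integrable]
    simp only [integral_const_mul]
  have hnn : 0 ≤ ∫ ω, ‖∑ k, t k * centredInv P H z k ∅ ω‖ ^ n ∂P :=
    integral_nonneg fun _ => by positivity
  have hψ := hR.pos.le
  calc ∫ ω, ‖∑ k, t k * centredInv P H z k ∅ ω‖ ^ n ∂P
      = ‖((∫ ω, ‖∑ k, t k * centredInv P H z k ∅ ω‖ ^ n ∂P : ℝ) : ℂ)‖ := by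
        rw [Complex.norm_real, Real.norm_of_nonneg hnn]
    _ ≤ ∑ κ : Fin n → Fin N, (∏ r, ‖t (κ r)‖) * (C * ψ ^ (n + (loneValues κ).card)) := by
        rw [hint]
        refine (norm_sum_le _ _).trans (Finset.sum_le_sum fun κ _ => ?_)
        rw [norm_mul, norm_prod]
        simp only [norm_conjIf]
        exact mul_le_mul_of_nonneg_left (hC hW hR hK σ κ)
          (Finset.prod_nonneg fun r _ => norm_nonneg _)
    _ = C * ψ ^ n * ∑ κ : Fin n → Fin N, (∏ r, ‖t (κ r)‖) * ψ ^ (loneValues κ).card := by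
        rw [Finset.mul_sum]
        refine Finset.sum_congr rfl fun κ _ => ?_
        rw [pow_add]
        ring
    _ ≤ C * ψ ^ n * (n.factorial * ψ ^ n) := by
        gcongr
        exact sum_prod_mul_pow_loneValues_le (t := fun k => ‖t k‖) (fun k => norm_nonneg _)
          (fun k => (ht k).trans hR.inv_bandParam_le) htsum hψ hR.le_one n
    _ = C * n.factorial * ψ ^ (4 * (q + 1)) := by
        rw [show 4 * (q + 1) = n + n by rw [hn]; ring, pow_add]
        ring

end Products

/-! ### From moments to stochastic domination -/

section Final

variable {N : ℕ} {Ω : Type*} [mΩ : MeasurableSpace Ω] {P : Measure Ω}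
  {H : Ω → Matrix (Fin N) (Fin N) ℂ} {δ : ℝ} {mom : ℕ → ℝ} {z : ℂ}

/-- The hypotheses of the theorem at a fixed large `N` provide a control regime. -/
theorem exists_controlRegime [IsProbabilityMeasure P] (hN : 2 ≤ N)
    (hW : IsGeneralizedWigner P H δ mom) {S : Set ℂ} (hS : IsSpectralDomain (bandParam P H) S)
    (hz : z ∈ S) {x y ε c c' : ℝ} {d b K : ℕ} (hε : 0 ≤ ε) (hc : 0 < c) (hc' : 0 < c')
    (hεc : ε ≤ δ * c / 2) (hεc' : ε ≤ δ * c' / 2)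
    (hx : x ≤ bandParam P H ^ (-c)) (hy : bandParam P H ^ (-(1 / 2 : ℝ)) ≤ y)
    (hy' : y ≤ bandParam P H ^ (-c')) (hb : 1 ≤ b * (δ * c' / 2))
    (hsmall : 4096 * (d + 1) * 4 ^ d * (N : ℝ) ^ (-(δ * c' / 2)) ≤ 1)
    (hsmall' : (N : ℝ) ^ (-(δ * c / 2)) ≤ 1 / 32)
    (h1 : P.real {ω | Lambda (H ω) z > (N : ℝ) ^ ε * x} ≤ (N : ℝ) ^ (-((K : ℝ) / 2 + 1)))
    (h2 : P.real {ω | LambdaO (H ω) z > (N : ℝ) ^ ε * y} ≤ (N : ℝ) ^ (-((K : ℝ) / 2 + 1))) :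
    ∃ B, ControlRegime P H z ((N : ℝ) ^ ε * y) d b K B := by
  have hN0 : (0 : ℝ) < N := by
    have : 0 < N := by omega
    exact_mod_cast this
  have hN1 : (1 : ℝ) ≤ N := by
    have : 1 ≤ N := by omega
    exact_mod_cast this
  have hN2 : (2 : ℝ) ≤ N := by exact_mod_cast hN
  set M := bandParam P H with hM
  have hM0 : 0 < M := (Real.rpow_pos_of_pos hN0 δ).trans_le hW.le_bandParam
  have hMpow : ∀ {c : ℝ}, 0 < c → M ^ (-c) ≤ (N : ℝ) ^ (-(δ * c)) := fun {c} hc => by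
    have h := Real.rpow_le_rpow_of_nonpos (Real.rpow_pos_of_pos hN0 δ) hW.le_bandParam
      (neg_nonpos.mpr hc.le)
    rwa [← Real.rpow_mul hN0.le, mul_neg] at h
  have hscale : ∀ {c v : ℝ}, 0 < c → ε ≤ δ * c / 2 → v ≤ M ^ (-c) →
      (N : ℝ) ^ ε * v ≤ (N : ℝ) ^ (-(δ * c / 2)) := fun {c v} hc hεc hv => by
    calc (N : ℝ) ^ ε * v ≤ (N : ℝ) ^ ε * (N : ℝ) ^ (-(δ * c)) := by
          gcongr
          exact hv.trans (hMpow hc)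
      _ = (N : ℝ) ^ (ε + -(δ * c)) := (Real.rpow_add hN0 _ _).symm
      _ ≤ _ := Real.rpow_le_rpow_of_exponent_le hN1 (by linarith)
  have hψle := hscale hc' hεc' hy'
  have hψx := hscale hc hεc hx
  set ψ := (N : ℝ) ^ ε * y with hψ
  have hy0 : 0 < y := (Real.rpow_pos_of_pos hM0 _).trans_le hy
  have hψ0 : 0 < ψ := mul_pos (Real.rpow_pos_of_pos hN0 _) hy0
  have hyψ : y ≤ ψ := le_mul_of_one_le_left hy0.le (Real.one_le_rpow hN1 hε)
  have hMψ : M ^ (-(1 / 2 : ℝ)) ≤ ψ := hy.trans hyψ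
  -- This turns a probability N^(-K/2) into ψ^K; the additional 1 in the assumed exponent absorbs
  -- the factor 2 of the union bound.
  have hNψ : (N : ℝ) ^ (-(1 / 2 : ℝ)) ≤ ψ :=
    (Real.rpow_le_rpow_of_nonpos hM0 hW.bandParam_le (by norm_num)).trans hMψ
  obtain ⟨hre, him, him'⟩ := hS z hz
  have him0 : 0 < z.im := (inv_pos.mpr hM0).trans_le him
  -- A measurable hull has the same measure and avoids showing that the event is measurable.
  refine ⟨toMeasurable P ({ω | Lambda (H ω) z > (N : ℝ) ^ ε * x} ∪
    {ω | LambdaO (H ω) z > ψ}), ?_⟩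
  have hout : ∀ ω ∉ toMeasurable P ({ω | Lambda (H ω) z > (N : ℝ) ^ ε * x} ∪
      {ω | LambdaO (H ω) z > ψ}), Lambda (H ω) z ≤ (N : ℝ) ^ ε * x ∧ LambdaO (H ω) z ≤ ψ := by
    intro ω hω
    have h : ω ∉ {ω | Lambda (H ω) z > (N : ℝ) ^ ε * x} ∪ {ω | LambdaO (H ω) z > ψ} :=
      fun h => hω (subset_toMeasurable _ _ h)
    simp only [Set.mem_union, Set.mem_ofPred_eq, not_or, not_lt, gt_iff_lt] at h
    exact h
  constructor
  · exact him0
  · refine abs_le_of_sq_le_sq' ?_ (by norm_num) |>.2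
    rw [← Complex.normSq_eq_norm_sq, Complex.normSq_apply]
    nlinarith [abs_le.mp hre]
  · exact (inv_le_of_inv_le₀ hM0 him).trans hW.bandParam_le
  · have h3 : ψ ^ b ≤ (N : ℝ) ^ (-(1 : ℝ)) := by
      calc ψ ^ b ≤ ((N : ℝ) ^ (-(δ * c' / 2))) ^ b := by gcongr
        _ = (N : ℝ) ^ (-(δ * c' / 2) * b) := by
            rw [← Real.rpow_natCast, ← Real.rpow_mul hN0.le]
        _ ≤ _ := Real.rpow_le_rpow_of_exponent_le hN1 (by linarith)
    calc (N : ℝ) * ψ ^ b ≤ N * (N : ℝ) ^ (-(1 : ℝ)) := by gcongr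
      _ = 1 := by rw [Real.rpow_neg_one, mul_inv_cancel₀ hN0.ne']
  · calc M⁻¹ = (M ^ (-(1 / 2 : ℝ))) ^ 2 := by
          rw [← Real.rpow_natCast, ← Real.rpow_mul hM0.le, ← Real.rpow_neg_one]
          norm_num
      _ ≤ ψ ^ 2 := by gcongr
  · exact hψ0
  · refine le_trans ?_ hsmall
    gcongr
  · exact measurableSet_toMeasurable _ _
  · exact fun ω hω => (hout ω hω).2
  · exact fun ω hω => (hout ω hω).1.trans (hψx.trans hsmall')
  · have h3 : P.real (toMeasurable P ({ω | Lambda (H ω) z > (N : ℝ) ^ ε * x} ∪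
        {ω | LambdaO (H ω) z > ψ})) = P.real ({ω | Lambda (H ω) z > (N : ℝ) ^ ε * x} ∪
        {ω | LambdaO (H ω) z > ψ}) := by
      rw [Measure.real, measure_toMeasurable, Measure.real]
    rw [h3]
    calc P.real ({ω | Lambda (H ω) z > (N : ℝ) ^ ε * x} ∪ {ω | LambdaO (H ω) z > ψ})
        ≤ (N : ℝ) ^ (-((K : ℝ) / 2 + 1)) + (N : ℝ) ^ (-((K : ℝ) / 2 + 1)) :=
          (measureReal_union_le _ _).trans (add_le_add h1 h2)
      _ = 2 * (N : ℝ) ^ (-((K : ℝ) / 2 + 1)) := (two_mul _).symm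
      _ ≤ (N : ℝ) ^ (1 : ℝ) * (N : ℝ) ^ (-((K : ℝ) / 2 + 1)) := by
          rw [Real.rpow_one]
          gcongr
      _ = ((N : ℝ) ^ (-(1 / 2 : ℝ))) ^ K := by
          rw [← Real.rpow_add hN0, ← Real.rpow_natCast, ← Real.rpow_mul hN0.le]
          congr 1
          ring
      _ ≤ ψ ^ K := by gcongr

/-- Markov's inequality for the weighted average of the fluctuations. -/
theorem measureReal_sum_fluct_gt_le [IsProbabilityMeasure P] (hW : IsGeneralizedWigner P H δ mom)
    (hz : 0 < z.im) (t : Fin N → ℂ) {C ψ y : ℝ} (hy : 0 < y) {n : ℕ}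
    (h : ∫ ω, ‖∑ k, t k * centredInv P H z k ∅ ω‖ ^ n ∂P ≤ C * ψ ^ (2 * n)) :
    P.real {ω | ‖∑ k, t k * fluct P H k (fun ω' => 1 / green (H ω') z k k) ω‖ > y}
      ≤ C * ψ ^ (2 * n) / y ^ n := by
  have hae : (fun ω => ‖∑ k, t k * fluct P H k (fun ω' => 1 / green (H ω') z k k) ω‖)
      =ᵐ[P] fun ω => ‖∑ k, t k * centredInv P H z k ∅ ω‖ := by
    have h1 := ae_all_iff.mpr fun k => hW.fluct_ae_eq hz k
    filter_upwards [h1] with ω hω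
    simp only [hω]
  have hset : P.real {ω | ‖∑ k, t k * fluct P H k (fun ω' => 1 / green (H ω') z k k) ω‖ > y}
      = P.real {ω | ‖∑ k, t k * centredInv P H z k ∅ ω‖ > y} := by
    refine measureReal_congr ?_
    filter_upwards [hae] with ω hω
    simp only [eq_iff_iff]
    exact Iff.of_eq (congrArg (· > y) hω)
  have hm : HasMoments P fun ω => ∑ k, t k * centredInv P H z k ∅ ω :=
    HasMoments.sum fun k _ => (hW.hasMoments_centredInv hz (Finset.notMem_empty k)).const_mul _
  have hmark := mul_meas_ge_le_integral_of_nonneg (μ := P)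
    (Filter.Eventually.of_forall fun ω => pow_nonneg (norm_nonneg _) n)
    (hm.integrable_norm_pow n) (y ^ n)
  rw [hset, le_div_iff₀ (pow_pos hy n), mul_comm]
  refine le_trans ?_ (hmark.trans h)
  refine mul_le_mul_of_nonneg_left (measureReal_mono fun ω hω => ?_) (by positivity)
  exact pow_le_pow_left₀ hy.le (le_of_lt hω) n

end Final

end LocalSemicircle

end

open LocalSemicircle in
/-- The index `a : A N` collects all parameters, other than the spectral parameter and the matrix
index, on which the model may depend (the probability space, the law of `H`, the domain, the control
parameters and the weights); all bounds are uniform in it. A single sequence of random matrices is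
the case in which every `A N` has one element. -/
theorem theorem4p7
    (δ : ℝ) (hδ : 0 < δ) (mom : ℕ → ℝ)
    {A : ℕ → Type*} {Ω : (N : ℕ) → A N → Type*} [∀ N a, MeasurableSpace (Ω N a)]
    (P : (N : ℕ) → (a : A N) → Measure (Ω N a)) [∀ N a, IsProbabilityMeasure (P N a)]
    (H : (N : ℕ) → (a : A N) → Ω N a → Matrix (Fin N) (Fin N) ℂ)
    (hH : ∀ N ≥ 1, ∀ a, IsGeneralizedWigner (P N a) (H N a) δ mom)
    (D : (N : ℕ) → A N → Set ℂ)
    (hD : ∀ N ≥ 1, ∀ a, IsSpectralDomain (bandParam (P N a) (H N a)) (D N a))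
    (Ψ Ψₒ : (N : ℕ) → A N → ℂ → ℝ)
    (hΨ : ∃ c > (0 : ℝ), ∀ N ≥ 1, ∀ a, IsAdmissible c (bandParam (P N a) (H N a)) (D N a) (Ψ N a))
    (hΨₒ : ∃ c > (0 : ℝ), ∀ N ≥ 1, ∀ a, IsAdmissible c (bandParam (P N a) (H N a)) (D N a) (Ψₒ N a))
    (T : (N : ℕ) → A N → Matrix (Fin N) (Fin N) ℂ)
    (hT : ∀ N ≥ 1, ∀ a, IsWeight (bandParam (P N a) (H N a)) (T N a))
    (hΛ : StochDom (fun N (u : Σ a : A N, D N a) => P N u.1)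
      (fun N u ω => Lambda (H N u.1 ω) u.2) (fun N u _ => Ψ N u.1 u.2))
    (hΛₒ : StochDom (fun N (u : Σ a : A N, D N a) => P N u.1)
      (fun N u ω => LambdaO (H N u.1 ω) u.2) (fun N u _ => Ψₒ N u.1 u.2)) :
    StochDom (fun N (u : (Σ a : A N, D N a) × Fin N) => P N u.1.1)
      (fun N u ω => ‖∑ k, T N u.1.1 u.2 k *
        fluct (P N u.1.1) (H N u.1.1) k (fun ω' => 1 / green (H N u.1.1 ω') u.1.2 k k) ω‖)
      (fun N u _ => Ψₒ N u.1.1 u.1.2 ^ 2) := by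
  obtain ⟨c, hc, hΨ⟩ := hΨ
  obtain ⟨c', hc', hΨₒ⟩ := hΨₒ
  intro ε hε D₀ hD₀
  -- The bound ε/4 keeps a factor N^(-ε/2) per power after Markov's inequality; the others keep N^ε₁
  -- Ψ and N^ε₁ Ψ_o below negative powers of N.
  set ε₁ := min (ε / 4) (min (δ * c / 2) (δ * c' / 2)) with hε₁
  have hε₁0 : 0 < ε₁ := by positivity
  have hε₁ε : ε₁ ≤ ε / 4 := min_le_left _ _
  have hε₁c : ε₁ ≤ δ * c / 2 := (min_le_right _ _).trans (min_le_left _ _)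
  have hε₁c' : ε₁ ≤ δ * c' / 2 := (min_le_right _ _).trans (min_le_right _ _)
  -- With n = 2(q+1), the gain N^(-nε/2) is at most N^(-(D₀+1)); the additional power of N absorbs
  -- the constant C ≤ N.
  obtain ⟨q, hq⟩ := exists_nat_ge ((D₀ + 1) / ε)
  obtain ⟨b, hb⟩ := exists_nat_ge (1 / (δ * c' / 2))
  have hb' : 1 ≤ b * (δ * c' / 2) := by
    rwa [div_le_iff₀ (by positivity)] at hb
  have hq' : D₀ + 1 ≤ (q + 1) * ε := by
    rw [div_le_iff₀ hε] at hq
    linarith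
  obtain ⟨C, hC1, hC⟩ := exists_integral_norm_sum_centredInv_pow_le q b mom
  set d := 2 * (q + 1) + 1 with hd
  set K := 2 * (2 * (q + 1) * (2 * (q + 1) + 1)) + 4 * (q + 1) * b with hK
  obtain ⟨N₁, hN₁⟩ := hΛ ε₁ hε₁0 ((K : ℝ) / 2 + 1) (by positivity)
  obtain ⟨N₂, hN₂⟩ := hΛₒ ε₁ hε₁0 ((K : ℝ) / 2 + 1) (by positivity)
  have hlim : ∀ a > (0 : ℝ), ∀ r > (0 : ℝ), ∀ᶠ N : ℕ in Filter.atTop, (N : ℝ) ^ (-a) ≤ r :=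
    fun a ha r hr => ((tendsto_rpow_neg_atTop ha).comp
      tendsto_natCast_atTop_atTop).eventually_le_const hr
  obtain ⟨N₃, hN₃⟩ := Filter.eventually_atTop.mp
    (hlim (δ * c' / 2) (by positivity) ((4096 * ((d : ℝ) + 1) * 4 ^ d)⁻¹) (by positivity))
  obtain ⟨N₄, hN₄⟩ := Filter.eventually_atTop.mp
    (hlim (δ * c / 2) (by positivity) (1 / 32) (by norm_num))
  obtain ⟨N₅, hN₅⟩ := exists_nat_ge C
  refine ⟨N₁ + N₂ + N₃ + N₄ + N₅ + 2, fun N hN u => ?_⟩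
  obtain ⟨⟨a, z, hz⟩, i⟩ := u
  have hN2 : 2 ≤ N := by omega
  have hN1 : 1 ≤ N := by omega
  have hN0 : (0 : ℝ) < N := by exact_mod_cast hN1
  have hN1' : (1 : ℝ) ≤ N := by exact_mod_cast hN1
  have hW := hH N hN1 a
  have hsmall : 4096 * ((d : ℝ) + 1) * 4 ^ d * (N : ℝ) ^ (-(δ * c' / 2)) ≤ 1 := by
    have h := hN₃ N (by omega)
    rwa [← one_div, le_div_iff₀ (by positivity), mul_comm] at h
  obtain ⟨hy, hy'⟩ := hΨₒ N hN1 a z hz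
  obtain ⟨B, hB⟩ := exists_controlRegime (d := d) (b := b) (K := K) hN2 hW (hD N hN1 a) hz hε₁0.le
    hc hc' hε₁c hε₁c' (hΨ N hN1 a z hz).2 hy hy' hb' hsmall (hN₄ N (by omega))
    (hN₁ N (by omega) ⟨a, z, hz⟩) (hN₂ N (by omega) ⟨a, z, hz⟩)
  obtain ⟨hT1, hT2⟩ := hT N hN1 a
  have hmom := hC hW hB le_rfl (t := T N a i) (hT1 i) (hT2 i)
  rw [show 4 * (q + 1) = 2 * (2 * (q + 1)) by ring] at hmom
  have hM0 : 0 < bandParam (P N a) (H N a) :=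
    (Real.rpow_pos_of_pos hN0 δ).trans_le hW.le_bandParam
  have hy0 : 0 < Ψₒ N a z := (Real.rpow_pos_of_pos hM0 _).trans_le hy
  refine (measureReal_sum_fluct_gt_le hW hB.im_pos (T N a i)
    (mul_pos (Real.rpow_pos_of_pos hN0 ε) (pow_pos hy0 2)) hmom).trans ?_
  have hCN : C ≤ (N : ℝ) ^ (1 : ℝ) := by
    rw [Real.rpow_one]
    exact hN₅.trans (by exact_mod_cast (by omega : N₅ ≤ N))
  set n := 2 * (q + 1) with hn
  -- The moment is of order ψ^(2n), so the powers of Ψ_o cancel exactly and only a power of N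
  -- remains.
  have hratio : C * ((N : ℝ) ^ ε₁ * Ψₒ N a z) ^ (2 * n) / ((N : ℝ) ^ ε * Ψₒ N a z ^ 2) ^ n
      = C * (N : ℝ) ^ ((2 * ε₁ - ε) * n) := by
    have h1 : ((N : ℝ) ^ ε₁ * Ψₒ N a z) ^ (2 * n)
        = (N : ℝ) ^ (2 * ε₁ * n) * (Ψₒ N a z ^ 2) ^ n := by
      rw [mul_pow, ← pow_mul, ← Real.rpow_natCast ((N : ℝ) ^ ε₁), ← Real.rpow_mul hN0.le]
      congr 2
      push_cast
      ring
    have h2 : ((N : ℝ) ^ ε * Ψₒ N a z ^ 2) ^ n = (N : ℝ) ^ (ε * n) * (Ψₒ N a z ^ 2) ^ n := by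
      rw [mul_pow, ← Real.rpow_natCast ((N : ℝ) ^ ε), ← Real.rpow_mul hN0.le]
    rw [h1, h2, sub_mul, Real.rpow_sub hN0]
    have h3 : (Ψₒ N a z ^ 2) ^ n ≠ 0 := (pow_pos (pow_pos hy0 2) n).ne'
    have h4 : (N : ℝ) ^ (ε * n) ≠ 0 := (Real.rpow_pos_of_pos hN0 _).ne'
    field_simp
  rw [hratio]
  calc C * (N : ℝ) ^ ((2 * ε₁ - ε) * n) ≤ (N : ℝ) ^ (1 : ℝ) * (N : ℝ) ^ (-(D₀ + 1)) := by
        refine mul_le_mul hCN (Real.rpow_le_rpow_of_exponent_le hN1' ?_) (by positivity)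
          (by positivity)
        have hnn : (n : ℝ) = 2 * (q + 1) := by
          rw [hn]
          push_cast
          ring
        rw [hnn]
        have hq0 : (0 : ℝ) ≤ q := Nat.cast_nonneg q
        have h5 : (2 * ε₁ - ε) * (2 * (q + 1)) ≤ (-(ε / 2)) * (2 * ((q : ℝ) + 1)) :=
          mul_le_mul_of_nonneg_right (by linarith) (by positivity)
        linarith
    _ = (N : ℝ) ^ (-D₀) := by
        rw [← Real.rpow_add hN0]
        congr 1
        ring
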